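/- Let $K(x)=\frac{x_1^2+x_2^2-2x_3^2}{|x|^5}$ be the dipole kernel on $\mathbb R^3$, let $K\ast\rho$ denote the (principal value) singular convolution, and for $f\in H^1(\mathbb R^3)=H^1(\mathbb R^3;\mathbb C)$ put $$N(f)=-\lambda_1\|f\|_{L^4}^4-\lambda_2\int_{\mathbb R^3}(K\ast|f|^2)|f|^2\,dx .$$ Let $\lambda_1,\lambda_2\in\mathbb R$ belong to the unstable regime: $\lambda_1-\frac{4\pi}{3}\lambda_2<0$ if $\lambda_2\ge 0$, and $\lambda_1+\frac{8\pi}{3}\lambda_2<0$ if $\lambda_2\le 0$. Let $0<\alpha<\infty$ and define $C_\alpha$ by $$C_\alpha^{-1}=\inf\left\{\frac{\|f\|_{L^2}\|\nabla f\|_{L^2}^{\frac{3}{1+\alpha}}\|f\|_{L^6}^{\frac{3\alpha}{1+\alpha}}}{N(f)} : f\in H^1(\mathbb R^3),\ N(f)>0\right\}.$$ Then $0<C_\alpha<\infty$, and $C_\alpha$ is the sharp (smallest) constant in the $\alpha$-Gagliardo–Nirenberg–Hölder inequality $$N(f)\le C_\alpha\,\|f\|_{L^2}\|\nabla f\|_{L^2}^{\frac{3}{1+\alpha}}\|f\|_{L^6}^{\frac{3\alpha}{1+\alpha}}\qquad\text{for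 all } f\in H^1(\mathbb R^3).$$ Moreover, the infimum is attained at some $Q_\alpha\in H^1(\mathbb R^3)$ which, for some $\omega\in\mathbb R$, is a weak solution of $$-\Delta Q+\lambda_1|Q|^2Q+\lambda_2(K\ast|Q|^2)Q+|Q|^4Q+\omega Q=0$$ and which satisfies $\|Q_\alpha\|_{L^6}^6=\alpha\|\nabla Q_\alpha\|_{L^2}^2$; and for every such $Q_\alpha$, $$C_\alpha=\frac{4(1+\alpha)}{3\,\alpha^{\frac{\alpha}{2(1+\alpha)}}}\;\frac{\|\nabla Q_\alpha\|_{L^2}^{\frac{\alpha-1}{\alpha+1}}}{\|Q_\alpha\|_{L^2}} .$$ -/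

import Mathlib

open MeasureTheory Filter Topology
open scoped ContDiff

noncomputable section

namespace DipolarNLS

/-- The Euclidean space `ℝ³`. -/
abbrev E3 : Type := EuclideanSpace ℝ (Fin 3)

/-- Real-valued test functions: smooth with compact support. -/
def IsTest (φ : E3 → ℝ) : Prop := ContDiff ℝ ∞ φ ∧ HasCompactSupport φ

/-- The `i`-th classical partial derivative of a test function. -/
def partialD (i : Fin 3) (φ : E3 → ℝ) (x : E3) : ℝ :=
  fderiv ℝ φ x (EuclideanSpace.single i (1 : ℝ))

/-- `g` is a square-integrable weak gradient of the complex-valued function `f`. -/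
def HasWeakGradient (f : E3 → ℂ) (g : E3 → EuclideanSpace ℂ (Fin 3)) : Prop :=
  MemLp g 2 volume ∧
    ∀ φ : E3 → ℝ, IsTest φ → ∀ i : Fin 3,
      ∫ x, f x * (partialD i φ x : ℂ) = - ∫ x, g x i * (φ x : ℂ)

/-- Membership in the Sobolev space `H¹(ℝ³)` of complex-valued functions. -/
def MemH1 (f : E3 → ℂ) : Prop :=
  MemLp f 2 volume ∧ ∃ g, HasWeakGradient f g

open Classical in
/-- The weak gradient of `f` (unique almost everywhere); zero if there is none. -/
def weakGrad (f : E3 → ℂ) : E3 → EuclideanSpace ℂ (Fin 3) :=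
  if h : ∃ g, HasWeakGradient f g then h.choose else 0

/-- The `L^p` norm of `f`. -/
def normL (p : ENNReal) (f : E3 → ℂ) : ℝ := lpNorm f p volume

/-- The `L²` norm of the weak gradient of `f`. -/
def normGrad (f : E3 → ℂ) : ℝ := lpNorm (weakGrad f) 2 volume

/-- The dipole kernel with dipole axis `(0,0,1)`:
`K(x) = (1 - 3 cos² θ) / |x|³ = (x₁² + x₂² - 2 x₃²) / |x|⁵`. -/
def dipoleKernel (x : E3) : ℝ := (x 0 ^ 2 + x 1 ^ 2 - 2 * x 2 ^ 2) / ‖x‖ ^ 5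

/-- Convolution of `ρ` with the kernel truncated to `{|x| > ε}`. -/
def truncConv (ε : ℝ) (ρ : E3 → ℝ) (x : E3) : ℝ :=
  ∫ y in {y : E3 | ε < ‖x - y‖}, dipoleKernel (x - y) * ρ y

/-- `g` is the principal-value convolution `K ∗ ρ`, the limit of the truncated convolutions
being taken in `L²(ℝ³)`. -/
def IsDipoleConv (ρ g : E3 → ℝ) : Prop :=
  MemLp g 2 volume ∧
    Tendsto (fun ε : ℝ => eLpNorm (fun x => truncConv ε ρ x - g x) 2 volume)
      (𝓝[>] (0 : ℝ)) (𝓝 0)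

open Classical in
/-- The singular convolution `K ∗ ρ` (unique almost everywhere). By Calderón–Zygmund theory the
`L²` limit exists for every `ρ ∈ L¹ ∩ L²`, in particular for `ρ = |f|²` with `f ∈ H¹(ℝ³)`. -/
def dipoleConv (ρ : E3 → ℝ) : E3 → ℝ :=
  if h : ∃ g, IsDipoleConv ρ g then h.choose else 0

/-- The density `|f|²`. -/
def density (f : E3 → ℂ) (x : E3) : ℝ := ‖f x‖ ^ 2

/-- `N(f) = -λ₁ ‖f‖_{L⁴}⁴ - λ₂ ∫ (K ∗ |f|²) |f|²`. -/
def N (l₁ l₂ : ℝ) (f : E3 → ℂ) : ℝ :=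
  - l₁ * normL 4 f ^ 4 - l₂ * ∫ x, dipoleConv (density f) x * density f x

/-- The unstable regime: `λ₁ - (4π/3) λ₂ < 0` if `λ₂ > 0` and `λ₁ + (8π/3) λ₂ < 0` if `λ₂ < 0`.
For `λ₂ = 0` both conditions read `λ₁ < 0`. -/
def Unstable (l₁ l₂ : ℝ) : Prop :=
  (0 ≤ l₂ → l₁ - 4 * Real.pi / 3 * l₂ < 0) ∧ (l₂ ≤ 0 → l₁ + 8 * Real.pi / 3 * l₂ < 0)

/-- `‖f‖_{L²} ‖∇f‖_{L²}^{3/(1+α)} ‖f‖_{L⁶}^{3α/(1+α)}`. -/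
def gnProduct (α : ℝ) (f : E3 → ℂ) : ℝ :=
  normL 2 f * normGrad f ^ (3 / (1 + α)) * normL 6 f ^ (3 * α / (1 + α))

/-- The admissible class `{f ∈ H¹(ℝ³) : N(f) > 0}`. -/
def admissible (l₁ l₂ : ℝ) : Set (E3 → ℂ) := {f | MemH1 f ∧ 0 < N l₁ l₂ f}

/-- The Weinstein functional. -/
def weinstein (l₁ l₂ α : ℝ) (f : E3 → ℂ) : ℝ := gnProduct α f / N l₁ l₂ f

/-- The constant `C_α`, given by `C_α⁻¹ = inf W` over the admissible class. -/
def sharpConst (l₁ l₂ α : ℝ) : ℝ :=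
  (sInf (weinstein l₁ l₂ α '' admissible l₁ l₂))⁻¹

/-- `f` attains the infimum of the Weinstein functional. -/
def IsOptimizer (l₁ l₂ α : ℝ) (f : E3 → ℂ) : Prop :=
  f ∈ admissible l₁ l₂ ∧ IsMinOn (weinstein l₁ l₂ α) (admissible l₁ l₂) f

/-- `Q ∈ H¹(ℝ³)` is a weak solution of
`-ΔQ + λ₁ |Q|² Q + λ₂ (K ∗ |Q|²) Q + |Q|⁴ Q + w Q = 0`. -/
def IsStandingWave (l₁ l₂ w : ℝ) (Q : E3 → ℂ) : Prop :=
  MemH1 Q ∧ ∀ φ : E3 → ℝ, IsTest φ →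
    (∫ x, ∑ i : Fin 3, weakGrad Q x i * (partialD i φ x : ℂ)) +
      ∫ x, ((l₁ * density Q x + l₂ * dipoleConv (density Q) x + density Q x ^ 2 + w : ℝ) : ℂ)
        * Q x * (φ x : ℂ) = 0

/-- A normalized optimizer `Q_α`: an optimizer that solves the stationary equation for some
frequency `w` and satisfies `‖Q_α‖_{L⁶}⁶ = α ‖∇Q_α‖_{L²}²`. -/
def IsNormalizedOptimizer (l₁ l₂ α : ℝ) (Q : E3 → ℂ) : Prop :=
  IsOptimizer l₁ l₂ α Q ∧ (∃ w : ℝ, IsStandingWave l₁ l₂ w Q) ∧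
    normL 6 Q ^ 6 = α * normGrad Q ^ 2

/-- `(4(1+α) / (3 α^{α/(2(1+α))})) ‖∇Q‖_{L²}^{(α-1)/(α+1)} / ‖Q‖_{L²}`. -/
def explicitConst (α : ℝ) (Q : E3 → ℂ) : ℝ :=
  4 * (1 + α) / (3 * α ^ (α / (2 * (1 + α)))) *
    (normGrad Q ^ ((α - 1) / (α + 1)) / normL 2 Q)

end DipolarNLS

end

open MeasureTheory Filter Topology
open scoped ContDiff

noncomputable section

set_option linter.unusedSectionVars false

namespace DipolarNLS

open scoped ENNReal NNReal

/-! ### Minkowski's inequality in L² -/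

section LpTools

variable {α β F : Type*} [MeasurableSpace α] [MeasurableSpace β] [NormedAddCommGroup F]

/-! Write ρ = |f|² and V = -λ₁ - λ₂ K∗. The first point is that K∗ is the bounded symmetric operator
(4π/3)(3∂₃²Δ⁻¹ - 1) on L². This is obtained without the Fourier transform. The operator ∂₃²Δ⁻¹ is
defined on Laplacians of test functions, which are dense in L² by a Liouville theorem. The field of
a uniformly charged ball then yields an exact identity (`avg_truncK`): convolution with the kernel
cut off at radius ε is 4π/3 times the mean over balls of radius ε of (3∂₃²Δ⁻¹ - 1)ρ. Letting ε tend
to 0 gives `isDipoleConv_dipoleOp`, and N(f) = ⟨Vρ, ρ⟩ (`H1Data.N_eq`). Stretching a density along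
x₃ drives ∂₃²Δ⁻¹ towards 0 (cigar) or 1 (pancake); the unstable regime says that the limiting
quadratic form is positive in the relevant case (`exists_admissible`).

Let P be the Gagliardo–Nirenberg product and m the infimum of P/N. Positivity of m follows from N(f)
≤ ‖V‖ ‖f‖₂ ‖f‖₆³ and Sobolev. Since P and N scale alike under f ↦ μ f(κx + v), a minimizing sequence
can be normalized to have unit mass and unit gradient energy. It stays away from zero in L⁴, so
suitable translates have a nonzero weak limit f in H¹. Mass, gradient energy and N split exactly
between f and the remainder, while ∫|f|⁶ splits with an inequality in the useful direction. As a
function of these quantities P has total degree (2+α)/(1+α) > 1 and is superadditive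
(`gnFun_superadditive`). Applying the sharp inequality to the remainder leaves P(f) ≤ m N(f)
(`gnFun_le_of_weak_limit`), so f is an optimizer, and strong convergence is never needed.

The functional P - mN is nonnegative on H¹ and vanishes at an optimizer; its first variation is the
Euler–Lagrange equation (`euler_lagrange`). The two scaling parameters bring its cubic and quintic
coefficients to 1, which gives Q_α.

The formula for C_α amounts to 3N(Q) = 4(1+α)‖∇Q‖² for every normalized optimizer Q
(`IsNormalizedOptimizer.N_eq`). Such a Q solves the prescribed equation and also the Euler–Lagrange
equation, whose cubic coefficient is B = 4(1+α)‖∇Q‖²/(3N(Q)). If B ≠ 1, subtraction makes the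
potential constant where Q ≠ 0. Then |Q|, which is an optimizer too, solves -Δu = Ku - su⁵ with K∫u²
> s∫u⁶, and integrating this equation against large cutoffs shows that it is impossible
(`not_exists_nonneg_solution`). No Pohozaev identity is used. -/

theorem eLpNorm_two_sq (f : α → F) (μ : Measure α) :
    eLpNorm f 2 μ ^ 2 = ∫⁻ x, ‖f x‖ₑ ^ 2 ∂μ := by
  have h := eLpNorm_nnreal_pow_eq_lintegral (f := f) (μ := μ) (p := 2) two_ne_zero
  simpa using h

/-- Minkowski's integral inequality in `L²`, with a uniform bound on the fibres. -/
theorem eLpNorm_integral_le [NormedSpace ℝ F] (μ : Measure α) [SFinite μ] (ν : Measure β)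
    [IsProbabilityMeasure ν] (G : α → β → F)
    (hG : AEStronglyMeasurable (Function.uncurry G) (μ.prod ν)) (C : ℝ≥0∞)
    (h : ∀ᵐ y ∂ν, eLpNorm (fun x => G x y) 2 μ ≤ C) :
    eLpNorm (fun x => ∫ y, G x y ∂ν) 2 μ ≤ C := by
  have key : eLpNorm (fun x => ∫ y, G x y ∂ν) 2 μ ^ 2 ≤ C ^ 2 := by
    rw [eLpNorm_two_sq]
    have hm := hG.prodMk_left
    calc ∫⁻ x, ‖∫ y, G x y ∂ν‖ₑ ^ 2 ∂μ ≤ ∫⁻ x, ∫⁻ y, ‖G x y‖ₑ ^ 2 ∂ν ∂μ := by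
          apply lintegral_mono_ae
          filter_upwards [hm] with x hx
          have h1 : ‖∫ y, G x y ∂ν‖ₑ ≤ eLpNorm (G x) 1 ν := by
            rw [eLpNorm_one_eq_lintegral_enorm]; exact enorm_integral_le_lintegral_enorm _
          -- Total mass one of `ν` is what makes this comparison constant-free.
          have h2 : eLpNorm (G x) 1 ν ≤ eLpNorm (G x) 2 ν :=
            eLpNorm_le_eLpNorm_of_exponent_le (by norm_num) hx
          calc ‖∫ y, G x y ∂ν‖ₑ ^ 2 ≤ eLpNorm (G x) 2 ν ^ 2 := by gcongr; exact h1.trans h2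
            _ = _ := eLpNorm_two_sq _ _
      _ = ∫⁻ y, ∫⁻ x, ‖G x y‖ₑ ^ 2 ∂μ ∂ν := by
          apply lintegral_lintegral_swap
          exact (hG.enorm.pow_const 2)
      _ ≤ ∫⁻ y, C ^ 2 ∂ν := by
          apply lintegral_mono_ae
          filter_upwards [h] with y hy
          rw [← eLpNorm_two_sq]
          gcongr
      _ = C ^ 2 := by simp
  exact (ENNReal.pow_le_pow_left_iff two_ne_zero).mp key

end LpTools

/-! ### Continuity of translations in L² -/

section Translation

variable {F : Type*} [NormedAddCommGroup F]

theorem aestronglyMeasurable_comp_sub {f : E3 → F} (hf : AEStronglyMeasurable f volume)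
    {ν : Measure E3} [SFinite ν] (hν : ν ≪ volume) :
    AEStronglyMeasurable (fun p : E3 × E3 => f (p.1 - p.2)) (volume.prod ν) := by
  have h1 : Measure.QuasiMeasurePreserving (fun p : E3 × E3 => p.1 - p.2)
      ((volume : Measure E3).prod volume) volume := quasiMeasurePreserving_sub _ _
  have h2 := hf.comp_quasiMeasurePreserving h1
  exact h2.mono_ac (Measure.AbsolutelyContinuous.rfl.prod hν)

theorem eLpNorm_comp_sub_right (f : E3 → F) (hf : AEStronglyMeasurable f volume) (p : ℝ≥0∞)
    (y : E3) : eLpNorm (fun x => f (x - y)) p volume = eLpNorm f p volume :=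
  eLpNorm_comp_measurePreserving (f := fun x : E3 => x - y) hf (measurePreserving_sub_right _ y)

/-- Translations form a continuous family of measure-preserving maps, and composition with such a
family acts continuously on `Lp`. -/
theorem tendsto_eLpNorm_translation {f : E3 → F} (hf : MemLp f 2 volume) :
    Tendsto (fun y : E3 => eLpNorm (fun x => f (x - y) - f x) 2 volume) (𝓝 0) (𝓝 0) := by
  have hc : Continuous (fun y : E3 => (⟨fun x : E3 => x - y, by fun_prop⟩ : C(E3, E3))) := by
    apply ContinuousMap.continuous_of_continuous_uncurry
    simp only [Function.uncurry_def, ContinuousMap.coe_mk]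
    fun_prop
  have key := Continuous.compMeasurePreservingLp (p := 2) (μ := (volume : Measure E3))
    (ν := (volume : Measure E3)) (f := fun _ : E3 => hf.toLp f) continuous_const hc
    (fun y => measurePreserving_sub_right _ y) (by norm_num)
  have h0 := (key.sub (continuous_const (y := hf.toLp f))).enorm.tendsto 0
  have h1 : ∀ y : E3, ‖Lp.compMeasurePreserving (fun x : E3 => x - y)
      (measurePreserving_sub_right volume y) (hf.toLp f) - hf.toLp f‖ₑ
      = eLpNorm (fun x => f (x - y) - f x) 2 volume := by
    intro y
    rw [Lp.toLp_compMeasurePreserving hf (measurePreserving_sub_right volume y),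
      ← MemLp.toLp_sub, Lp.enorm_toLp]
    rfl
  have h2 : ‖Lp.compMeasurePreserving (fun x : E3 => x - 0)
      (measurePreserving_sub_right volume 0) (hf.toLp f) - hf.toLp f‖ₑ = 0 := by
    rw [h1]; simp
  rw [← h2]
  exact h0.congr h1

end Translation

/-! ### Averaging by shrinking kernels -/

section Average

variable {F : Type*} [NormedAddCommGroup F] [NormedSpace ℝ F] [CompleteSpace F]

/-- A bounded probability density supported in the ball of radius `δ`. -/
structure IsKernel (δ : ℝ) (η : E3 → ℝ) : Prop where
  measurable : Measurable η
  nonneg : ∀ y, 0 ≤ η y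
  bdd : ∃ C, ∀ y, η y ≤ C
  supp : ∀ y, δ < ‖y‖ → η y = 0
  mass : ∫ y, η y = 1

/-- The convolution `η ∗ f`. -/
def avg (η : E3 → ℝ) (f : E3 → F) (x : E3) : F := ∫ z, η (x - z) • f z

theorem avg_eq (η : E3 → ℝ) (f : E3 → F) (x : E3) : avg η f x = ∫ y, η y • f (x - y) := by
  rw [avg, ← integral_sub_left_eq_self (fun z => η (x - z) • f z) volume x]
  simp

theorem IsKernel.integrable {δ : ℝ} {η : E3 → ℝ} (h : IsKernel δ η) : Integrable η := by
  apply Integrable.of_integral_ne_zero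
  rw [h.mass]; exact one_ne_zero

theorem IsKernel.memLp_two {δ : ℝ} {η : E3 → ℝ} (h : IsKernel δ η) : MemLp η 2 volume := by
  rw [memLp_two_iff_integrable_sq h.measurable.aestronglyMeasurable]
  obtain ⟨C, hC⟩ := h.bdd
  refine (h.integrable.const_mul C).mono' (h.measurable.pow_const 2).aestronglyMeasurable ?_
  filter_upwards with x
  rw [Real.norm_of_nonneg (sq_nonneg _), sq]
  exact mul_le_mul_of_nonneg_right (hC x) (h.nonneg x)

theorem measurePreserving_sub_left' (x : E3) : MeasurePreserving (fun z : E3 => x - z) :=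
  Measure.measurePreserving_sub_left volume x

theorem memLp_comp_sub_left {η : E3 → F} {p : ℝ≥0∞} (h : MemLp η p volume) (x : E3) :
    MemLp (fun z => η (x - z)) p volume :=
  h.comp_measurePreserving (measurePreserving_sub_left' x)

theorem integrable_avg {η : E3 → ℝ} (hη : MemLp η 2 volume) {f : E3 → F} (hf : MemLp f 2 volume)
    (x : E3) : Integrable (fun y => η y • f (x - y)) := by
  rw [← memLp_one_iff_integrable]
  exact (memLp_comp_sub_left hf x).smul hη

theorem integrable_avg' {η : E3 → ℝ} (hη : MemLp η 2 volume) {f : E3 → F} (hf : MemLp f 2 volume)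
    (x : E3) : Integrable (fun y => η (x - y) • f y) := by
  rw [← memLp_one_iff_integrable]
  exact hf.smul (memLp_comp_sub_left hη x)

/-- The probability measure with density `η`. -/
def kernelMeasure (η : E3 → ℝ) : Measure E3 := volume.withDensity (fun y => ENNReal.ofReal (η y))

theorem IsKernel.isProbabilityMeasure {δ : ℝ} {η : E3 → ℝ} (h : IsKernel δ η) :
    IsProbabilityMeasure (kernelMeasure η) := by
  constructor
  rw [kernelMeasure, withDensity_apply _ MeasurableSet.univ, Measure.restrict_univ,
    ← ofReal_integral_eq_lintegral_ofReal h.integrable (ae_of_all _ h.nonneg), h.mass]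
  simp

theorem kernelMeasure_ac (η : E3 → ℝ) : kernelMeasure η ≪ volume :=
  withDensity_absolutelyContinuous _ _

theorem IsKernel.integral_kernelMeasure {δ : ℝ} {η : E3 → ℝ} (h : IsKernel δ η) (g : E3 → F) :
    ∫ y, g y ∂(kernelMeasure η) = ∫ y, η y • g y := by
  rw [kernelMeasure, integral_withDensity_eq_integral_toReal_smul h.measurable.ennreal_ofReal
    (by simp)]
  simp [h.nonneg]

theorem IsKernel.ae_norm_le {δ : ℝ} {η : E3 → ℝ} (h : IsKernel δ η) :
    ∀ᵐ y ∂(kernelMeasure η), ‖y‖ ≤ δ := by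
  rw [kernelMeasure, ae_withDensity_iff h.measurable.ennreal_ofReal]
  filter_upwards with y hy
  by_contra hlt
  push Not at hlt
  simp [h.supp y hlt] at hy

/-- Because `η` has mass one, the error is the η-average of the differences f(· - y) - f with ‖y‖ ≤
δ, and Minkowski bounds it by the worst of them. Kernels need not be smooth: normalized indicators
of balls are used later as well as mollifiers. -/
theorem IsKernel.eLpNorm_avg_sub_le {δ : ℝ} {η : E3 → ℝ} (h : IsKernel δ η) {f : E3 → F}
    (hf : MemLp f 2 volume) (C : ℝ≥0∞)
    (hC : ∀ y : E3, ‖y‖ ≤ δ → eLpNorm (fun x => f (x - y) - f x) 2 volume ≤ C) :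
    eLpNorm (fun x => avg η f x - f x) 2 volume ≤ C := by
  have := h.isProbabilityMeasure
  have h1 : (fun x => avg η f x - f x) = fun x => ∫ y, (f (x - y) - f x) ∂(kernelMeasure η) := by
    funext x
    rw [h.integral_kernelMeasure]
    simp only [smul_sub]
    rw [integral_sub (integrable_avg h.memLp_two hf x) (h.integrable.smul_const _), avg_eq,
      integral_smul_const, h.mass, one_smul]
  rw [h1]
  refine eLpNorm_integral_le volume (kernelMeasure η) _ ?_ C ?_
  · exact (aestronglyMeasurable_comp_sub hf.1 (kernelMeasure_ac η)).sub hf.1.comp_fst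
  · filter_upwards [h.ae_norm_le] with y hy using hC y hy

theorem IsKernel.eLpNorm_avg_le {δ : ℝ} {η : E3 → ℝ} (h : IsKernel δ η) {f : E3 → F}
    (hf : MemLp f 2 volume) : eLpNorm (avg η f) 2 volume ≤ eLpNorm f 2 volume := by
  have := h.isProbabilityMeasure
  have h1 : avg η f = fun x => ∫ y, f (x - y) ∂(kernelMeasure η) := by
    funext x
    rw [h.integral_kernelMeasure, avg_eq]
  rw [h1]
  refine eLpNorm_integral_le volume (kernelMeasure η) _ ?_ _ ?_
  · exact (aestronglyMeasurable_comp_sub hf.1 (kernelMeasure_ac η))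
  · filter_upwards with y using (eLpNorm_comp_sub_right f hf.1 2 y).le

theorem IsKernel.memLp_avg {δ : ℝ} {η : E3 → ℝ} (h : IsKernel δ η) {f : E3 → F}
    (hf : MemLp f 2 volume) : MemLp (avg η f) 2 volume := by
  refine ⟨?_, (h.eLpNorm_avg_le hf).trans_lt hf.2⟩
  have := h.isProbabilityMeasure
  have h1 : avg η f = fun x => ∫ y, f (x - y) ∂(kernelMeasure η) := by
    funext x
    rw [h.integral_kernelMeasure, avg_eq]
  rw [h1]
  exact (aestronglyMeasurable_comp_sub hf.1 (kernelMeasure_ac η)).integral_prod_right'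

/-- Averages over shrinking kernels converge in `L²`. -/
theorem tendsto_eLpNorm_avg_sub {ι : Type*} {l : Filter ι} {δ : ι → ℝ} {η : ι → E3 → ℝ}
    (h : ∀ᶠ i in l, IsKernel (δ i) (η i)) (hδ : Tendsto δ l (𝓝 0)) {f : E3 → F}
    (hf : MemLp f 2 volume) :
    Tendsto (fun i => eLpNorm (fun x => avg (η i) f x - f x) 2 volume) l (𝓝 0) := by
  rw [ENNReal.tendsto_nhds_zero]
  intro e he
  have h1 := ENNReal.tendsto_nhds_zero.mp (tendsto_eLpNorm_translation hf) e he
  rw [Metric.eventually_nhds_iff] at h1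
  obtain ⟨r, hr, h2⟩ := h1
  filter_upwards [h, hδ.eventually (gt_mem_nhds hr)] with i hi hi2
  exact hi.eLpNorm_avg_sub_le hf e fun y hy => h2 (by simpa using hy.trans_lt hi2)

end Average

/-! ### Calculus of test functions -/

section TestFunctions

/-- The `i`-th standard basis vector. -/
abbrev ee (i : Fin 3) : E3 := EuclideanSpace.single i (1 : ℝ)

variable {F : Type*} [NormedAddCommGroup F] [NormedSpace ℝ F]

/-- The `i`-th classical partial derivative of a vector-valued function. -/
def pd (i : Fin 3) (u : E3 → F) (x : E3) : F := fderiv ℝ u x (ee i)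

theorem pd_eq_partialD (i : Fin 3) (u : E3 → ℝ) : pd i u = partialD i u := rfl

theorem IsTest.differentiable {φ : E3 → ℝ} (h : IsTest φ) : Differentiable ℝ φ :=
  h.1.differentiable (by simp)

theorem IsTest.continuous {φ : E3 → ℝ} (h : IsTest φ) : Continuous φ := h.1.continuous

theorem IsTest.memLp {φ : E3 → ℝ} (h : IsTest φ) (p : ℝ≥0∞) : MemLp φ p volume :=
  h.continuous.memLp_of_hasCompactSupport h.2

theorem IsTest.bounded {φ : E3 → ℝ} (h : IsTest φ) : ∃ C, 0 ≤ C ∧ ∀ x, |φ x| ≤ C := by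
  obtain ⟨C, hC⟩ := h.2.exists_bound_of_continuous h.continuous
  exact ⟨C, (norm_nonneg _).trans (hC 0), hC⟩

theorem contDiff_partialD {φ : E3 → ℝ} (h : ContDiff ℝ ∞ φ) (i : Fin 3) :
    ContDiff ℝ ∞ (partialD i φ) :=
  (h.fderiv_right (m := ∞) (by simp)).clm_apply contDiff_const

theorem IsTest.partialD {φ : E3 → ℝ} (h : IsTest φ) (i : Fin 3) : IsTest (partialD i φ) :=
  ⟨contDiff_partialD h.1 i, h.2.fderiv_apply ℝ (ee i)⟩

theorem IsTest.add {φ ψ : E3 → ℝ} (h : IsTest φ) (h' : IsTest ψ) : IsTest (fun x => φ x + ψ x) :=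
  ⟨h.1.add h'.1, h.2.add h'.2⟩

theorem IsTest.const_mul {φ : E3 → ℝ} (h : IsTest φ) (c : ℝ) : IsTest (fun x => c * φ x) :=
  ⟨contDiff_const.mul h.1, h.2.mul_left⟩

theorem IsTest.mul {φ ψ : E3 → ℝ} (h : IsTest φ) (h' : ContDiff ℝ ∞ ψ) :
    IsTest (fun x => φ x * ψ x) :=
  ⟨h.1.mul h', h.2.mul_right⟩

theorem isTest_zero : IsTest (fun _ => 0) := ⟨contDiff_const, HasCompactSupport.zero⟩

theorem IsTest.sum {ι : Type*} (s : Finset ι) {φ : ι → E3 → ℝ} (h : ∀ i ∈ s, IsTest (φ i)) :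
    IsTest (fun x => ∑ i ∈ s, φ i x) := by
  classical
  induction s using Finset.induction_on with
  | empty => simpa using isTest_zero
  | insert a s ha ih =>
    simp only [Finset.sum_insert ha]
    exact (h a (by simp)).add (ih fun i hi => h i (by simp [hi]))

theorem IsTest.comp_sub_left {φ : E3 → ℝ} (h : IsTest φ) (x : E3) :
    IsTest (fun y => φ (x - y)) :=
  ⟨h.1.comp (contDiff_const.sub contDiff_id),
    h.2.comp_homeomorph (Homeomorph.subLeft x)⟩

theorem partialD_comp_sub_left {φ : E3 → ℝ} (h : Differentiable ℝ φ) (x : E3) (i : Fin 3) (y : E3) :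
    partialD i (fun y => φ (x - y)) y = - partialD i φ (x - y) := by
  have h1 : HasFDerivAt (fun y => φ (x - y)) (- fderiv ℝ φ (x - y)) y := by
    have h2 : HasFDerivAt (fun y : E3 => x - y) (-ContinuousLinearMap.id ℝ E3) y :=
      (hasFDerivAt_id y).const_sub x
    exact ((h (x - y)).hasFDerivAt.comp y h2).congr_fderiv (by ext; simp)
  rw [partialD, h1.fderiv]; rfl

/-- The affine substitution `x ↦ κ • x + v` preserves test functions. -/
theorem IsTest.comp_affine {φ : E3 → ℝ} (h : IsTest φ) {κ : ℝ} (hκ : κ ≠ 0) (v : E3) :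
    IsTest (fun y => φ (κ • y + v)) :=
  ⟨h.1.comp (g := φ) (f := fun y : E3 => κ • y + v) (by fun_prop),
    h.2.comp_homeomorph ((Homeomorph.smulOfNeZero κ hκ).trans (Homeomorph.addRight v))⟩

theorem partialD_comp_affine {φ : E3 → ℝ} (h : Differentiable ℝ φ) (κ : ℝ) (v : E3) (i : Fin 3)
    (y : E3) : partialD i (fun y => φ (κ • y + v)) y = κ * partialD i φ (κ • y + v) := by
  have h1 : HasFDerivAt (fun y => φ (κ • y + v)) (κ • fderiv ℝ φ (κ • y + v)) y := by
    have h2 : HasFDerivAt (fun y : E3 => κ • y + v) (κ • ContinuousLinearMap.id ℝ E3) y :=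
      ((hasFDerivAt_id y).const_smul κ).add_const v
    exact ((h (κ • y + v)).hasFDerivAt.comp y h2).congr_fderiv (by ext; simp)
  rw [partialD, h1.fderiv]; rfl

theorem partialD_add {φ ψ : E3 → ℝ} (h : Differentiable ℝ φ) (h' : Differentiable ℝ ψ)
    (i : Fin 3) (x : E3) :
    partialD i (fun x => φ x + ψ x) x = partialD i φ x + partialD i ψ x := by
  simp only [partialD]
  rw [fderiv_fun_add (h x) (h' x)]; rfl

theorem partialD_const_mul {φ : E3 → ℝ} (h : Differentiable ℝ φ) (c : ℝ) (i : Fin 3) (x : E3) :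
    partialD i (fun x => c * φ x) x = c * partialD i φ x := by
  simp only [partialD]
  rw [fderiv_const_mul (h x)]; rfl

theorem partialD_mul {φ ψ : E3 → ℝ} (h : Differentiable ℝ φ) (h' : Differentiable ℝ ψ)
    (i : Fin 3) (x : E3) :
    partialD i (fun x => φ x * ψ x) x = partialD i φ x * ψ x + φ x * partialD i ψ x := by
  simp only [partialD]
  rw [fderiv_fun_mul (h x) (h' x)]
  simp; ring

theorem partialD_comm {φ : E3 → ℝ} (h : ContDiff ℝ ∞ φ) (i j : Fin 3) :
    partialD i (partialD j φ) = partialD j (partialD i φ) := by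
  have key : ∀ (k l : Fin 3) (x : E3),
      partialD k (partialD l φ) x = fderiv ℝ (fderiv ℝ φ) x (ee k) (ee l) := by
    intro k l x
    have h1 : DifferentiableAt ℝ (fderiv ℝ φ) x :=
      (h.fderiv_right (m := ∞) (by simp)).differentiable (by simp) x
    have h2 : HasFDerivAt (fun y => fderiv ℝ φ y (ee l))
        ((fderiv ℝ (fderiv ℝ φ) x).flip (ee l)) x := by
      simpa using h1.hasFDerivAt.clm_apply (hasFDerivAt_const (ee l) x)
    change fderiv ℝ (fun y => fderiv ℝ φ y (ee l)) x (ee k) = _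
    rw [h2.fderiv]; rfl
  funext x
  rw [key, key]
  exact ((contDiff_infty.mp h 2).contDiffAt.isSymmSndFDerivAt (by simp)).eq _ _

/-- Integration by parts for smooth functions, one of them compactly supported. -/
theorem integral_mul_partialD {φ ψ : E3 → ℝ} (h : ContDiff ℝ ∞ φ) (h' : IsTest ψ) (i : Fin 3) :
    ∫ x, φ x * partialD i ψ x = - ∫ x, partialD i φ x * ψ x := by
  apply integral_mul_fderiv_eq_neg_fderiv_mul_of_integrable
  · exact ((contDiff_partialD h i).continuous.mul h'.continuous).integrable_of_hasCompactSupport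
      h'.2.mul_left
  · exact (h.continuous.mul (h'.partialD i).continuous).integrable_of_hasCompactSupport
      (h'.partialD i).2.mul_left
  · exact (h.continuous.mul h'.continuous).integrable_of_hasCompactSupport h'.2.mul_left
  · exact fun x _ => h.differentiable (by simp) x
  · exact fun x _ => h'.differentiable x

theorem exists_cutoff : ∃ χ : E3 → ℝ, IsTest χ ∧ (∀ x, 0 ≤ χ x) ∧ (∀ x, χ x ≤ 1) ∧
    (∀ x, ‖x‖ ≤ 1 → χ x = 1) ∧ ∀ x, 2 < ‖x‖ → χ x = 0 := by
  let b : ContDiffBump (0 : E3) := ⟨1, 2, one_pos, one_lt_two⟩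
  refine ⟨b, ⟨b.contDiff, b.hasCompactSupport⟩, fun x => b.nonneg, fun x => b.le_one, fun x hx => ?_,
    fun x hx => ?_⟩
  · exact b.one_of_mem_closedBall (by simpa using hx)
  · exact b.zero_of_le_dist (by simpa using hx.le)

theorem exists_test_kernel {δ : ℝ} (hδ : 0 < δ) : ∃ η : E3 → ℝ, IsTest η ∧ IsKernel δ η := by
  let b : ContDiffBump (0 : E3) := ⟨δ / 2, δ, by positivity, by linarith⟩
  have ht : IsTest (b.normed volume) := ⟨b.contDiff_normed, b.hasCompactSupport_normed⟩
  refine ⟨b.normed volume, ht, ht.continuous.measurable, b.nonneg_normed, ?_, ?_, b.integral_normed⟩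
  · obtain ⟨C, -, hC⟩ := ht.bounded
    exact ⟨C, fun y => (le_abs_self _).trans (hC y)⟩
  · intro y hy
    have : y ∉ Function.support (b.normed volume) := by
      rw [b.support_normed_eq]
      simpa using hy.le
    simpa using this

end TestFunctions

/-! ### Derivatives of mollified functions -/

section Mollify

variable {F : Type*} [NormedAddCommGroup F] [NormedSpace ℝ F] [CompleteSpace F]

theorem avg_eq_convolution (η : E3 → ℝ) (f : E3 → F) :
    avg η f = convolution η f (ContinuousLinearMap.lsmul ℝ ℝ) volume := by
  funext x
  rw [avg_eq]; rfl

theorem contDiff_avg {η : E3 → ℝ} (hη : IsTest η) {f : E3 → F} (hf : LocallyIntegrable f) :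
    ContDiff ℝ ∞ (avg η f) := by
  rw [avg_eq_convolution]
  exact hη.2.contDiff_convolution_left _ hη.1 hf

theorem pd_avg {η : E3 → ℝ} (hη : IsTest η) {f : E3 → F} (hf : LocallyIntegrable f) (i : Fin 3) :
    pd i (avg η f) = avg (partialD i η) f := by
  funext x
  have h1 := hη.2.hasFDerivAt_convolution_left (ContinuousLinearMap.lsmul ℝ ℝ)
    (hη.1.of_le (by simp)) hf x (μ := volume)
  rw [pd, avg_eq_convolution, h1.fderiv, convolution, ContinuousLinearMap.integral_apply, avg_eq]
  · simp [partialD]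
  · exact (hη.2.fderiv ℝ).convolutionExists_left _
      (hη.1.continuous_fderiv (by simp)) hf x

end Mollify

/-! ### Weak partial derivatives and the translation estimate -/

section WeakDerivative

variable {F : Type*} [NormedAddCommGroup F] [NormedSpace ℝ F] [CompleteSpace F]

/-- `g` is the `i`-th weak partial derivative of `f`. -/
def WeakPD (i : Fin 3) (f g : E3 → F) : Prop :=
  ∀ φ : E3 → ℝ, IsTest φ → ∫ x, partialD i φ x • f x = - ∫ x, φ x • g x

theorem hasWeakGradient_iff {f : E3 → ℂ} {g : E3 → EuclideanSpace ℂ (Fin 3)} :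
    HasWeakGradient f g ↔ MemLp g 2 volume ∧ ∀ i, WeakPD i f (fun x => g x i) := by
  simp only [HasWeakGradient, WeakPD, Complex.real_smul, mul_comm (Complex.ofReal _)]
  refine and_congr_right fun _ => ⟨fun h i φ hφ => h φ hφ i, fun h φ hφ i => h i φ hφ⟩

theorem MemLp.locInt {f : E3 → F} (hf : MemLp f 2 volume) : LocallyIntegrable f volume :=
  hf.locallyIntegrable (by norm_num)

theorem WeakPD.unique {i : Fin 3} {f g g' : E3 → F} (hg : MemLp g 2 volume)
    (hg' : MemLp g' 2 volume) (h : WeakPD i f g) (h' : WeakPD i f g') : g =ᵐ[volume] g' :=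
  ae_eq_of_integral_contDiff_smul_eq (MemLp.locInt hg) (MemLp.locInt hg') fun φ h1 h2 =>
    neg_injective ((h φ ⟨h1, h2⟩).symm.trans (h' φ ⟨h1, h2⟩))

theorem IsTest.integrable_smul {φ : E3 → ℝ} (hφ : IsTest φ) {f : E3 → F}
    (hf : MemLp f 2 volume) : Integrable (fun x => φ x • f x) := by
  rw [← memLp_one_iff_integrable]
  exact hf.smul (hφ.memLp 2)

theorem WeakPD.add {i : Fin 3} {f g f' g' : E3 → F} (hf : MemLp f 2 volume)
    (hg : MemLp g 2 volume) (hf' : MemLp f' 2 volume) (hg' : MemLp g' 2 volume)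
    (h : WeakPD i f g) (h' : WeakPD i f' g') :
    WeakPD i (fun x => f x + f' x) (fun x => g x + g' x) := by
  intro φ hφ
  simp only [smul_add]
  rw [integral_add ((hφ.partialD i).integrable_smul hf) ((hφ.partialD i).integrable_smul hf'),
    integral_add (hφ.integrable_smul hg) (hφ.integrable_smul hg'), h φ hφ, h' φ hφ, neg_add]

theorem WeakPD.const_smul {𝕜 : Type*} [NormedField 𝕜] [NormedSpace 𝕜 F] [SMulCommClass ℝ 𝕜 F]
    {i : Fin 3} {f g : E3 → F} (c : 𝕜) (h : WeakPD i f g) :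
    WeakPD i (fun x => c • f x) (fun x => c • g x) := by
  intro φ hφ
  simp only [smul_comm _ c]
  rw [integral_smul, integral_smul, h φ hφ, smul_neg]

theorem integral_comp_affine (f : E3 → F) {κ : ℝ} (hκ : 0 < κ) (v : E3) :
    ∫ x, f (κ • x + v) = (κ ^ 3)⁻¹ • ∫ x, f x := by
  rw [Measure.integral_comp_smul volume (fun x => f (x + v)) κ,
    integral_add_right_eq_self (fun x => f x) v]
  simp [abs_of_pos hκ]

theorem WeakPD.comp_affine {i : Fin 3} {f g : E3 → F} (h : WeakPD i f g) {κ : ℝ} (hκ : 0 < κ)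
    (v : E3) : WeakPD i (fun x => f (κ • x + v)) (fun x => κ • g (κ • x + v)) := by
  intro φ hφ
  -- The test function is transported by the inverse affine map, so that the change of variables
  -- returns φ.
  have hψ : IsTest (fun y => φ (κ⁻¹ • y + -(κ⁻¹ • v))) :=
    hφ.comp_affine (inv_ne_zero hκ.ne') _
  have h0 := h _ hψ
  simp only [partialD_comp_affine hφ.differentiable] at h0
  have e : ∀ x : E3, κ⁻¹ • (κ • x + v) + -(κ⁻¹ • v) = x := by
    intro x; rw [smul_add, smul_smul, inv_mul_cancel₀ hκ.ne']; simp
  have h1 := integral_comp_affine (fun y => (κ⁻¹ * partialD i φ (κ⁻¹ • y + -(κ⁻¹ • v))) • f y) hκ v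
  have h2 := integral_comp_affine (fun y => φ (κ⁻¹ • y + -(κ⁻¹ • v)) • g y) hκ v
  simp only [e] at h1 h2
  rw [h0, smul_neg, ← h2] at h1
  have h3 : ∀ x, partialD i φ x • f (κ • x + v)
      = κ • ((κ⁻¹ * partialD i φ x) • f (κ • x + v)) := by
    intro x; rw [smul_smul, ← mul_assoc, mul_inv_cancel₀ hκ.ne', one_mul]
  simp only [h3, integral_smul, h1, smul_comm _ κ, smul_neg]

/-- This is the weak derivative tested against z ↦ η(x - z); the sign from the reflection cancels
the one in `WeakPD`. -/
theorem avg_partialD {i : Fin 3} {f g : E3 → F} (h : WeakPD i f g) {η : E3 → ℝ} (hη : IsTest η) :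
    avg (partialD i η) f = avg η g := by
  funext x
  have h1 := h _ (hη.comp_sub_left x)
  simp only [partialD_comp_sub_left hη.differentiable, neg_smul, integral_neg, neg_inj] at h1
  exact h1

theorem WeakPD.pd_avg {i : Fin 3} {f g : E3 → F} (h : WeakPD i f g) (hf : MemLp f 2 volume)
    {η : E3 → ℝ} (hη : IsTest η) : pd i (avg η f) = avg η g := by
  rw [DipolarNLS.pd_avg hη (MemLp.locInt hf), avg_partialD h hη]

theorem sum_smul_ee (h : E3) : ∑ i, h i • ee i = h := by
  ext j
  fin_cases j <;> simp [Fin.sum_univ_three]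

theorem fderiv_eq_sum_pd (u : E3 → F) (x h : E3) : fderiv ℝ u x h = ∑ i, h i • pd i u x := by
  conv_lhs => rw [← sum_smul_ee h]
  simp [pd]

theorem norm_fderiv_le (u : E3 → F) (x : E3) : ‖fderiv ℝ u x‖ ≤ ∑ i, ‖pd i u x‖ := by
  refine ContinuousLinearMap.opNorm_le_bound _ (by positivity) fun h => ?_
  rw [fderiv_eq_sum_pd, Finset.sum_mul]
  refine norm_sum_le_of_le _ fun i _ => ?_
  rw [norm_smul, mul_comm]
  gcongr
  exact PiLp.norm_apply_le h i

/-- Translation estimate for smooth functions with square-integrable derivatives. -/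
theorem eLpNorm_translation_le_of_smooth {u : E3 → F} (hu : ContDiff ℝ ∞ u) (h : E3) :
    eLpNorm (fun x => u (x + h) - u x) 2 volume ≤
      eLpNorm (fun x => fderiv ℝ u x h) 2 volume := by
  have hc : Continuous (fun x => fderiv ℝ u x h) :=
    (hu.continuous_fderiv (by simp)).clm_apply continuous_const
  have e : (fun x => u (x + h) - u x)
      = fun x => ∫ t, fderiv ℝ u (x + t • h) h ∂(volume.restrict (Set.Ioc (0 : ℝ) 1)) := by
    funext x
    rw [← intervalIntegral.integral_of_le zero_le_one]
    have hd : ∀ t ∈ Set.uIcc (0 : ℝ) 1,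
        HasDerivAt (fun t : ℝ => u (x + t • h)) (fderiv ℝ u (x + t • h) h) t := by
      intro t _
      have h1 : HasDerivAt (fun t : ℝ => x + t • h) h t := by
        simpa using ((hasDerivAt_id t).smul_const h).const_add x
      exact ((hu.differentiable (by simp)) _).hasFDerivAt.comp_hasDerivAt t h1
    rw [intervalIntegral.integral_eq_sub_of_hasDerivAt hd]
    · simp
    · exact (hc.comp (by fun_prop : Continuous fun t : ℝ => x + t • h)).intervalIntegrable _ _
  have : IsProbabilityMeasure (volume.restrict (Set.Ioc (0 : ℝ) 1)) := ⟨by simp⟩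
  rw [e]
  refine eLpNorm_integral_le volume _ _ ?_ _ ?_
  · exact (hc.comp (by fun_prop : Continuous fun p : E3 × ℝ => p.1 + p.2 • h)).aestronglyMeasurable
  · refine ae_of_all _ fun t => ?_
    exact (eLpNorm_comp_measurePreserving (f := fun x : E3 => x + t • h)
      hc.aestronglyMeasurable (measurePreserving_add_right volume (t • h))).le

theorem exists_approx_kernels : ∃ η : ℕ → E3 → ℝ, (∀ n, IsTest (η n)) ∧
    (∀ n : ℕ, IsKernel (1 / ((n : ℝ) + 1)) (η n)) ∧
    ∀ f : E3 → F, MemLp f 2 volume →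
      Tendsto (fun n => eLpNorm (fun x => avg (η n) f x - f x) 2 volume) atTop (𝓝 0) := by
  choose η h1 h2 using fun n : ℕ => exists_test_kernel (δ := 1 / ((n : ℝ) + 1)) (by positivity)
  exact ⟨η, h1, h2, fun f hf => tendsto_eLpNorm_avg_sub (Eventually.of_forall h2)
    tendsto_one_div_add_atTop_nhds_zero_nat hf⟩

theorem eLpNorm_comp_add_right (f : E3 → F) (hf : AEStronglyMeasurable f volume) (p : ℝ≥0∞)
    (y : E3) : eLpNorm (fun x => f (x + y)) p volume = eLpNorm f p volume :=
  eLpNorm_comp_measurePreserving (f := fun x : E3 => x + y) hf (measurePreserving_add_right _ y)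

theorem fderiv_avg_apply {f : E3 → F} {g : Fin 3 → E3 → F} (hf : MemLp f 2 volume)
    (hg : ∀ i, MemLp (g i) 2 volume) (hw : ∀ i, WeakPD i f (g i)) {η : E3 → ℝ} (hη : IsTest η)
    (h : E3) : (fun x => fderiv ℝ (avg η f) x h) = avg η (fun x => ∑ i, h i • g i x) := by
  funext x
  have e : ∀ i, pd i (avg η f) x = avg η (g i) x := fun i => by rw [(hw i).pd_avg hf hη]
  rw [fderiv_eq_sum_pd]
  simp only [e]
  unfold avg
  have e2 : ∀ z, η (x - z) • ∑ i, h i • g i z = ∑ i, h i • (η (x - z) • g i z) := fun z => by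
    rw [Finset.smul_sum]
    exact Finset.sum_congr rfl fun i _ => smul_comm _ _ _
  simp only [e2]
  rw [integral_finsetSum (f := fun i z => h i • (η (x - z) • g i z)) Finset.univ
    fun i _ => (integrable_avg' (hη.memLp 2) (hg i) x).smul (h i)]
  exact Finset.sum_congr rfl fun i _ => (integral_smul _ _).symm

/-- After mollification the smooth estimate applies. The derivative of the mollified function is the
average of the weak derivative, and averaging contracts L², so the bound survives the limit. -/
theorem eLpNorm_translation_le {f : E3 → F} {g : Fin 3 → E3 → F} (hf : MemLp f 2 volume)
    (hg : ∀ i, MemLp (g i) 2 volume) (hw : ∀ i, WeakPD i f (g i)) (h : E3) :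
    eLpNorm (fun x => f (x + h) - f x) 2 volume ≤
      eLpNorm (fun x => ∑ i, h i • g i x) 2 volume := by
  obtain ⟨η, hη, hk, hlim⟩ := exists_approx_kernels (F := F)
  have hlf := hlim f hf
  have hG : MemLp (fun x => ∑ i, h i • g i x) 2 volume :=
    memLp_finsetSum _ fun i _ => (hg i).const_smul (h i)
  -- The mollification error enters twice, at x and at x + h.
  have bound : ∀ n, eLpNorm (fun x => f (x + h) - f x) 2 volume ≤
      eLpNorm (fun x => ∑ i, h i • g i x) 2 volume
        + 2 * eLpNorm (fun x => avg (η n) f x - f x) 2 volume := by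
    intro n
    obtain ⟨u, hu⟩ : ∃ u, u = avg (η n) f := ⟨_, rfl⟩
    rw [← hu]
    have huc : ContDiff ℝ ∞ u := hu ▸ contDiff_avg (hη n) (MemLp.locInt hf)
    have hud : MemLp (fun x => u x - f x) 2 volume := hu ▸ ((hk n).memLp_avg hf).sub hf
    have s1 : eLpNorm (fun x => u (x + h) - u x) 2 volume ≤
        eLpNorm (fun x => ∑ i, h i • g i x) 2 volume := by
      refine (eLpNorm_translation_le_of_smooth huc h).trans ?_
      have : (fun x => fderiv ℝ (avg (η n) f) x h) = avg (η n) (fun x => ∑ i, h i • g i x) :=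
        fderiv_avg_apply hf hg hw (hη n) h
      rw [hu, this]
      exact (hk n).eLpNorm_avg_le hG
    have s2 : eLpNorm (fun x => u (x + h) - f (x + h)) 2 volume
        = eLpNorm (fun x => u x - f x) 2 volume :=
      eLpNorm_comp_add_right (fun x => u x - f x) hud.1 2 h
    have hum : AEStronglyMeasurable (fun x => u (x + h) - f (x + h)) volume :=
      hud.1.comp_measurePreserving (f := fun x : E3 => x + h) (measurePreserving_add_right volume h)
    have hum2 : AEStronglyMeasurable (fun x => u (x + h) - u x) volume := by
      have hc := huc.continuous
      exact ((hc.comp (continuous_add_const h)).sub hc).aestronglyMeasurable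
    calc eLpNorm (fun x => f (x + h) - f x) 2 volume
        = eLpNorm ((fun x => u (x + h) - u x) +
            ((fun x => u x - f x) - fun x => u (x + h) - f (x + h))) 2 volume := by
          congr 1; funext x; simp only [Pi.add_apply, Pi.sub_apply]; abel
      _ ≤ _ := eLpNorm_add_le hum2 (hud.1.sub hum) (by norm_num)
      _ ≤ _ := add_le_add s1 (eLpNorm_sub_le hud.1 hum (by norm_num))
      _ = _ := by rw [s2, two_mul]
  have hl : Tendsto (fun n => eLpNorm (fun x => ∑ i, h i • g i x) 2 volume
        + 2 * eLpNorm (fun x => avg (η n) f x - f x) 2 volume) atTop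
        (𝓝 (eLpNorm (fun x => ∑ i, h i • g i x) 2 volume + 2 * 0)) :=
    tendsto_const_nhds.add (ENNReal.Tendsto.const_mul hlf (Or.inr (by norm_num)))
  simpa using ge_of_tendsto' hl bound

end WeakDerivative

/-! ### Sobolev embedding of H¹ in L⁶ -/

section Sobolev

theorem eLpNorm_six_le_of_compact : ∃ C : ℝ≥0, ∀ u : E3 → ℂ, ContDiff ℝ 1 u → HasCompactSupport u →
    eLpNorm u 6 volume ≤ C * eLpNorm (fderiv ℝ u) 2 volume := by
  refine ⟨eLpNormLESNormFDerivOfEqInnerConst (volume : Measure E3) 2, fun u hu hc => ?_⟩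
  have := eLpNorm_le_eLpNorm_fderiv_of_eq_inner (μ := (volume : Measure E3)) (p := 2) (p' := 6)
    hu hc (by norm_num) (by simp) (by simp; norm_num)
  simpa using this

theorem pd_smul {φ : E3 → ℝ} {u : E3 → ℂ} (hφ : Differentiable ℝ φ) (hu : Differentiable ℝ u)
    (i : Fin 3) (x : E3) :
    pd i (fun x => φ x • u x) x = partialD i φ x • u x + φ x • pd i u x := by
  simp only [pd, partialD]
  rw [fderiv_fun_smul (hφ x) (hu x)]
  simp [add_comm]

/-- A uniform bound for the gradient of the rescaled cutoffs. -/
theorem exists_cutoff_seq : ∃ (χ : ℕ → E3 → ℝ) (M : ℝ), 0 ≤ M ∧ (∀ n, IsTest (χ n)) ∧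
    (∀ n x, 0 ≤ χ n x) ∧ (∀ n x, χ n x ≤ 1) ∧ (∀ (n : ℕ) x, ‖x‖ ≤ (n : ℝ) + 1 → χ n x = 1) ∧
    (∀ (n : ℕ) i x, |partialD i (χ n) x| ≤ M / ((n : ℝ) + 1)) ∧
    (∀ (n : ℕ) i j x, |partialD i (partialD j (χ n)) x| ≤ M / ((n : ℝ) + 1) ^ 2) ∧
    (∀ (n : ℕ) x, 2 * ((n : ℝ) + 1) < ‖x‖ → χ n x = 0) := by
  obtain ⟨χ, hχ, h0, h1, h2, h3⟩ := exists_cutoff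
  choose M1 hM1 hb1 using fun i => (hχ.partialD i).bounded
  choose M2 hM2 hb2 using fun i j => ((hχ.partialD j).partialD i).bounded
  have hS1 : 0 ≤ ∑ i, M1 i := Finset.sum_nonneg fun i _ => hM1 i
  have hS2 : 0 ≤ ∑ i, ∑ j, M2 i j :=
    Finset.sum_nonneg fun i _ => Finset.sum_nonneg fun j _ => hM2 i j
  have hκ : ∀ n : ℕ, (0 : ℝ) < ((n : ℝ) + 1)⁻¹ := fun n => by positivity
  have hnorm : ∀ (n : ℕ) (x : E3), ‖((n : ℝ) + 1)⁻¹ • x + 0‖ = ‖x‖ / ((n : ℝ) + 1) := fun n x => by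
    rw [add_zero, norm_smul, Real.norm_of_nonneg (hκ n).le, div_eq_inv_mul]
  have d1 : ∀ (n : ℕ) i, partialD i (fun x => χ (((n : ℝ) + 1)⁻¹ • x + 0))
      = fun x => ((n : ℝ) + 1)⁻¹ * partialD i χ (((n : ℝ) + 1)⁻¹ • x + 0) := fun n i =>
    funext fun x => partialD_comp_affine hχ.differentiable _ _ i x
  refine ⟨fun n x => χ (((n : ℝ) + 1)⁻¹ • x + 0), ∑ i, M1 i + ∑ i, ∑ j, M2 i j, by positivity,
    fun n => hχ.comp_affine (hκ n).ne' 0, fun n x => h0 _, fun n x => h1 _, fun n x hx => h2 _ ?_,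
    fun n i x => ?_, fun n i j x => ?_, fun n x hx => h3 _ ?_⟩
  · rw [hnorm, div_le_one (by positivity)]; exact hx
  · rw [d1, abs_mul, abs_of_pos (hκ n), div_eq_inv_mul]
    refine mul_le_mul_of_nonneg_left ((hb1 i _).trans ?_) (hκ n).le
    exact (Finset.single_le_sum (fun i _ => hM1 i) (Finset.mem_univ i)).trans (by linarith)
  · have hd : Differentiable ℝ (fun x => partialD j χ (((n : ℝ) + 1)⁻¹ • x + 0)) :=
      ((hχ.partialD j).comp_affine (hκ n).ne' 0).differentiable
    rw [d1, partialD_const_mul hd, partialD_comp_affine (hχ.partialD j).differentiable,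
      abs_mul, abs_mul, abs_of_pos (hκ n), ← mul_assoc, div_eq_inv_mul, ← sq, inv_pow]
    refine mul_le_mul_of_nonneg_left ((hb2 i j _).trans ?_) (by positivity)
    calc M2 i j ≤ ∑ j, M2 i j :=
          Finset.single_le_sum (f := fun j => M2 i j) (fun j _ => hM2 i j) (Finset.mem_univ j)
      _ ≤ ∑ i, ∑ j, M2 i j := Finset.single_le_sum (f := fun i => ∑ j, M2 i j)
          (fun i _ => Finset.sum_nonneg fun j _ => hM2 i j) (Finset.mem_univ i)
      _ ≤ _ := by linarith
  · rw [hnorm, lt_div_iff₀ (by positivity)]; exact hx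

/-- The inequality for compactly supported functions is applied to cut-off mollifications of `f`.
The cutoff contributes to the gradient only O(1/n) times the mass norm, and Fatou's lemma along an
almost everywhere convergent subsequence gives the claim. -/
theorem exists_sobolev_const : ∃ C : ℝ≥0, ∀ (f : E3 → ℂ) (g : Fin 3 → E3 → ℂ),
    MemLp f 2 volume → (∀ i, MemLp (g i) 2 volume) → (∀ i, WeakPD i f (g i)) →
    eLpNorm f 6 volume ≤ C * ∑ i, eLpNorm (g i) 2 volume := by
  obtain ⟨C, hC⟩ := eLpNorm_six_le_of_compact
  refine ⟨C, fun f g hf hg hw => ?_⟩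
  obtain ⟨χ, M, hM, hχ, h0, h1, hone, hgrad, -⟩ := exists_cutoff_seq
  obtain ⟨η, hη, hk, hlim⟩ := exists_approx_kernels (F := ℂ)
  obtain ⟨ns, hns, hae⟩ := (tendstoInMeasure_of_tendsto_eLpNorm (by norm_num)
    (fun n => ((hk n).memLp_avg hf).1) hf.1 (hlim f hf)).exists_seq_tendsto_ae
  set u : ℕ → E3 → ℂ := fun n x => χ n x • avg (η (ns n)) f x with hu
  have huc : ∀ n, ContDiff ℝ ∞ (u n) := fun n =>
    (hχ n).1.smul (contDiff_avg (hη _) (MemLp.locInt hf))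
  have bound : ∀ n, eLpNorm (u n) 6 volume ≤
      C * ∑ i, (ENNReal.ofReal (M / ((n : ℝ) + 1)) * eLpNorm f 2 volume
        + eLpNorm (g i) 2 volume) := by
    intro n
    refine (hC (u n) ((huc n).of_le (by simp)) (hχ n).2.smul_right).trans ?_
    gcongr
    have hdiff := (contDiff_avg (hη (ns n)) (MemLp.locInt hf)).differentiable (by simp)
    have e1 : ∀ x, ‖fderiv ℝ (u n) x‖ ≤ ∑ i, (M / ((n : ℝ) + 1) * ‖avg (η (ns n)) f x‖
        + ‖avg (η (ns n)) (g i) x‖) := by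
      intro x
      refine (norm_fderiv_le _ _).trans (Finset.sum_le_sum fun i _ => ?_)
      rw [hu, pd_smul (hχ n).differentiable hdiff, (hw i).pd_avg hf (hη _)]
      refine (norm_add_le _ _).trans (add_le_add ?_ ?_)
      · rw [norm_smul]; gcongr; exact hgrad n i x
      · rw [norm_smul, Real.norm_of_nonneg (h0 n x)]
        exact mul_le_of_le_one_left (norm_nonneg _) (h1 n x)
    have hm1 := (hk (ns n)).memLp_avg hf
    have hm2 := fun i => (hk (ns n)).memLp_avg (hg i)
    calc eLpNorm (fderiv ℝ (u n)) 2 volume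
        ≤ eLpNorm (∑ i, ((fun x => M / ((n : ℝ) + 1) * ‖avg (η (ns n)) f x‖)
          + fun x => ‖avg (η (ns n)) (g i) x‖)) 2 volume := by
          refine eLpNorm_mono_real fun x => ?_
          simpa using e1 x
      _ ≤ ∑ i, eLpNorm ((fun x => M / ((n : ℝ) + 1) * ‖avg (η (ns n)) f x‖)
          + fun x => ‖avg (η (ns n)) (g i) x‖) 2 volume :=
          eLpNorm_sum_le (fun i _ => ((hm1.norm.const_mul _).add (hm2 i).norm).1) (by norm_num)
      _ ≤ _ := by
          refine Finset.sum_le_sum fun i _ => ?_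
          refine (eLpNorm_add_le (hm1.norm.const_mul _).1 (hm2 i).norm.1 (by norm_num)).trans
            (add_le_add ?_ ?_)
          · change eLpNorm ((M / ((n : ℝ) + 1)) • fun x => ‖avg (η (ns n)) f x‖) 2 volume ≤ _
            rw [eLpNorm_const_smul, eLpNorm_norm, Real.enorm_of_nonneg (by positivity)]
            gcongr
            exact (hk _).eLpNorm_avg_le hf
          · rw [eLpNorm_norm]; exact (hk _).eLpNorm_avg_le (hg i)
  have hconv : ∀ᵐ x ∂volume, Tendsto (fun n => u n x) atTop (𝓝 (f x)) := by
    filter_upwards [hae] with x hx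
    refine hx.congr' ?_
    obtain ⟨m, hm⟩ := exists_nat_ge ‖x‖
    filter_upwards [eventually_ge_atTop m] with n hn
    have : (m : ℝ) ≤ n := by exact_mod_cast hn
    simp only [hu]
    rw [hone n x (by linarith), one_smul]
  have hF := Lp.eLpNorm_lim_le_liminf_eLpNorm (p := 6) (fun n => (huc n).continuous.aestronglyMeasurable)
    f hconv
  refine hF.trans ?_
  refine (liminf_le_liminf (Eventually.of_forall bound)).trans ?_
  have hl : Tendsto (fun n : ℕ => (C : ℝ≥0∞) * ∑ i, (ENNReal.ofReal (M / ((n : ℝ) + 1))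
      * eLpNorm f 2 volume + eLpNorm (g i) 2 volume)) atTop
      (𝓝 (C * ∑ i, (ENNReal.ofReal 0 * eLpNorm f 2 volume + eLpNorm (g i) 2 volume))) := by
    refine ENNReal.Tendsto.const_mul (tendsto_finsetSum _ fun i _ => ?_) (Or.inr (by simp))
    refine (ENNReal.Tendsto.mul_const (ENNReal.tendsto_ofReal ?_) (Or.inr hf.2.ne)).add_const _
    have := (tendsto_one_div_add_atTop_nhds_zero_nat (𝕜 := ℝ)).const_mul M
    simpa [div_eq_mul_inv] using this
  rw [hl.liminf_eq]
  simp

end Sobolev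

/-! ### A Liouville theorem in L² -/

section Liouville

theorem partialD_cutoff_eq_zero {χ : E3 → ℝ} {r : ℝ} (h : ∀ x, ‖x‖ ≤ r → χ x = 1) (i : Fin 3)
    {x : E3} (hx : ‖x‖ < r) : partialD i χ x = 0 := by
  have : χ =ᶠ[𝓝 x] fun _ => 1 := by
    filter_upwards [continuous_norm.continuousAt.eventually_lt continuousAt_const hx] with y hy
    exact h y hy.le
  rw [partialD, this.fderiv_eq]; simp

theorem partialD_eq_zero_of_norm_gt {χ : E3 → ℝ} {r : ℝ} (h : ∀ x, r < ‖x‖ → χ x = 0) (i : Fin 3)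
    {x : E3} (hx : r < ‖x‖) : partialD i χ x = 0 := by
  have : χ =ᶠ[𝓝 x] fun _ => 0 := by
    filter_upwards [continuousAt_const.eventually_lt continuous_norm.continuousAt hx] with y hy
    exact h y hy
  rw [partialD, this.fderiv_eq]; simp

/-- Fatou's lemma gives ∫ w = 0 without assuming `w` integrable; continuity then upgrades almost
everywhere to everywhere. -/
theorem ae_eq_zero_of_cutoff {χ : ℕ → E3 → ℝ} (hχ : ∀ n, IsTest (χ n)) (h0 : ∀ n x, 0 ≤ χ n x)
    (hone : ∀ (n : ℕ) x, ‖x‖ ≤ (n : ℝ) + 1 → χ n x = 1) {w : E3 → ℝ} (hw : Continuous w)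
    (hw0 : ∀ x, 0 ≤ w x) (hlim : Tendsto (fun n => ∫ x, χ n x * w x) atTop (𝓝 0)) :
    w = 0 := by
  have h1 : ∫⁻ x, ENNReal.ofReal (w x) = 0 := by
    have e : ∀ x, ENNReal.ofReal (w x)
        = liminf (fun n => ENNReal.ofReal (χ n x * w x)) atTop := by
      intro x
      refine (Tendsto.liminf_eq (tendsto_const_nhds.congr' ?_)).symm
      obtain ⟨m, hm⟩ := exists_nat_ge ‖x‖
      filter_upwards [eventually_ge_atTop m] with n hn
      have : (m : ℝ) ≤ n := by exact_mod_cast hn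
      rw [hone n x (by linarith), one_mul]
    have hm : ∀ n, Measurable fun x => ENNReal.ofReal (χ n x * w x) := fun n =>
      ((hχ n).continuous.mul hw).measurable.ennreal_ofReal
    have h2 := lintegral_liminf_le (μ := (volume : Measure E3)) (u := (atTop : Filter ℕ)) hm
    simp only [← e] at h2
    have e2 : ∀ n, ∫⁻ x, ENNReal.ofReal (χ n x * w x) = ENNReal.ofReal (∫ x, χ n x * w x) :=
      fun n => (ofReal_integral_eq_lintegral_ofReal
        (((hχ n).continuous.mul hw).integrable_of_hasCompactSupport (hχ n).2.mul_right)
        (ae_of_all _ fun x => mul_nonneg (h0 n x) (hw0 x))).symm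
    simp only [e2] at h2
    rw [(ENNReal.tendsto_ofReal hlim).liminf_eq] at h2
    simpa using h2
  rw [lintegral_eq_zero_iff hw.measurable.ennreal_ofReal] at h1
  refine (hw.ae_eq_iff_eq volume continuous_const).mp ?_
  filter_upwards [h1] with x hx
  exact le_antisymm (ENNReal.ofReal_eq_zero.mp hx) (hw0 x)

theorem partialD_sq {u : E3 → ℝ} (hu : ContDiff ℝ ∞ u) (i : Fin 3) :
    partialD i (fun x => u x * u x) = fun x => 2 * (u x * partialD i u x) := by
  have hd := hu.differentiable (by simp)
  funext x
  rw [partialD_mul hd hd]; ring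

theorem partialD_partialD_sq {u : E3 → ℝ} (hu : ContDiff ℝ ∞ u) (i : Fin 3) :
    partialD i (partialD i (fun x => u x * u x))
      = fun x => 2 * (partialD i u x * partialD i u x + u x * partialD i (partialD i u) x) := by
  have hd := hu.differentiable (by simp)
  have hd' := (contDiff_partialD hu i).differentiable (by simp)
  rw [partialD_sq hu]
  funext x
  rw [partialD_const_mul (φ := fun x => u x * partialD i u x) (hd.mul hd') 2 i x, partialD_mul hd hd']

/-- Square-integrable functions annihilated by `∑_{i ∈ S} ∂ᵢ²` vanish. -/
theorem eq_zero_of_sum_partialD_eq_zero {S : Finset (Fin 3)} (hS : S.Nonempty) {u : E3 → ℝ}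
    (hu : ContDiff ℝ ∞ u) (hu2 : MemLp u 2 volume)
    (hL : ∀ x, ∑ i ∈ S, partialD i (partialD i u) x = 0) : u = 0 := by
  obtain ⟨χ, M, hM, hχ, h0, h1, hone, hg1, hg2, hsupp⟩ := exists_cutoff_seq
  have hsq : Integrable (fun x => u x * u x) := by
    simpa [sq] using (memLp_two_iff_integrable_sq hu2.1).mp hu2
  have huu : ContDiff ℝ ∞ (fun x => u x * u x) := hu.mul hu
  have hc := hu.continuous
  have hcd := fun i => (contDiff_partialD hu i).continuous
  -- the derivatives in the directions of `S` vanish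
  have grad : (fun x => ∑ i ∈ S, partialD i u x * partialD i u x) = 0 := by
    refine ae_eq_zero_of_cutoff hχ h0 hone (continuous_finsetSum _ fun i _ => (hcd i).mul (hcd i))
      (fun x => Finset.sum_nonneg fun i _ => mul_self_nonneg _) ?_
    -- By the equation, ∑ ∂ᵢ²(u²) = 2 ∑ (∂ᵢu)². Moving both derivatives onto the cutoff leaves ∫ u²
    -- times a quantity tending uniformly to 0.
    have key : ∀ n, ∫ x, χ n x * ∑ i ∈ S, partialD i u x * partialD i u x
        = (1 / 2) * ∑ i ∈ S, ∫ x, (u x * u x) * partialD i (partialD i (χ n)) x := by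
      intro n
      have e : ∀ i, ∫ x, (u x * u x) * partialD i (partialD i (χ n)) x
          = ∫ x, 2 * (partialD i u x * partialD i u x + u x * partialD i (partialD i u) x)
            * χ n x := by
        intro i
        rw [integral_mul_partialD huu ((hχ n).partialD i),
          integral_mul_partialD (contDiff_partialD huu i) (hχ n), neg_neg,
          partialD_partialD_sq hu]
      simp only [e]
      rw [← integral_finsetSum, ← integral_const_mul]
      · congr 1; funext x
        rw [← Finset.sum_mul, ← Finset.mul_sum, Finset.sum_add_distrib, ← Finset.mul_sum, hL]
        ring
      · intro i _
        have hcdd := (contDiff_partialD (contDiff_partialD hu i) i).continuous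
        exact ((continuous_const.mul (((hcd i).mul (hcd i)).add (hc.mul hcdd))).mul
          (hχ n).continuous).integrable_of_hasCompactSupport (hχ n).2.mul_left
    simp only [key]
    rw [show (0 : ℝ) = (1 / 2) * ∑ i ∈ S, 0 by simp]
    refine (tendsto_finsetSum _ fun i _ => ?_).const_mul _
    have hb : ∀ n : ℕ, ‖∫ x, (u x * u x) * partialD i (partialD i (χ n)) x‖
        ≤ (∫ x, u x * u x) * (M * (1 / ((n : ℝ) + 1))) := by
      intro n
      rw [← integral_mul_const]
      refine norm_integral_le_of_norm_le (hsq.mul_const _) (ae_of_all _ fun x => ?_)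
      rw [norm_mul, Real.norm_of_nonneg (mul_self_nonneg _)]
      refine mul_le_mul_of_nonneg_left ((hg2 n i i x).trans ?_) (mul_self_nonneg _)
      rw [div_eq_mul_one_div]
      gcongr
      have : (0 : ℝ) ≤ n := n.cast_nonneg
      nlinarith
    refine squeeze_zero_norm hb ?_
    simpa using (tendsto_one_div_add_atTop_nhds_zero_nat (𝕜 := ℝ)).const_mul M |>.const_mul
      (∫ x, u x * u x)
  obtain ⟨i, hi⟩ := hS
  have hdi : ∀ x, partialD i u x = 0 := by
    intro x
    have h2 := congrFun grad x
    rw [Pi.zero_apply, Finset.sum_eq_zero_iff_of_nonneg fun i _ => mul_self_nonneg _] at h2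
    simpa using h2 i hi
  have hx : ContDiff ℝ ∞ (fun x : E3 => x i) := by fun_prop
  have hpx : ∀ x, partialD i (fun x : E3 => x i) x = 1 := by
    intro x
    have : HasFDerivAt (fun x : E3 => x i) (EuclideanSpace.proj i : E3 →L[ℝ] ℝ) x :=
      (EuclideanSpace.proj i : E3 →L[ℝ] ℝ).hasFDerivAt
    rw [partialD, this.fderiv]; simp
  have final : (fun x => u x * u x) = 0 := by
    refine ae_eq_zero_of_cutoff hχ h0 hone (hc.mul hc) (fun x => mul_self_nonneg _) ?_
    -- Since ∂ᵢ(u²) = 0, the integral of u² ∂ᵢ(χ xᵢ) vanishes. The resulting weight xᵢ ∂ᵢχ is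
    -- bounded uniformly in n and is zero on balls that grow to the whole space.
    have key : ∀ n, ∫ x, χ n x * (u x * u x)
        = ∫ x, - ((u x * u x) * (partialD i (χ n) x * x i)) := by
      intro n
      have e := integral_mul_partialD huu ((hχ n).mul hx) i
      simp only [partialD_mul (hχ n).differentiable (hx.differentiable (by simp)), hpx,
        partialD_sq hu, hdi, mul_one, mul_zero, zero_mul, integral_zero, neg_zero] at e
      simp only [mul_add] at e
      rw [integral_add] at e
      · rw [integral_neg]; simp only [mul_comm (χ n _)]; linarith
      · exact ((hc.mul hc).mul (((hχ n).partialD i).continuous.mul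
          hx.continuous)).integrable_of_hasCompactSupport ((hχ n).partialD i).2.mul_right.mul_left
      · exact ((hc.mul hc).mul (hχ n).continuous).integrable_of_hasCompactSupport (hχ n).2.mul_left
    simp only [key]
    rw [show (0 : ℝ) = ∫ x : E3, (0 : ℝ) by simp]
    refine tendsto_integral_of_dominated_convergence (fun x => (u x * u x) * (2 * M)) ?_ ?_ ?_ ?_
    · intro n
      exact ((hc.mul hc).mul (((hχ n).partialD i).continuous.mul
        hx.continuous)).neg.aestronglyMeasurable
    · exact hsq.mul_const _
    · intro n
      refine ae_of_all _ fun x => ?_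
      rw [norm_neg, norm_mul, Real.norm_of_nonneg (mul_self_nonneg _)]
      refine mul_le_mul_of_nonneg_left ?_ (mul_self_nonneg _)
      rw [norm_mul]
      by_cases hxn : 2 * ((n : ℝ) + 1) < ‖x‖
      · rw [partialD_eq_zero_of_norm_gt (hsupp n) i hxn]; simp [hM]
      · push Not at hxn
        have h3 : ‖x i‖ ≤ 2 * ((n : ℝ) + 1) := (PiLp.norm_apply_le x i).trans hxn
        calc ‖partialD i (χ n) x‖ * ‖x i‖ ≤ (M / ((n : ℝ) + 1)) * (2 * ((n : ℝ) + 1)) := by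
              gcongr; exact hg1 n i x
          _ = 2 * M := by field_simp
    · refine ae_of_all _ fun x => tendsto_const_nhds.congr' ?_
      obtain ⟨m, hm⟩ := exists_nat_ge ‖x‖
      filter_upwards [eventually_ge_atTop m] with n hn
      have : (m : ℝ) ≤ n := by exact_mod_cast hn
      rw [partialD_cutoff_eq_zero (hone n) i (by linarith)]; simp
  funext x
  simpa using congrFun final x

/-- Mollifications of `h` are smooth, square-integrable classical solutions, hence zero by the
preceding Liouville theorem, and they converge to `h`. -/
theorem ae_eq_zero_of_forall_integral_sum_partialD {S : Finset (Fin 3)} (hS : S.Nonempty)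
    {h : E3 → ℝ} (hh : MemLp h 2 volume)
    (hL : ∀ φ, IsTest φ → ∫ x, (∑ i ∈ S, partialD i (partialD i φ) x) * h x = 0) :
    h =ᵐ[volume] 0 := by
  obtain ⟨η, hη, hk, hlim⟩ := exists_approx_kernels (F := ℝ)
  have hz : ∀ n, avg (η n) h = 0 := by
    intro n
    refine eq_zero_of_sum_partialD_eq_zero hS (contDiff_avg (hη n) (MemLp.locInt hh))
      ((hk n).memLp_avg hh) fun x => ?_
    have e : ∀ i, partialD i (partialD i (avg (η n) h)) x
        = ∫ z, partialD i (partialD i (η n)) (x - z) * h z := by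
      intro i
      rw [← pd_eq_partialD i (avg (η n) h), pd_avg (hη n) (MemLp.locInt hh), ← pd_eq_partialD,
        pd_avg ((hη n).partialD i) (MemLp.locInt hh)]
      rfl
    simp only [e]
    rw [← integral_finsetSum]
    · have h2 := hL _ ((hη n).comp_sub_left x)
      rw [← h2]
      congr 1; funext z
      rw [← Finset.sum_mul]
      congr 1
      refine Finset.sum_congr rfl fun i _ => ?_
      have e1 : partialD i (fun y => η n (x - y)) = fun y => (-1) * partialD i (η n) (x - y) :=
        funext fun y => by rw [partialD_comp_sub_left (hη n).differentiable]; ring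
      rw [e1, partialD_const_mul (((hη n).partialD i).comp_sub_left x).differentiable,
        partialD_comp_sub_left ((hη n).partialD i).differentiable]
      ring
    · exact fun i _ => integrable_avg' ((((hη n).partialD i).partialD i).memLp 2) hh x
  have h3 := hlim h hh
  simp only [hz, Pi.zero_apply, zero_sub] at h3
  have h4 : eLpNorm (fun x => - h x) 2 volume = 0 := tendsto_nhds_unique tendsto_const_nhds h3
  rw [eLpNorm_eq_zero_iff (f := fun x => - h x) hh.1.neg (by norm_num)] at h4
  filter_upwards [h4] with x hx
  simpa using hx

end Liouville

/-! ### Density of partial Laplacians of test functions -/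

section TestSpace

/-- The vector space of test functions. -/
def TestSpace : Submodule ℝ (E3 → ℝ) where
  carrier := {φ | IsTest φ}
  add_mem' h h' := IsTest.add h h'
  zero_mem' := isTest_zero
  smul_mem' c _ h := IsTest.const_mul h c

/-- The inclusion of test functions in `L²`. -/
def testToLp : TestSpace →ₗ[ℝ] Lp ℝ 2 (volume : Measure E3) where
  toFun φ := (IsTest.memLp φ.2 2).toLp φ.1
  map_add' _ _ := rfl
  map_smul' _ _ := rfl

/-- The operator `∂ᵢ∂ᵢ` on test functions. -/
def secondD (i : Fin 3) : TestSpace →ₗ[ℝ] TestSpace where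
  toFun φ := ⟨partialD i (partialD i φ.1), (IsTest.partialD φ.2 i).partialD i⟩
  map_add' φ ψ := by
    have h1 : partialD i (φ.1 + ψ.1) = fun x => partialD i φ.1 x + partialD i ψ.1 x :=
      funext fun x => partialD_add (IsTest.differentiable φ.2) (IsTest.differentiable ψ.2) i x
    apply Subtype.ext
    funext x
    change partialD i (partialD i (φ.1 + ψ.1)) x = _
    rw [h1, partialD_add (IsTest.partialD φ.2 i).differentiable
      (IsTest.partialD ψ.2 i).differentiable]
    rfl
  map_smul' c φ := by
    have h1 : partialD i (c • φ.1) = fun x => c * partialD i φ.1 x :=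
      funext fun x => partialD_const_mul (IsTest.differentiable φ.2) c i x
    apply Subtype.ext
    funext x
    change partialD i (partialD i (c • φ.1)) x = _
    rw [h1, partialD_const_mul (IsTest.partialD φ.2 i).differentiable]
    rfl

/-- The operator `∑_{i ∈ S} ∂ᵢ∂ᵢ` from test functions to `L²`. -/
def partialLaplacian (S : Finset (Fin 3)) : TestSpace →ₗ[ℝ] Lp ℝ 2 (volume : Measure E3) :=
  ∑ i ∈ S, testToLp ∘ₗ secondD i

theorem testToLp_coe (φ : TestSpace) : testToLp φ =ᵐ[volume] φ.1 :=
  MemLp.coeFn_toLp (IsTest.memLp φ.2 2)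

theorem inner_testToLp (h : Lp ℝ 2 (volume : Measure E3)) (φ : TestSpace) :
    inner ℝ h (testToLp φ) = ∫ x, φ.1 x * h x := by
  rw [L2.inner_def]
  refine integral_congr_ae ?_
  filter_upwards [testToLp_coe φ] with x hx
  rw [hx]; rfl

/-- An element orthogonal to the range solves ∑ ∂ᵢ²h = 0 weakly, so it is zero by Liouville. The
full index set serves to define ∂₃²Δ⁻¹; the sets {0, 1} and {2} serve the cigar and pancake limits.
-/
theorem denseRange_partialLaplacian {S : Finset (Fin 3)} (hS : S.Nonempty) :
    DenseRange (partialLaplacian S) := by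
  have h : (LinearMap.range (partialLaplacian S)).topologicalClosure = ⊤ := by
    rw [Submodule.topologicalClosure_eq_top_iff, Submodule.eq_bot_iff]
    intro h hh
    rw [Submodule.mem_orthogonal'] at hh
    have hz : (h : E3 → ℝ) =ᵐ[volume] 0 := by
      refine ae_eq_zero_of_forall_integral_sum_partialD hS (Lp.memLp h) fun φ hφ => ?_
      have h2 := hh _ ⟨⟨φ, hφ⟩, rfl⟩
      simp only [partialLaplacian, LinearMap.sum_apply, LinearMap.comp_apply, inner_sum,
        inner_testToLp] at h2
      rw [← h2, ← integral_finsetSum]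
      · simp only [Finset.sum_mul]; rfl
      · exact fun i _ => IsTest.integrable_smul (secondD i ⟨φ, hφ⟩).2 (Lp.memLp h)
    exact (Lp.eq_zero_iff_ae_eq_zero).mpr hz
  rw [DenseRange, ← LinearMap.coe_range]
  exact Submodule.dense_iff_topologicalClosure_eq_top.mpr h

end TestSpace

/-! ### The operator ∂₃²Δ⁻¹ on L² -/

section RieszOperator

theorem integral_secondD_mul {φ ψ : E3 → ℝ} (hφ : IsTest φ) (hψ : IsTest ψ) (i j : Fin 3) :
    ∫ x, partialD i (partialD i φ) x * partialD j (partialD j ψ) x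
      = ∫ x, partialD i (partialD j φ) x * partialD i (partialD j ψ) x := by
  rw [integral_mul_partialD ((hφ.partialD i).partialD i).1 (hψ.partialD j),
    partialD_comm (hφ.partialD i).1 j i, partialD_comm hφ.1 j i,
    integral_mul_partialD ((hφ.partialD j).partialD i).1 (hψ.partialD j)]

theorem inner_secondD (φ ψ : TestSpace) (i j : Fin 3) :
    inner ℝ (testToLp (secondD i φ)) (testToLp (secondD j ψ))
      = ∫ x, partialD i (partialD j φ.1) x * partialD i (partialD j ψ.1) x := by
  rw [inner_testToLp, ← integral_secondD_mul φ.2 ψ.2]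
  refine integral_congr_ae ?_
  filter_upwards [testToLp_coe (secondD i φ)] with x hx
  rw [hx, mul_comm]; rfl

/-- Expanding ‖Δφ‖², each term ⟨∂ᵢ²φ, ∂ⱼ²φ⟩ equals ∫ (∂ᵢ∂ⱼφ)² ≥ 0, so a single diagonal term is at
most the sum. -/
theorem norm_secondD_le (φ : TestSpace) (i : Fin 3) :
    ‖testToLp (secondD i φ)‖ ≤ ‖partialLaplacian Finset.univ φ‖ := by
  refine le_of_sq_le_sq ?_ (norm_nonneg _)
  rw [← real_inner_self_eq_norm_sq, ← real_inner_self_eq_norm_sq]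
  simp only [partialLaplacian, LinearMap.sum_apply, LinearMap.comp_apply, inner_sum, sum_inner]
  have h : ∀ i j, 0 ≤ inner ℝ (testToLp (secondD i φ)) (testToLp (secondD j φ)) := fun i j => by
    rw [inner_secondD]
    exact integral_nonneg fun x => mul_self_nonneg _
  refine (Finset.single_le_sum (f := fun j => inner ℝ (testToLp (secondD j φ))
    (testToLp (secondD i φ))) (fun j _ => h j i) (Finset.mem_univ i)).trans ?_
  exact Finset.single_le_sum (f := fun k => ∑ j, inner ℝ (testToLp (secondD j φ))
    (testToLp (secondD k φ))) (fun k _ => Finset.sum_nonneg fun j _ => h j k) (Finset.mem_univ i)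

/-- The operator `∂₃² Δ⁻¹` on `L²`. -/
def rieszOp : Lp ℝ 2 (volume : Measure E3) →L[ℝ] Lp ℝ 2 (volume : Measure E3) :=
  (testToLp ∘ₗ secondD 2).extendOfNorm (partialLaplacian Finset.univ)

theorem rieszOp_bound : ∀ φ : TestSpace,
    ‖(testToLp ∘ₗ secondD 2) φ‖ ≤ 1 * ‖partialLaplacian Finset.univ φ‖ := fun φ => by
  simpa using norm_secondD_le φ 2

theorem rieszOp_laplacian (φ : TestSpace) :
    rieszOp (partialLaplacian Finset.univ φ) = testToLp (secondD 2 φ) :=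
  LinearMap.extendOfNorm_eq (denseRange_partialLaplacian Finset.univ_nonempty)
    ⟨1, rieszOp_bound⟩ φ

theorem norm_rieszOp_le (v : Lp ℝ 2 (volume : Measure E3)) : ‖rieszOp v‖ ≤ ‖v‖ := by
  have h := LinearMap.norm_extendOfNorm_apply_le
    (denseRange_partialLaplacian Finset.univ_nonempty) 1 rieszOp_bound v
  rwa [one_mul] at h

/-- By density it suffices to take Laplacians Δφ and Δψ; both sides are then the symmetric
expression ∑ⱼ ∫ ∂₃∂ⱼφ ∂₃∂ⱼψ. -/
theorem rieszOp_symm (u v : Lp ℝ 2 (volume : Measure E3)) :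
    inner ℝ (rieszOp u) v = inner ℝ u (rieszOp v) := by
  have hd := denseRange_partialLaplacian (S := Finset.univ) Finset.univ_nonempty
  refine hd.induction_on (p := fun u => inner ℝ (rieszOp u) v = inner ℝ u (rieszOp v)) u
    (isClosed_eq (by fun_prop) (by fun_prop)) fun φ => ?_
  refine hd.induction_on (p := fun v => inner ℝ (rieszOp (partialLaplacian Finset.univ φ)) v
    = inner ℝ (partialLaplacian Finset.univ φ) (rieszOp v)) v
    (isClosed_eq (by fun_prop) (by fun_prop)) fun ψ => ?_
  rw [rieszOp_laplacian, rieszOp_laplacian]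
  simp only [partialLaplacian, LinearMap.sum_apply, LinearMap.comp_apply, inner_sum, sum_inner,
    inner_secondD]
  refine Finset.sum_congr rfl fun j _ => ?_
  have h1 : IsTest φ.1 := φ.2
  have h2 : IsTest ψ.1 := ψ.2
  rw [partialD_comm h1.1 2 j, partialD_comm h2.1 2 j]

end RieszOperator

/-! ### The field of a charged ball -/

section TruncatedKernel

/-- The gradient of the potential of a uniformly charged ball of radius `ε`. -/
def ballField (ε : ℝ) (i : Fin 3) (z : E3) : ℝ := - (z i * (max ‖z‖ ε)⁻¹ ^ 3)

/-- Replacing |z| by max(|z|, ε) removes the singularity at the origin and keeps the field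
continuous across the sphere |z| = ε. Lipschitz regularity is what later allows integration by parts
without a surface term. -/
theorem ballField_lipschitz {ε : ℝ} (hε : 0 < ε) (i : Fin 3) :
    ∃ C, LipschitzWith C (ballField ε i) := by
  set m : E3 → ℝ := fun z => max ‖z‖ ε with hm
  have m0 : ∀ z, 0 < m z := fun z => lt_max_of_lt_right hε
  have mε : ∀ z, (m z)⁻¹ ≤ ε⁻¹ := fun z => inv_anti₀ hε (le_max_right _ _)
  have mlip : ∀ z w, |m z - m w| ≤ ‖z - w‖ := fun z w =>
    (abs_max_sub_max_le_abs _ _ _).trans (abs_norm_sub_norm_le z w)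
  have binv : ∀ z w, |(m z)⁻¹ - (m w)⁻¹| ≤ ‖z - w‖ * (m z)⁻¹ * (m w)⁻¹ := by
    intro z w
    rw [inv_sub_inv (m0 z).ne' (m0 w).ne', abs_div, abs_mul, abs_of_pos (m0 z), abs_of_pos (m0 w),
      div_eq_mul_inv, mul_inv, ← mul_assoc, abs_sub_comm]
    have := mlip z w
    have h1 := (inv_pos.mpr (m0 z)).le
    have h2 := (inv_pos.mpr (m0 w)).le
    gcongr
  have zi : ∀ z : E3, |z i| * (m z)⁻¹ ≤ 1 := fun z => by
    rw [← div_eq_mul_inv, div_le_one (m0 z)]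
    exact (PiLp.norm_apply_le z i).trans (le_max_left _ _)
  have I0 : 0 < ε⁻¹ := inv_pos.mpr hε
  refine ⟨Real.toNNReal (4 * ε⁻¹ ^ 3), LipschitzWith.of_dist_le_mul fun z w => ?_⟩
  rw [Real.coe_toNNReal _ (by positivity), Real.dist_eq, dist_eq_norm]
  have hd : |z i - w i| ≤ ‖z - w‖ := PiLp.norm_apply_le (z - w) i
  set a := (m z)⁻¹ with ha
  set b := (m w)⁻¹ with hb
  have ha0 : 0 < a := inv_pos.mpr (m0 z)
  have hb0 : 0 < b := inv_pos.mpr (m0 w)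
  -- The factorization pairs w i with b and |a - b| with b⁻¹, the two products bounded without
  -- reference to the size of w.
  have e : ballField ε i z - ballField ε i w
      = - ((z i - w i) * a ^ 3) - (w i * b) * ((a - b) * b⁻¹ * (a ^ 2 + a * b + b ^ 2)) := by
    simp only [ballField]
    change -(z i * a ^ 3) - -(w i * b ^ 3) = _
    field_simp
    ring
  have h1 : |a - b| * b⁻¹ ≤ ‖z - w‖ * a := by
    rw [mul_inv_le_iff₀ hb0]; exact binv z w
  rw [e]
  refine (abs_sub _ _).trans ?_
  rw [abs_neg, abs_mul, abs_mul, abs_mul, abs_mul, abs_mul, abs_of_pos (pow_pos ha0 3),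
    abs_of_pos (inv_pos.mpr hb0), abs_of_pos (by positivity : 0 < a ^ 2 + a * b + b ^ 2),
    abs_of_pos hb0]
  have hae : a ≤ ε⁻¹ := mε z
  have hbe : b ≤ ε⁻¹ := mε w
  calc |z i - w i| * a ^ 3 + |w i| * b * (|a - b| * b⁻¹ * (a ^ 2 + a * b + b ^ 2))
      ≤ ‖z - w‖ * ε⁻¹ ^ 3 + 1 * (‖z - w‖ * ε⁻¹ * (ε⁻¹ ^ 2 + ε⁻¹ * ε⁻¹ + ε⁻¹ ^ 2)) := by
        refine add_le_add (by gcongr) (mul_le_mul (zi w) ?_ (by positivity) zero_le_one)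
        refine mul_le_mul (h1.trans (by gcongr)) ?_ (by positivity) (by positivity)
        gcongr
    _ = 4 * ε⁻¹ ^ 3 * ‖z - w‖ := by ring

theorem lineDeriv_ballField_of_lt {ε : ℝ} (i j : Fin 3) {z : E3} (hz : ‖z‖ < ε) :
    lineDeriv ℝ (ballField ε i) z (ee j) = - ((ee j) i * ε⁻¹ ^ 3) := by
  have h : HasLineDerivAt ℝ (ballField ε i) (- ((ee j) i * ε⁻¹ ^ 3)) z (ee j) := by
    have h1 : HasDerivAt (fun t : ℝ => - ((z i + t * (ee j) i) * ε⁻¹ ^ 3))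
        (- ((ee j) i * ε⁻¹ ^ 3)) 0 := by
      exact ((((hasDerivAt_id (0 : ℝ)).mul_const ((ee j) i)).const_add (z i)).mul_const
        (ε⁻¹ ^ 3)).neg.congr_deriv (by simp)
    refine h1.congr_of_eventuallyEq ?_
    have hc : Continuous fun t : ℝ => ‖z + t • ee j‖ := by fun_prop
    filter_upwards [hc.continuousAt.eventually_lt continuousAt_const
      (by simpa using hz : ‖z + (0 : ℝ) • ee j‖ < ε)] with t ht
    simp only [ballField]
    rw [max_eq_right ht.le]
    simp
  exact h.lineDeriv

/-- Outside the ball the field is the gradient of 1/|z|. Its Jacobian is therefore symmetric and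
trace-free, and the entry i = j = 2 is minus the dipole kernel. -/
theorem lineDeriv_ballField_of_gt {ε : ℝ} (hε : 0 < ε) (i j : Fin 3) {z : E3} (hz : ε < ‖z‖) :
    lineDeriv ℝ (ballField ε i) z (ee j)
      = - ((ee j) i * ‖z‖⁻¹ ^ 3) + 3 * z i * z j * ‖z‖⁻¹ ^ 5 := by
  have hz0 : 0 < ‖z‖ := hε.trans hz
  have h : HasLineDerivAt ℝ (ballField ε i)
      (- ((ee j) i * ‖z‖⁻¹ ^ 3) + 3 * z i * z j * ‖z‖⁻¹ ^ 5) z (ee j) := by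
    have hl : HasDerivAt (fun t : ℝ => z + t • ee j) (ee j) 0 := by
      simpa using ((hasDerivAt_id (0 : ℝ)).smul_const (ee j)).const_add z
    have hn : HasDerivAt (fun t : ℝ => ‖z + t • ee j‖) (z j / ‖z‖) 0 := by
      have h2 := hl.norm_sq.sqrt (by simpa using hz0.ne')
      simp only [Real.sqrt_sq (norm_nonneg _)] at h2
      convert h2 using 1
      simp [EuclideanSpace.inner_single_right]
      field_simp
    have h1 : HasDerivAt (fun t : ℝ => - ((z i + t * (ee j) i) * ‖z + t • ee j‖⁻¹ ^ 3))
        (- ((ee j) i * ‖z‖⁻¹ ^ 3) + 3 * z i * z j * ‖z‖⁻¹ ^ 5) 0 := by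
      have h3 := hn.fun_inv (by simpa using hz0.ne')
      have h4 := ((((hasDerivAt_id (0 : ℝ)).mul_const ((ee j) i)).const_add (z i)).mul
        (h3.fun_pow 3)).neg
      refine (h4.congr_deriv ?_)
      simp
      field_simp
      ring
    refine h1.congr_of_eventuallyEq ?_
    have hc : Continuous fun t : ℝ => ‖z + t • ee j‖ := by fun_prop
    filter_upwards [continuousAt_const.eventually_lt hc.continuousAt
      (by simpa using hz : ε < ‖z + (0 : ℝ) • ee j‖)] with t ht
    simp only [ballField]
    rw [max_eq_left ht.le]
    simp
  exact h.lineDeriv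

theorem ae_norm_ne (ε : ℝ) (hε : 0 < ε) : ∀ᵐ z : E3, ‖z‖ ≠ ε := by
  have := Measure.addHaar_sphere_of_ne_zero (volume : Measure E3) 0 hε.ne'
  rw [measure_eq_zero_iff_ae_notMem] at this
  filter_upwards [this] with z hz
  simpa using hz

/-- Integration by parts against the field of the charged ball. -/
theorem integral_lineDeriv_ballField {ε : ℝ} (hε : 0 < ε) (i j : Fin 3) {φ : E3 → ℝ}
    (hφ : IsTest φ) : ∫ z, lineDeriv ℝ (ballField ε i) z (ee j) * φ z
      = - ∫ z, partialD j φ z * ballField ε i z := by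
  obtain ⟨C, hC⟩ := ballField_lipschitz hε i
  obtain ⟨D, hD⟩ := ContDiff.lipschitzWith_of_hasCompactSupport hφ.2 hφ.1 (by simp)
  rw [hC.integral_lineDeriv_mul_eq hD hφ.2, ← integral_neg]
  congr 1; funext z
  rw [(hφ.differentiable z).lineDeriv_eq_fderiv, partialD, map_neg, neg_mul]

/-- The field is curl-free, ∂ⱼF₂ = ∂₂Fⱼ away from the sphere, so repeated integration by parts
exchanges the indices of the field with those of the second derivatives of φ. -/
theorem integral_lineDeriv_ballField_swap {ε : ℝ} (hε : 0 < ε) (j : Fin 3) {φ : E3 → ℝ}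
    (hφ : IsTest φ) :
    ∫ z, lineDeriv ℝ (ballField ε 2) z (ee 2) * partialD j (partialD j φ) z
      = ∫ z, lineDeriv ℝ (ballField ε j) z (ee j) * partialD 2 (partialD 2 φ) z := by
  rw [integral_lineDeriv_ballField hε 2 2 ((hφ.partialD j).partialD j),
    partialD_comm (hφ.partialD j).1 2 j,
    ← integral_lineDeriv_ballField hε 2 j ((hφ.partialD j).partialD 2),
    integral_lineDeriv_ballField hε j j ((hφ.partialD 2).partialD 2),
    partialD_comm (hφ.partialD 2).1 j 2, partialD_comm hφ.1 j 2,
    ← integral_lineDeriv_ballField hε j 2 ((hφ.partialD j).partialD 2)]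
  refine integral_congr_ae ?_
  filter_upwards [ae_norm_ne ε hε] with z hz
  have hs : (ee j) 2 = (ee 2) j := by simp [eq_comm]
  rcases lt_or_gt_of_ne hz with h | h
  · rw [lineDeriv_ballField_of_lt 2 j h, lineDeriv_ballField_of_lt j 2 h, hs]
  · rw [lineDeriv_ballField_of_gt hε 2 j h, lineDeriv_ballField_of_gt hε j 2 h, hs]
    ring

end TruncatedKernel

/-! ### The principal value as a bounded operator -/

section DipoleConvolution

/-- The dipole kernel truncated to `{‖z‖ > ε}`. -/
def truncK (ε : ℝ) : E3 → ℝ := Set.indicator {z | ε < ‖z‖} dipoleKernel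

/-- The indicator of the ball of radius `ε`, divided by `ε³`. -/
def ballK (ε : ℝ) : E3 → ℝ := Set.indicator (Metric.ball 0 ε) fun _ => ε⁻¹ ^ 3

theorem norm_sq_E3 (z : E3) : ‖z‖ ^ 2 = z 0 ^ 2 + z 1 ^ 2 + z 2 ^ 2 := by
  rw [EuclideanSpace.norm_sq_eq]; simp [Fin.sum_univ_three]

theorem measurable_dipoleKernel : Measurable dipoleKernel := by
  unfold dipoleKernel
  fun_prop

theorem measurable_truncK (ε : ℝ) : Measurable (truncK ε) :=
  measurable_dipoleKernel.indicator (measurableSet_lt measurable_const measurable_norm)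

theorem measurable_ballK (ε : ℝ) : Measurable (ballK ε) :=
  measurable_const.indicator Metric.isOpen_ball.measurableSet

theorem abs_dipoleKernel_le (z : E3) : |dipoleKernel z| ≤ 2 * (‖z‖⁻¹) ^ 3 := by
  rcases eq_or_ne z 0 with rfl | hz
  · simp [dipoleKernel]
  have h0 : 0 < ‖z‖ := norm_pos_iff.mpr hz
  have h1 : |z 0 ^ 2 + z 1 ^ 2 - 2 * z 2 ^ 2| ≤ 2 * ‖z‖ ^ 2 := by
    rw [norm_sq_E3, abs_le]
    constructor <;> nlinarith [sq_nonneg (z 0), sq_nonneg (z 1), sq_nonneg (z 2)]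
  rw [dipoleKernel, abs_div, abs_of_pos (pow_pos h0 5), div_le_iff₀ (by positivity)]
  calc _ ≤ _ := h1
    _ = _ := by field_simp

theorem memLp_truncK {ε : ℝ} (hε : 0 < ε) : MemLp (truncK ε) 2 volume := by
  rw [memLp_two_iff_integrable_sq (measurable_truncK ε).aestronglyMeasurable]
  have h1 : Integrable (fun z : E3 => (1 + ‖z‖) ^ (-(6 : ℝ))) :=
    integrable_one_add_norm (by simp; norm_num)
  refine (h1.const_mul (4 * ((1 + ε) / ε) ^ 6)).mono'
    ((measurable_truncK ε).pow_const 2).aestronglyMeasurable (ae_of_all _ fun z => ?_)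
  rw [Real.norm_of_nonneg (sq_nonneg _)]
  have e6 : (1 + ‖z‖) ^ (-(6 : ℝ)) = ((1 + ‖z‖)⁻¹) ^ 6 := by
    rw [Real.rpow_neg (by positivity), inv_pow]
    norm_cast
  rw [e6]
  by_cases hz : ε < ‖z‖
  · rw [truncK, Set.indicator_of_mem (by exact hz)]
    have h0 : 0 < ‖z‖ := hε.trans hz
    have h2 : ‖z‖⁻¹ ≤ (1 + ε) / ε * (1 + ‖z‖)⁻¹ := by
      rw [← div_eq_mul_inv, inv_eq_one_div, div_div, div_le_div_iff₀ h0 (by positivity)]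
      nlinarith
    calc dipoleKernel z ^ 2 = |dipoleKernel z| ^ 2 := (sq_abs _).symm
      _ ≤ (2 * (‖z‖⁻¹) ^ 3) ^ 2 := by gcongr; exact abs_dipoleKernel_le z
      _ = 4 * (‖z‖⁻¹) ^ 6 := by ring
      _ ≤ 4 * ((1 + ε) / ε * (1 + ‖z‖)⁻¹) ^ 6 := by gcongr
      _ = _ := by ring
  · rw [truncK, Set.indicator_of_notMem (by exact hz), zero_pow two_ne_zero]
    positivity

theorem isKernel_ballK {ε : ℝ} (hε : 0 < ε) :
    IsKernel ε (fun z => (4 * Real.pi / 3)⁻¹ * ballK ε z) := by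
  have hpi := Real.pi_pos
  refine ⟨(measurable_ballK ε).const_mul _, fun y => ?_, ⟨(4 * Real.pi / 3)⁻¹ * ε⁻¹ ^ 3, fun y => ?_⟩,
    fun y hy => ?_, ?_⟩
  · exact mul_nonneg (by positivity) (Set.indicator_nonneg (fun _ _ => by positivity) _)
  · refine mul_le_mul_of_nonneg_left ?_ (by positivity)
    exact Set.indicator_le_self' (fun _ _ => by positivity) y
  · rw [ballK, Set.indicator_of_notMem (by simpa using hy.le), mul_zero]
  · rw [integral_const_mul, ballK, integral_indicator Metric.isOpen_ball.measurableSet,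
      setIntegral_const, Measure.real, EuclideanSpace.volume_ball_fin_three]
    rw [ENNReal.toReal_mul, ENNReal.toReal_pow, ENNReal.toReal_ofReal hε.le,
      ENNReal.toReal_ofReal (by positivity), smul_eq_mul]
    field_simp

theorem memLp_ballK {ε : ℝ} (hε : 0 < ε) : MemLp (ballK ε) 2 volume := by
  have h := (isKernel_ballK hε).memLp_two.const_mul (4 * Real.pi / 3)
  have hpi := Real.pi_pos
  refine (memLp_congr_ae (ae_of_all _ fun z => ?_)).mp h
  field_simp

/-- For the field F of the charged ball, ∂₂F₂ is minus the sum of the truncated kernel and the ball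
kernel, and div F is -3 times the ball kernel. Summing the index exchange ∫ ∂₂F₂ ∂ⱼ²φ = ∫ ∂ⱼFⱼ ∂₂²φ
over j gives the identity, exactly and for every ε. -/
theorem integral_truncK_laplacian {ε : ℝ} (hε : 0 < ε) {φ : E3 → ℝ} (hφ : IsTest φ) :
    ∫ z, truncK ε z * ∑ j, partialD j (partialD j φ) z
      = ∫ z, ballK ε z * (3 * partialD 2 (partialD 2 φ) z - ∑ j, partialD j (partialD j φ) z) := by
  have hint : ∀ i j {ψ : E3 → ℝ}, IsTest ψ →
      Integrable (fun z => lineDeriv ℝ (ballField ε i) z (ee j) * ψ z) := by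
    intro i j ψ hψ
    obtain ⟨C, hC⟩ := ballField_lipschitz hε i
    have hm : MemLp (fun z => lineDeriv ℝ (ballField ε i) z (ee j)) ∞ volume :=
      hC.memLp_lineDeriv (ee j)
    rw [← memLp_one_iff_integrable]
    exact (hψ.memLp 1).mul hm
  have hd : ∀ j, IsTest (partialD j (partialD j φ)) := fun j => (hφ.partialD j).partialD j
  have hsum := Finset.sum_congr (rfl : (Finset.univ : Finset (Fin 3)) = Finset.univ)
    fun j _ => integral_lineDeriv_ballField_swap hε j hφ
  rw [← integral_finsetSum _ fun j _ => hint 2 2 (hd j),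
    ← integral_finsetSum _ fun j _ => hint j j (hd 2)] at hsum
  have hT : IsTest (fun z => ∑ j, partialD j (partialD j φ) z) := IsTest.sum _ fun j _ => hd j
  have e1 : ∫ z, ∑ j, lineDeriv ℝ (ballField ε 2) z (ee 2) * partialD j (partialD j φ) z
      = ∫ z, - ((truncK ε z + ballK ε z) * ∑ j, partialD j (partialD j φ) z) := by
    refine integral_congr_ae ?_
    filter_upwards [ae_norm_ne ε hε] with z hz
    rw [← Finset.mul_sum, ← neg_mul]
    congr 1
    rcases lt_or_gt_of_ne hz with h | h
    · rw [lineDeriv_ballField_of_lt 2 2 h, truncK, ballK, Set.indicator_of_notMem (by simpa using h.le),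
        Set.indicator_of_mem (by simpa using h)]
      simp
    · rw [lineDeriv_ballField_of_gt hε 2 2 h, truncK, ballK, Set.indicator_of_mem (by exact h),
        Set.indicator_of_notMem (by simpa using h.le)]
      have h0 : 0 < ‖z‖ := hε.trans h
      have h2 := norm_sq_E3 z
      simp [dipoleKernel]
      field_simp
      rw [h2]; ring
  have e2 : ∫ z, ∑ j, lineDeriv ℝ (ballField ε j) z (ee j) * partialD 2 (partialD 2 φ) z
      = ∫ z, - (ballK ε z * (3 * partialD 2 (partialD 2 φ) z)) := by
    refine integral_congr_ae ?_
    filter_upwards [ae_norm_ne ε hε] with z hz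
    rw [← Finset.sum_mul, ← mul_assoc, ← neg_mul]
    congr 1
    rcases lt_or_gt_of_ne hz with h | h
    · simp only [lineDeriv_ballField_of_lt _ _ h, ballK]
      rw [Set.indicator_of_mem (by simpa using h)]
      simp; ring
    · simp only [lineDeriv_ballField_of_gt hε _ _ h, ballK]
      rw [Set.indicator_of_notMem (by simpa using h.le)]
      have h0 : 0 < ‖z‖ := hε.trans h
      have h2 := norm_sq_E3 z
      simp [Fin.sum_univ_three]
      field_simp
      rw [h2]; ring
  rw [e1, e2, integral_neg, integral_neg, neg_inj] at hsum
  have i1 : Integrable (fun z => truncK ε z * ∑ j, partialD j (partialD j φ) z) := by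
    simpa [mul_comm] using hT.integrable_smul (memLp_truncK hε)
  have i2 : Integrable (fun z => ballK ε z * ∑ j, partialD j (partialD j φ) z) := by
    simpa [mul_comm] using hT.integrable_smul (memLp_ballK hε)
  have i3 : Integrable (fun z => ballK ε z * (3 * partialD 2 (partialD 2 φ) z)) := by
    simpa [mul_comm] using ((hd 2).const_mul 3).integrable_smul (memLp_ballK hε)
  simp only [add_mul] at hsum
  rw [integral_add i1 i2] at hsum
  simp only [mul_sub]
  rw [integral_sub i3 i2]
  linarith

/-- Convolution with a square-integrable kernel, as a functional on `L²`. -/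
def avgL {η : E3 → ℝ} (hη : MemLp η 2 volume) (x : E3) : Lp ℝ 2 (volume : Measure E3) →L[ℝ] ℝ :=
  innerSL ℝ ((memLp_comp_sub_left hη x).toLp _)

theorem avgL_apply {η : E3 → ℝ} (hη : MemLp η 2 volume) (x : E3)
    (v : Lp ℝ 2 (volume : Measure E3)) : avgL hη x v = avg η v x := by
  rw [avgL, innerSL_apply_apply, L2.inner_def, avg]
  refine integral_congr_ae ?_
  filter_upwards [(memLp_comp_sub_left hη x).coeFn_toLp] with z hz
  rw [hz]; simp [mul_comm]

theorem avg_congr {F : Type*} [NormedAddCommGroup F] [NormedSpace ℝ F] {η : E3 → ℝ} {f g : E3 → F}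
    (h : f =ᵐ[volume] g) : avg η f = avg η g := by
  funext x
  refine integral_congr_ae ?_
  filter_upwards [h] with z hz
  rw [hz]

/-- The truncated dipole convolution is the average over a ball of a fixed `L²` function. -/
theorem avg_truncK {ε : ℝ} (hε : 0 < ε) (v : Lp ℝ 2 (volume : Measure E3)) (x : E3) :
    avg (truncK ε) v x = avg (ballK ε) ((3 : ℝ) • rieszOp v - v : Lp ℝ 2 (volume : Measure E3)) x := by
  rw [← avgL_apply (memLp_truncK hε), ← avgL_apply (memLp_ballK hε)]
  have hd := denseRange_partialLaplacian (S := Finset.univ) Finset.univ_nonempty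
  -- For fixed x both sides are continuous functionals of v, so the identity need only be checked on
  -- Laplacians of test functions.
  refine hd.induction_on (p := fun v => avgL (memLp_truncK hε) x v
    = avgL (memLp_ballK hε) x ((3 : ℝ) • rieszOp v - v)) v
    (isClosed_eq (by fun_prop) (by fun_prop)) fun φ => ?_
  have hφ : IsTest φ.1 := φ.2
  rw [avgL_apply, avgL_apply, rieszOp_laplacian]
  have hψ := hφ.comp_sub_left x
  have hp : ∀ j z, partialD j (partialD j fun y => φ.1 (x - y)) z
      = partialD j (partialD j φ.1) (x - z) := by
    intro j z
    have e1 : partialD j (fun y => φ.1 (x - y)) = fun y => (-1) * partialD j φ.1 (x - y) :=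
      funext fun y => by rw [partialD_comp_sub_left hφ.differentiable]; ring
    rw [e1, partialD_const_mul ((hφ.partialD j).comp_sub_left x).differentiable,
      partialD_comp_sub_left (hφ.partialD j).differentiable]
    ring
  have key := integral_truncK_laplacian hε hψ
  simp only [hp] at key
  have c1 : partialLaplacian Finset.univ φ
      =ᵐ[volume] fun z => ∑ j, partialD j (partialD j φ.1) z := by
    simp only [partialLaplacian, LinearMap.sum_apply, LinearMap.comp_apply]
    have h2 : ∀ j, (testToLp (secondD j φ) : E3 → ℝ) =ᵐ[volume] partialD j (partialD j φ.1) :=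
      fun j => testToLp_coe _
    rw [Fin.sum_univ_three]
    filter_upwards [h2 0, h2 1, h2 2, Lp.coeFn_add (testToLp (secondD 0 φ) + testToLp (secondD 1 φ))
      (testToLp (secondD 2 φ)), Lp.coeFn_add (testToLp (secondD 0 φ)) (testToLp (secondD 1 φ))]
      with z h0 h1 h2 h3 h4
    rw [h3, Pi.add_apply, h4, Pi.add_apply, h0, h1, h2, Fin.sum_univ_three]
  have c2 : ((3 : ℝ) • testToLp (secondD 2 φ) - partialLaplacian Finset.univ φ :
      Lp ℝ 2 (volume : Measure E3)) =ᵐ[volume]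
      fun z => 3 * partialD 2 (partialD 2 φ.1) z - ∑ j, partialD j (partialD j φ.1) z := by
    filter_upwards [c1, testToLp_coe (secondD 2 φ), Lp.coeFn_smul (3 : ℝ) (testToLp (secondD 2 φ)),
      Lp.coeFn_sub ((3 : ℝ) • testToLp (secondD 2 φ)) (partialLaplacian Finset.univ φ)]
      with z h0 h1 h2 h3
    rw [h3, Pi.sub_apply, h2, Pi.smul_apply, h0, h1]; rfl
  rw [avg_congr c1, avg_congr c2, avg_eq, avg_eq]
  exact key

/-- The dipole convolution operator on `L²`. -/
def dipoleOp : Lp ℝ 2 (volume : Measure E3) →L[ℝ] Lp ℝ 2 (volume : Measure E3) :=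
  (4 * Real.pi / 3) • ((3 : ℝ) • rieszOp - ContinuousLinearMap.id ℝ _)

theorem dipoleOp_symm (u v : Lp ℝ 2 (volume : Measure E3)) :
    inner ℝ (dipoleOp u) v = inner ℝ u (dipoleOp v) := by
  simp only [dipoleOp, _root_.smul_apply, _root_.sub_apply,
    ContinuousLinearMap.id_apply, inner_smul_left, inner_smul_right, inner_sub_left,
    inner_sub_right, rieszOp_symm]
  rfl

theorem truncConv_eq (ε : ℝ) (ρ : E3 → ℝ) (x : E3) : truncConv ε ρ x = avg (truncK ε) ρ x := by
  rw [truncConv, avg, ← integral_indicator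
    (measurableSet_lt measurable_const (by fun_prop : Measurable fun y : E3 => ‖x - y‖))]
  congr 1; funext y
  by_cases h : ε < ‖x - y‖
  · rw [Set.indicator_of_mem (by exact h), truncK, Set.indicator_of_mem (by exact h)]; rfl
  · rw [Set.indicator_of_notMem (by exact h), truncK, Set.indicator_of_notMem (by exact h)]; simp

/-- The truncated convolution is 4π/3 times the average of the fixed function 3∂₃²Δ⁻¹ρ - ρ over
balls of radius ε, so L² convergence is the approximate-identity theorem. The factor 4π/3 is the
volume of the unit ball. -/
theorem isDipoleConv_dipoleOp {ρ : E3 → ℝ} (hρ : MemLp ρ 2 volume) :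
    IsDipoleConv ρ (dipoleOp (hρ.toLp ρ)) := by
  refine ⟨Lp.memLp _, ?_⟩
  set v := hρ.toLp ρ with hv
  set w : Lp ℝ 2 (volume : Measure E3) := (3 : ℝ) • rieszOp v - v with hw
  have hpi := Real.pi_pos
  have e : ∀ ε ∈ Set.Ioi (0 : ℝ), eLpNorm (fun x => truncConv ε ρ x - dipoleOp v x) 2 volume
      = ENNReal.ofReal (4 * Real.pi / 3) * eLpNorm (fun x =>
        avg (fun z => (4 * Real.pi / 3)⁻¹ * ballK ε z) w x - w x) 2 volume := by
    intro ε hε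
    have h1 : (fun x => truncConv ε ρ x - dipoleOp v x) =ᵐ[volume]
        (4 * Real.pi / 3) • fun x => avg (fun z => (4 * Real.pi / 3)⁻¹ * ballK ε z) w x - w x := by
      filter_upwards [Lp.coeFn_smul (4 * Real.pi / 3) w] with x hx
      have h2 : truncConv ε ρ x = avg (ballK ε) w x := by
        rw [truncConv_eq, avg_congr hρ.coeFn_toLp.symm, avg_truncK hε]
      have h3 : dipoleOp v = (4 * Real.pi / 3) • w := rfl
      have h4 : avg (fun z => (4 * Real.pi / 3)⁻¹ * ballK ε z) w x
          = (4 * Real.pi / 3)⁻¹ * avg (ballK ε) w x := by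
        simp only [avg, smul_eq_mul, mul_assoc, integral_const_mul]
      rw [h2, h3, hx, Pi.smul_apply, Pi.smul_apply, h4, smul_eq_mul, smul_eq_mul]
      field_simp
    rw [eLpNorm_congr_ae h1, eLpNorm_const_smul, Real.enorm_of_nonneg (by positivity)]
  refine Tendsto.congr' (eventually_nhdsWithin_of_forall fun ε hε => (e ε hε).symm) ?_
  rw [show (0 : ℝ≥0∞) = ENNReal.ofReal (4 * Real.pi / 3) * 0 by simp]
  refine ENNReal.Tendsto.const_mul ?_ (Or.inr (by simp))
  exact tendsto_eLpNorm_avg_sub (δ := fun ε : ℝ => ε)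
    (eventually_nhdsWithin_of_forall fun ε hε => isKernel_ballK hε)
    (tendsto_nhdsWithin_of_tendsto_nhds tendsto_id) (Lp.memLp w)

theorem IsDipoleConv.unique {ρ g g' : E3 → ℝ} (h : IsDipoleConv ρ g) (h' : IsDipoleConv ρ g')
    (hm : ∀ ε > 0, AEStronglyMeasurable (truncConv ε ρ) volume) : g =ᵐ[volume] g' := by
  have h1 : Tendsto (fun ε : ℝ => eLpNorm (fun x => truncConv ε ρ x - g' x) 2 volume
      + eLpNorm (fun x => truncConv ε ρ x - g x) 2 volume) (𝓝[>] 0) (𝓝 (0 + 0)) := h'.2.add h.2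
  have h2 : eLpNorm (fun x => g x - g' x) 2 volume ≤ 0 + 0 := by
    refine ge_of_tendsto h1 (eventually_nhdsWithin_of_forall fun ε hε => ?_)
    have e : (fun x => g x - g' x) = (fun x => truncConv ε ρ x - g' x)
        - fun x => truncConv ε ρ x - g x := by funext x; simp
    rw [e]
    exact eLpNorm_sub_le ((hm ε hε).sub h'.1.1) ((hm ε hε).sub h.1.1) (by norm_num)
  rw [add_zero, nonpos_iff_eq_zero, eLpNorm_eq_zero_iff (f := fun x => g x - g' x) (h.1.1.sub h'.1.1) (by norm_num)] at h2
  filter_upwards [h2] with x hx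
  simpa [sub_eq_zero] using hx

theorem aestronglyMeasurable_truncConv {ρ : E3 → ℝ} (hρ : MemLp ρ 2 volume) {ε : ℝ} (hε : 0 < ε) :
    AEStronglyMeasurable (truncConv ε ρ) volume := by
  have h2 : truncConv ε ρ = fun x => (4 * Real.pi / 3) * avg (fun z => (4 * Real.pi / 3)⁻¹ * ballK ε z)
      ((3 : ℝ) • rieszOp (hρ.toLp ρ) - hρ.toLp ρ : Lp ℝ 2 (volume : Measure E3)) x := by
    funext x
    have hpi := Real.pi_pos
    rw [truncConv_eq, avg_congr hρ.coeFn_toLp.symm, avg_truncK hε]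
    simp only [avg, smul_eq_mul, mul_assoc, integral_const_mul]
    field_simp
  rw [h2]
  exact ((isKernel_ballK hε).memLp_avg (Lp.memLp _)).1.const_mul _

/-- Existence of the L² limit excludes the default value 0 in the definition, and uniqueness
identifies the chosen limit almost everywhere. -/
theorem dipoleConv_ae_eq {ρ : E3 → ℝ} (hρ : MemLp ρ 2 volume) :
    dipoleConv ρ =ᵐ[volume] dipoleOp (hρ.toLp ρ) := by
  have h : ∃ g, IsDipoleConv ρ g := ⟨_, isDipoleConv_dipoleOp hρ⟩
  have h1 : dipoleConv ρ = h.choose := dif_pos h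
  rw [h1]
  exact IsDipoleConv.unique h.choose_spec (isDipoleConv_dipoleOp hρ) fun ε hε =>
    aestronglyMeasurable_truncConv hρ hε

end DipoleConvolution

/-! ### Integral forms of the norms and of N -/

section Functionals

/-- `f ∈ H¹` with weak partial derivatives `g`. -/
structure H1Data (f : E3 → ℂ) (g : Fin 3 → E3 → ℂ) : Prop where
  memLp : MemLp f 2 volume
  memLp_grad : ∀ i, MemLp (g i) 2 volume
  weak : ∀ i, WeakPD i f (g i)

theorem memH1_iff {f : E3 → ℂ} : MemH1 f ↔ ∃ g, H1Data f g := by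
  constructor
  · rintro ⟨hf, g, hg⟩
    rw [hasWeakGradient_iff] at hg
    exact ⟨fun i x => g x i, hf, fun i => hg.1.eval_piLp i, hg.2⟩
  · rintro ⟨g, h⟩
    refine ⟨h.memLp, fun x => WithLp.toLp 2 fun i => g i x, ?_⟩
    rw [hasWeakGradient_iff]
    exact ⟨MemLp.of_eval_piLp h.memLp_grad, h.weak⟩

theorem MemH1.h1Data {f : E3 → ℂ} (h : MemH1 f) : H1Data f fun i x => weakGrad f x i := by
  have h1 : HasWeakGradient f (weakGrad f) := by
    rw [weakGrad, dif_pos h.2]; exact h.2.choose_spec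
  rw [hasWeakGradient_iff] at h1
  exact ⟨h.1, fun i => h1.1.eval_piLp i, h1.2⟩

theorem lpNorm_pow_eq_integral {F : Type*} [NormedAddCommGroup F] {f : E3 → F}
    (hf : AEStronglyMeasurable f volume) (n : ℕ) (hn : n ≠ 0) :
    lpNorm f n volume ^ n = ∫ x, ‖f x‖ ^ n := by
  rw [lpNorm_eq_integral_norm_rpow_toReal (by exact_mod_cast hn) (by simp) hf]
  simp only [ENNReal.toReal_natCast, Real.rpow_natCast]
  rw [Real.rpow_inv_natCast_pow (integral_nonneg fun x => by positivity) hn]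

theorem MemLp.integrable_pow {F : Type*} [NormedAddCommGroup F] {f : E3 → F} {n : ℕ} (hn : n ≠ 0)
    (hf : MemLp f n volume) : Integrable fun x => ‖f x‖ ^ n := by
  exact hf.integrable_norm_pow hn

theorem memLp_of_integrable_pow {F : Type*} [NormedAddCommGroup F] {f : E3 → F} {n : ℕ}
    (hn : n ≠ 0) (hf : AEStronglyMeasurable f volume) (h : Integrable fun x => ‖f x‖ ^ n) :
    MemLp f n volume := by
  rw [← integrable_norm_rpow_iff hf (by exact_mod_cast hn) (by simp)]
  simpa using h

/-- `∫ |f|²`. -/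
def mass (f : E3 → ℂ) : ℝ := ∫ x, ‖f x‖ ^ 2

/-- `∑ᵢ ∫ |gᵢ|²`. -/
def gradSq (g : Fin 3 → E3 → ℂ) : ℝ := ∑ i, ∫ x, ‖g i x‖ ^ 2

/-- `∫ |f|⁶`. -/
def sixth (f : E3 → ℂ) : ℝ := ∫ x, ‖f x‖ ^ 6

theorem mass_nonneg (f : E3 → ℂ) : 0 ≤ mass f := integral_nonneg fun _ => by positivity
theorem sixth_nonneg (f : E3 → ℂ) : 0 ≤ sixth f := integral_nonneg fun _ => by positivity
theorem gradSq_nonneg (g : Fin 3 → E3 → ℂ) : 0 ≤ gradSq g :=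
  Finset.sum_nonneg fun _ _ => integral_nonneg fun _ => by positivity

theorem H1Data.grad_ae {f : E3 → ℂ} {g g' : Fin 3 → E3 → ℂ} (h : H1Data f g) (h' : H1Data f g')
    (i : Fin 3) : g i =ᵐ[volume] g' i :=
  (h.weak i).unique (h.memLp_grad i) (h'.memLp_grad i) (h'.weak i)

theorem H1Data.memH1 {f : E3 → ℂ} {g : Fin 3 → E3 → ℂ} (h : H1Data f g) : MemH1 f :=
  memH1_iff.mpr ⟨g, h⟩

theorem H1Data.normGrad_sq {f : E3 → ℂ} {g : Fin 3 → E3 → ℂ} (h : H1Data f g) :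
    normGrad f ^ 2 = gradSq g := by
  have h1 := h.memH1.h1Data
  have hm : MemLp (weakGrad f) 2 volume := MemLp.of_eval_piLp h1.memLp_grad
  have h2 := lpNorm_pow_eq_integral hm.1 2 two_ne_zero
  rw [normGrad]
  refine (h2.trans ?_)
  simp only [EuclideanSpace.norm_sq_eq]
  rw [integral_finsetSum _ fun i _ => MemLp.integrable_pow two_ne_zero (h1.memLp_grad i), gradSq]
  refine Finset.sum_congr rfl fun i _ => integral_congr_ae ?_
  filter_upwards [h1.grad_ae h i] with x hx
  rw [← hx]

theorem MemLp.normL_two_sq {f : E3 → ℂ} (h : MemLp f 2 volume) : normL 2 f ^ 2 = mass f :=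
  lpNorm_pow_eq_integral h.1 2 two_ne_zero

theorem MemLp.normL_six_pow {f : E3 → ℂ} (h : MemLp f 2 volume) : normL 6 f ^ 6 = sixth f :=
  lpNorm_pow_eq_integral h.1 6 (by norm_num)

theorem MemLp.normL_four_pow {f : E3 → ℂ} (h : MemLp f 2 volume) :
    normL 4 f ^ 4 = ∫ x, ‖f x‖ ^ 4 :=
  lpNorm_pow_eq_integral h.1 4 (by norm_num)

theorem H1Data.memLp_six {f : E3 → ℂ} {g : Fin 3 → E3 → ℂ} (h : H1Data f g) :
    MemLp f 6 volume := by
  obtain ⟨C, hC⟩ := exists_sobolev_const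
  refine ⟨h.memLp.1, (hC f g h.memLp h.memLp_grad h.weak).trans_lt ?_⟩
  exact ENNReal.mul_lt_top (by simp) (ENNReal.sum_lt_top.mpr fun i _ => (h.memLp_grad i).2)

theorem H1Data.integrable_sixth {f : E3 → ℂ} {g : Fin 3 → E3 → ℂ} (h : H1Data f g) :
    Integrable fun x => ‖f x‖ ^ 6 :=
  MemLp.integrable_pow (n := 6) (by norm_num) h.memLp_six

theorem H1Data.integrable_sq {f : E3 → ℂ} {g : Fin 3 → E3 → ℂ} (h : H1Data f g) :
    Integrable fun x => ‖f x‖ ^ 2 :=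
  MemLp.integrable_pow (n := 2) (by norm_num) h.memLp

theorem H1Data.integrable_fourth {f : E3 → ℂ} {g : Fin 3 → E3 → ℂ} (h : H1Data f g) :
    Integrable fun x => ‖f x‖ ^ 4 := by
  refine (h.integrable_sq.add h.integrable_sixth).mono' (h.memLp.1.norm.pow 4)
    (ae_of_all _ fun x => ?_)
  rw [Real.norm_of_nonneg (by positivity), Pi.add_apply]
  nlinarith [sq_nonneg (‖f x‖ * (‖f x‖ ^ 2 - 1)), sq_nonneg (‖f x‖), sq_nonneg (‖f x‖ ^ 3)]

theorem H1Data.memLp_density {f : E3 → ℂ} {g : Fin 3 → E3 → ℂ} (h : H1Data f g) :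
    MemLp (density f) 2 volume := by
  refine memLp_of_integrable_pow (n := 2) two_ne_zero (h.memLp.1.norm.pow 2) ?_
  refine h.integrable_fourth.congr (ae_of_all _ fun x => ?_)
  simp only [density, norm_pow, norm_norm]
  ring

/-- The density `|f|²` as an element of `L²`. -/
def H1Data.rho {f : E3 → ℂ} {g : Fin 3 → E3 → ℂ} (h : H1Data f g) :
    Lp ℝ 2 (volume : Measure E3) := h.memLp_density.toLp (density f)

theorem H1Data.rho_coe {f : E3 → ℂ} {g : Fin 3 → E3 → ℂ} (h : H1Data f g) :
    h.rho =ᵐ[volume] density f := h.memLp_density.coeFn_toLp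

/-- The operator `-λ₁ - λ₂ K∗`. -/
def potOp (l₁ l₂ : ℝ) : Lp ℝ 2 (volume : Measure E3) →L[ℝ] Lp ℝ 2 (volume : Measure E3) :=
  -(l₁ • ContinuousLinearMap.id ℝ _) - l₂ • dipoleOp

theorem potOp_apply (l₁ l₂ : ℝ) (v : Lp ℝ 2 (volume : Measure E3)) :
    potOp l₁ l₂ v = -(l₁ • v) - l₂ • dipoleOp v := rfl

theorem potOp_symm (l₁ l₂ : ℝ) (u v : Lp ℝ 2 (volume : Measure E3)) :
    inner ℝ (potOp l₁ l₂ u) v = inner ℝ u (potOp l₁ l₂ v) := by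
  simp only [potOp_apply, inner_sub_left, inner_sub_right, inner_neg_left, inner_neg_right,
    inner_smul_left, inner_smul_right, dipoleOp_symm]
  rfl

theorem H1Data.norm_rho_sq {f : E3 → ℂ} {g : Fin 3 → E3 → ℂ} (h : H1Data f g) :
    ‖h.rho‖ ^ 2 = ∫ x, ‖f x‖ ^ 4 := by
  rw [← real_inner_self_eq_norm_sq, L2.inner_def]
  refine integral_congr_ae ?_
  filter_upwards [h.rho_coe] with x hx
  rw [hx, density, real_inner_self_eq_norm_sq, norm_pow, norm_norm]
  ring

/-- This form reduces the splitting of N along weak limits and its differentiation to facts about a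
bounded symmetric quadratic form evaluated at the density. -/
theorem H1Data.N_eq {f : E3 → ℂ} {g : Fin 3 → E3 → ℂ} (h : H1Data f g) (l₁ l₂ : ℝ) :
    N l₁ l₂ f = inner ℝ (potOp l₁ l₂ h.rho) h.rho := by
  rw [potOp_apply, inner_sub_left, inner_neg_left, inner_smul_left, inner_smul_left,
    real_inner_self_eq_norm_sq, h.norm_rho_sq, N, MemLp.normL_four_pow h.memLp]
  have : ∫ x, dipoleConv (density f) x * density f x = inner ℝ (dipoleOp h.rho) h.rho := by
    rw [L2.inner_def]
    refine integral_congr_ae ?_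
    filter_upwards [h.rho_coe, dipoleConv_ae_eq h.memLp_density] with x hx hx2
    rw [hx, hx2]
    simp [H1Data.rho, mul_comm]
  rw [this]
  simp

/-- `a^{1/2} b^{3/(2(1+α))} c^{α/(2(1+α))}`. -/
def gnFun (α a b c : ℝ) : ℝ :=
  a ^ (1 / 2 : ℝ) * b ^ (3 / (2 * (1 + α))) * c ^ (α / (2 * (1 + α)))

theorem H1Data.gnProduct_eq {f : E3 → ℂ} {g : Fin 3 → E3 → ℂ} (h : H1Data f g) {α : ℝ}
    (hα : 0 < α) : gnProduct α f = gnFun α (mass f) (gradSq g) (sixth f) := by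
  have h2 : 0 ≤ normL 2 f := lpNorm_nonneg
  have h6 : 0 ≤ normL 6 f := lpNorm_nonneg
  have hG : 0 ≤ normGrad f := lpNorm_nonneg
  have hα' : 1 + α ≠ 0 := by positivity
  rw [gnProduct, gnFun, ← MemLp.normL_two_sq h.memLp, ← MemLp.normL_six_pow h.memLp, ← h.normGrad_sq]
  rw [← Real.rpow_natCast_mul h2, ← Real.rpow_natCast_mul hG, ← Real.rpow_natCast_mul h6]
  congr 2
  · norm_num
  · congr 1; push_cast; field_simp
  · push_cast; field_simp; ring

end Functionals

/-! ### Scaling and translation -/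

section Affine

variable {F : Type*} [NormedAddCommGroup F]

theorem eLpNorm_comp_affine_le {κ : ℝ} (hκ : 0 < κ) (v : E3) :
    ∃ c : ℝ≥0∞, c ≠ ⊤ ∧ ∀ f : E3 → F, AEStronglyMeasurable f volume →
      eLpNorm (fun x => f (κ • x + v)) 2 volume = c * eLpNorm f 2 volume := by
  refine ⟨ENNReal.ofReal |(κ ^ Module.finrank ℝ E3)⁻¹| ^ (1 / (2 : ℝ≥0∞)).toReal, ?_, fun f hf => ?_⟩
  rotate_left
  · have e1 := eLpNorm_comp_measurePreserving (p := 2) (f := fun x : E3 => x + v) hf (measurePreserving_add_right volume v)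
    have hmap := Measure.map_addHaar_smul (volume : Measure E3) hκ.ne'
    have hg : AEStronglyMeasurable (fun x => f (x + v)) volume :=
      hf.comp_measurePreserving (f := fun x : E3 => x + v) (measurePreserving_add_right volume v)
    have h1 := eLpNorm_map_measure (μ := (volume : Measure E3)) (p := 2) (f := fun x : E3 => κ • x)
      (g := fun x => f (x + v)) (by rw [hmap]; exact hg.smul_measure _) (by fun_prop)
    rw [hmap, eLpNorm_smul_measure_of_ne_top (by norm_num)] at h1
    exact h1.symm.trans (by rw [smul_eq_mul]; exact congrArg _ e1)
  · exact ENNReal.rpow_ne_top_of_nonneg (by positivity) (by simp)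

theorem memLp_comp_affine {f : E3 → F} (hf : MemLp f 2 volume) {κ : ℝ} (hκ : 0 < κ) (v : E3) :
    MemLp (fun x => f (κ • x + v)) 2 volume := by
  obtain ⟨c, hc, h⟩ := eLpNorm_comp_affine_le (F := F) hκ v
  refine ⟨?_, ?_⟩
  · have hg : AEStronglyMeasurable (fun x => f (x + v)) volume :=
      hf.1.comp_measurePreserving (f := fun x : E3 => x + v) (measurePreserving_add_right volume v)
    refine hg.comp_quasiMeasurePreserving (f := fun x : E3 => κ • x) ⟨by fun_prop, ?_⟩
    rw [Measure.map_addHaar_smul (volume : Measure E3) hκ.ne']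
    exact Measure.smul_absolutelyContinuous
  · rw [h f hf.1]
    exact ENNReal.mul_lt_top hc.lt_top hf.2

/-- The rescaled and translated function `μ f(κ x + v)`. -/
def affineTrans {F : Type*} [SMul ℝ F] (μ κ : ℝ) (v : E3) (f : E3 → F) (x : E3) : F :=
  μ • f (κ • x + v)

theorem H1Data.affine {f : E3 → ℂ} {g : Fin 3 → E3 → ℂ} (h : H1Data f g) (μ : ℝ) {κ : ℝ}
    (hκ : 0 < κ) (v : E3) :
    H1Data (affineTrans μ κ v f) (fun i => affineTrans (μ * κ) κ v (g i)) := by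
  refine ⟨(memLp_comp_affine h.memLp hκ v).const_smul μ,
    fun i => (memLp_comp_affine (h.memLp_grad i) hκ v).const_smul (μ * κ), fun i => ?_⟩
  have := ((h.weak i).comp_affine hκ v).const_smul μ
  have e : affineTrans (μ * κ) κ v (g i) = fun x => μ • κ • g i (κ • x + v) :=
    funext fun x => mul_smul _ _ _
  rw [e]
  exact this

theorem integral_norm_pow_affine (f : E3 → ℂ) (μ : ℝ) {κ : ℝ} (hκ : 0 < κ) (v : E3) (n : ℕ) :
    ∫ x, ‖affineTrans μ κ v f x‖ ^ n = |μ| ^ n * (κ ^ 3)⁻¹ * ∫ x, ‖f x‖ ^ n := by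
  simp only [affineTrans, norm_smul, mul_pow, integral_const_mul, Real.norm_eq_abs]
  rw [integral_comp_affine (fun x => ‖f x‖ ^ n) hκ v, smul_eq_mul, mul_assoc]

theorem mass_affine (f : E3 → ℂ) (μ : ℝ) {κ : ℝ} (hκ : 0 < κ) (v : E3) :
    mass (affineTrans μ κ v f) = μ ^ 2 * (κ ^ 3)⁻¹ * mass f := by
  rw [mass, integral_norm_pow_affine f μ hκ v, sq_abs]; rfl

theorem sixth_affine (f : E3 → ℂ) (μ : ℝ) {κ : ℝ} (hκ : 0 < κ) (v : E3) :
    sixth (affineTrans μ κ v f) = μ ^ 6 * (κ ^ 3)⁻¹ * sixth f := by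
  rw [sixth, integral_norm_pow_affine f μ hκ v, Even.pow_abs (by decide)]; rfl

theorem gradSq_affine (g : Fin 3 → E3 → ℂ) (μ : ℝ) {κ : ℝ} (hκ : 0 < κ) (v : E3) :
    gradSq (fun i => affineTrans (μ * κ) κ v (g i)) = μ ^ 2 * κ⁻¹ * gradSq g := by
  simp only [gradSq, integral_norm_pow_affine _ _ hκ v, sq_abs, ← Finset.mul_sum]
  field_simp

theorem dipoleKernel_smul {κ : ℝ} (hκ : 0 < κ) (z : E3) :
    dipoleKernel (κ • z) = (κ ^ 3)⁻¹ * dipoleKernel z := by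
  rcases eq_or_ne z 0 with rfl | hz
  · simp [dipoleKernel]
  have h0 : 0 < ‖z‖ := norm_pos_iff.mpr hz
  simp only [dipoleKernel, norm_smul, Real.norm_of_nonneg hκ.le, PiLp.smul_apply, smul_eq_mul]
  field_simp

theorem truncK_smul {κ : ℝ} (hκ : 0 < κ) (ε : ℝ) (z : E3) :
    truncK (κ * ε) (κ • z) = (κ ^ 3)⁻¹ * truncK ε z := by
  have hiff : κ * ε < ‖κ • z‖ ↔ ε < ‖z‖ := by
    rw [norm_smul, Real.norm_of_nonneg hκ.le, mul_lt_mul_iff_right₀ hκ]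
  have e : ∀ δ w, truncK δ w = if δ < ‖w‖ then dipoleKernel w else 0 := fun _ _ => rfl
  simp only [e, hiff, dipoleKernel_smul hκ, mul_ite, mul_zero]

theorem truncConv_affine {κ : ℝ} (hκ : 0 < κ) (ε : ℝ) (v : E3) (ρ : E3 → ℝ) (x : E3) :
    truncConv ε (fun y => ρ (κ • y + v)) x = truncConv (κ * ε) ρ (κ • x + v) := by
  rw [truncConv_eq, truncConv_eq, avg, avg]
  have h1 := integral_comp_affine (fun y => truncK (κ * ε) (κ • x + v - y) • ρ y) hκ v
  have h2 : ∀ y : E3, κ • x + v - (κ • y + v) = κ • (x - y) := fun y => by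
    rw [smul_sub]; abel
  simp only [h2, truncK_smul hκ, smul_eq_mul, mul_assoc, integral_const_mul] at h1
  simp only [smul_eq_mul]
  exact mul_left_cancel₀ (by positivity) h1

/-- The kernel is homogeneous of degree -3, which cancels the Jacobian of the dilation. Only the
truncation radius changes, from ε to κε, and this does not affect the limit. -/
theorem IsDipoleConv.affine {ρ g : E3 → ℝ} (hρ : MemLp ρ 2 volume) (h : IsDipoleConv ρ g) (μ : ℝ)
    {κ : ℝ} (hκ : 0 < κ) (v : E3) :
    IsDipoleConv (affineTrans μ κ v ρ) (affineTrans μ κ v g) := by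
  refine ⟨(memLp_comp_affine h.1 hκ v).const_smul μ, ?_⟩
  obtain ⟨c, hc, hcs⟩ := eLpNorm_comp_affine_le (F := ℝ) hκ v
  have hm : ∀ ε > 0, AEStronglyMeasurable (truncConv ε ρ) volume := fun ε hε =>
    aestronglyMeasurable_truncConv hρ hε
  have e : ∀ ε ∈ Set.Ioi (0 : ℝ),
      eLpNorm (fun x => truncConv ε (affineTrans μ κ v ρ) x - affineTrans μ κ v g x) 2 volume
        = ‖μ‖ₑ * (c * eLpNorm (fun x => truncConv (κ * ε) ρ x - g x) 2 volume) := by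
    intro ε hε
    rw [← hcs (fun x => truncConv (κ * ε) ρ x - g x) ((hm _ (mul_pos hκ hε)).sub h.1.1), ← eLpNorm_const_smul]
    congr 1
    funext x
    have h1 : truncConv ε (affineTrans μ κ v ρ) x
        = μ * truncConv ε (fun y => ρ (κ • y + v)) x := by
      rw [truncConv_eq, truncConv_eq, avg, avg, ← integral_const_mul]
      congr 1; funext y
      simp only [affineTrans, smul_eq_mul]; ring
    rw [h1, truncConv_affine hκ]
    simp only [affineTrans, Pi.smul_apply, smul_eq_mul]; ring
  refine Tendsto.congr' (eventually_nhdsWithin_of_forall fun ε hε => (e ε hε).symm) ?_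
  have ht : Tendsto (fun ε : ℝ => κ * ε) (𝓝[>] 0) (𝓝[>] 0) := by
    refine tendsto_nhdsWithin_iff.mpr ⟨?_, eventually_nhdsWithin_of_forall fun ε hε => mul_pos hκ hε⟩
    have : Tendsto (fun ε : ℝ => κ * ε) (𝓝 0) (𝓝 (κ * 0)) := tendsto_id.const_mul κ
    rw [mul_zero] at this
    exact tendsto_nhdsWithin_of_tendsto_nhds this
  have := ENNReal.Tendsto.const_mul (a := ‖μ‖ₑ) (ENNReal.Tendsto.const_mul (a := c) (h.2.comp ht)
    (Or.inr hc)) (Or.inr (by simp))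
  simpa using! this

theorem N_affine {f : E3 → ℂ} {g : Fin 3 → E3 → ℂ} (h : H1Data f g) (l₁ l₂ μ : ℝ) {κ : ℝ}
    (hκ : 0 < κ) (v : E3) :
    N l₁ l₂ (affineTrans μ κ v f) = μ ^ 4 * (κ ^ 3)⁻¹ * N l₁ l₂ f := by
  have h' := h.affine μ hκ v
  have hd : density (affineTrans μ κ v f) = affineTrans (μ ^ 2) κ v (density f) := by
    funext x
    simp [density, affineTrans, mul_pow]
  have hconv : dipoleConv (density (affineTrans μ κ v f))
      =ᵐ[volume] affineTrans (μ ^ 2) κ v (dipoleConv (density f)) := by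
    have hex : ∃ g, IsDipoleConv (density f) g := ⟨_, isDipoleConv_dipoleOp h.memLp_density⟩
    have h1 : IsDipoleConv (density f) (dipoleConv (density f)) := by
      rw [dipoleConv, dif_pos hex]; exact hex.choose_spec
    have h2 := h1.affine h.memLp_density (μ ^ 2) hκ v
    rw [← hd] at h2
    exact (dipoleConv_ae_eq h'.memLp_density).trans (IsDipoleConv.unique
      (isDipoleConv_dipoleOp h'.memLp_density) h2
      fun ε hε => aestronglyMeasurable_truncConv h'.memLp_density hε)
  rw [N, N, MemLp.normL_four_pow h.memLp, MemLp.normL_four_pow h'.memLp,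
    integral_norm_pow_affine f μ hκ v]
  have h3 : ∫ x, dipoleConv (density (affineTrans μ κ v f)) x * density (affineTrans μ κ v f) x
      = μ ^ 4 * (κ ^ 3)⁻¹ * ∫ x, dipoleConv (density f) x * density f x := by
    rw [mul_assoc, ← smul_eq_mul (κ ^ 3)⁻¹,
      ← integral_comp_affine (fun x => dipoleConv (density f) x * density f x) hκ v,
      ← integral_const_mul]
    refine integral_congr_ae ?_
    filter_upwards [hconv] with x hx
    rw [hx, hd]
    simp only [affineTrans, smul_eq_mul]; ring
  rw [h3, Even.pow_abs (by decide)]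
  ring

end Affine

/-! ### Anisotropic stretching: cigars and pancakes -/

section Stretching

/-- The linear map `(x₁, x₂, x₃) ↦ (x₁, x₂, s x₃)`. -/
def stretchL (s : ℝ) : E3 →L[ℝ] E3 :=
  ContinuousLinearMap.id ℝ E3 + (s - 1) • (EuclideanSpace.proj 2 : E3 →L[ℝ] ℝ).smulRight (ee 2)

theorem stretchL_apply (s : ℝ) (x : E3) : stretchL s x = x + ((s - 1) * x 2) • ee 2 := by
  simp [stretchL, mul_smul]

theorem stretchL_comp {s t : ℝ} (h : s * t = 1) (x : E3) : stretchL s (stretchL t x) = x := by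
  ext i
  simp only [stretchL_apply]
  fin_cases i <;> simp
  linear_combination (x 2) * h

/-- The stretching map as an equivalence. -/
def stretch (s : ℝ) (hs : s ≠ 0) : E3 ≃L[ℝ] E3 :=
  ContinuousLinearEquiv.equivOfInverse (stretchL s) (stretchL s⁻¹)
    (stretchL_comp (inv_mul_cancel₀ hs)) (stretchL_comp (mul_inv_cancel₀ hs))

/-- The stretching factor in the `i`-th direction. -/
def stretchFactor (s : ℝ) (i : Fin 3) : ℝ := if i = 2 then s else 1

theorem stretch_ee (s : ℝ) (hs : s ≠ 0) (i : Fin 3) :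
    stretch s hs (ee i) = stretchFactor s i • ee i := by
  change stretchL s (ee i) = _
  rw [stretchL_apply]
  ext j
  fin_cases i <;> fin_cases j <;> simp [stretchFactor]

theorem isTest_stretch {φ : E3 → ℝ} (h : IsTest φ) (s : ℝ) (hs : s ≠ 0) :
    IsTest (fun x => φ (stretch s hs x)) :=
  ⟨h.1.comp (stretch s hs).contDiff, h.2.comp_homeomorph (stretch s hs).toHomeomorph⟩

theorem partialD_stretch {φ : E3 → ℝ} (h : Differentiable ℝ φ) (s : ℝ) (hs : s ≠ 0) (i : Fin 3)
    (x : E3) : partialD i (fun x => φ (stretch s hs x)) x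
      = stretchFactor s i * partialD i φ (stretch s hs x) := by
  have h1 : HasFDerivAt (fun y => φ (stretch s hs y))
      ((fderiv ℝ φ (stretch s hs x)).comp (stretch s hs : E3 →L[ℝ] E3)) x :=
    (h (stretch s hs x)).hasFDerivAt.comp x (stretch s hs).hasFDerivAt
  rw [partialD, h1.fderiv]
  change fderiv ℝ φ (stretch s hs x) (stretch s hs (ee i)) = _
  rw [stretch_ee]; simp [partialD]

theorem integral_stretch (F : E3 → ℝ) (s : ℝ) (hs : s ≠ 0) :
    ∫ x, F (stretch s hs x) = |(LinearMap.det ((stretch s hs : E3 →L[ℝ] E3) : E3 →ₗ[ℝ] E3))⁻¹|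
      * ∫ x, F x := by
  have hdet : LinearMap.det ((stretch s hs : E3 →L[ℝ] E3) : E3 →ₗ[ℝ] E3) ≠ 0 :=
    (LinearEquiv.isUnit_det' (stretch s hs).toLinearEquiv).ne_zero
  have hmap := Measure.map_linearMap_addHaar_eq_smul_addHaar (volume : Measure E3) hdet
  have h1 := (stretch s hs).toHomeomorph.toMeasurableEquiv.measurableEmbedding.integral_map
    (μ := (volume : Measure E3)) F
  have h2 : Measure.map (⇑(stretch s hs).toHomeomorph.toMeasurableEquiv) (volume : Measure E3)
      = ENNReal.ofReal |(LinearMap.det ((stretch s hs : E3 →L[ℝ] E3) : E3 →ₗ[ℝ] E3))⁻¹| • volume :=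
    hmap
  rw [h2, integral_smul_measure, ENNReal.toReal_ofReal (abs_nonneg _)] at h1
  exact h1.symm

/-- Composition with the stretching map on test functions. -/
def stretchT (s : ℝ) (hs : s ≠ 0) : TestSpace →ₗ[ℝ] TestSpace where
  toFun φ := ⟨fun x => φ.1 (stretch s hs x), isTest_stretch φ.2 s hs⟩
  map_add' _ _ := rfl
  map_smul' _ _ := rfl

theorem secondD_stretchT (s : ℝ) (hs : s ≠ 0) (i : Fin 3) (φ : TestSpace) :
    secondD i (stretchT s hs φ) = (stretchFactor s i ^ 2) • stretchT s hs (secondD i φ) := by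
  have hφ : IsTest φ.1 := φ.2
  apply Subtype.ext
  funext x
  change partialD i (partialD i fun x => φ.1 (stretch s hs x)) x
    = stretchFactor s i ^ 2 * partialD i (partialD i φ.1) (stretch s hs x)
  have e1 : partialD i (fun x => φ.1 (stretch s hs x))
      = fun x => stretchFactor s i * partialD i φ.1 (stretch s hs x) :=
    funext fun x => partialD_stretch hφ.differentiable s hs i x
  rw [e1, partialD_const_mul (isTest_stretch (hφ.partialD i) s hs).differentiable,
    partialD_stretch (hφ.partialD i).differentiable]
  ring

theorem norm_testToLp_sq (φ : TestSpace) : ‖testToLp φ‖ ^ 2 = ∫ x, φ.1 x * φ.1 x := by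
  rw [← real_inner_self_eq_norm_sq, inner_testToLp]
  refine integral_congr_ae ?_
  filter_upwards [testToLp_coe φ] with x hx
  rw [hx]

/-- The constant is the square root of the inverse Jacobian. It does not depend on φ, so it cancels
from every comparison of norms of stretched functions. -/
theorem norm_stretchT (s : ℝ) (hs : s ≠ 0) : ∃ c : ℝ, 0 < c ∧ ∀ φ : TestSpace,
    ‖testToLp (stretchT s hs φ)‖ = c * ‖testToLp φ‖ := by
  have hdet : LinearMap.det ((stretch s hs : E3 →L[ℝ] E3) : E3 →ₗ[ℝ] E3) ≠ 0 :=
    (LinearEquiv.isUnit_det' (stretch s hs).toLinearEquiv).ne_zero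
  have hpos := abs_pos.mpr (inv_ne_zero hdet)
  refine ⟨√|(LinearMap.det ((stretch s hs : E3 →L[ℝ] E3) : E3 →ₗ[ℝ] E3))⁻¹|,
    Real.sqrt_pos.mpr hpos, fun φ => ?_⟩
  rw [← sq_eq_sq₀ (norm_nonneg _) (by positivity), mul_pow, Real.sq_sqrt hpos.le, norm_testToLp_sq,
    norm_testToLp_sq, ← integral_stretch _ s hs]
  rfl

theorem partialLaplacian_univ (φ : TestSpace) : partialLaplacian Finset.univ φ
    = partialLaplacian {0, 1} φ + testToLp (secondD 2 φ) := by
  simp [partialLaplacian, Fin.sum_univ_three]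

theorem partialLaplacian_two (φ : TestSpace) :
    partialLaplacian {2} φ = testToLp (secondD 2 φ) := by
  simp [partialLaplacian]

/-- `G` represents `∑_{i ∈ S} ∂ᵢ²φ` as a test function. -/
theorem partialLaplacian_eq (S : Finset (Fin 3)) (φ : TestSpace) :
    partialLaplacian S φ = testToLp (∑ i ∈ S, secondD i φ) := by
  simp [partialLaplacian]

/-- For small s the profile is elongated along x₃. With ρ close to (∂₁² + ∂₂²)φ, stretching commutes
with ∂₁² + ∂₂² and multiplies ∂₃² by s², so the stretched ρ is nearly a full Laplacian whose ∂₃²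
part is negligible. -/
theorem exists_stretch_cigar (ρ : TestSpace) {δ : ℝ} (hδ : 0 < δ) :
    ∃ s : ℝ, ∃ hs : s ≠ 0, ∃ c : ℝ, 0 < c ∧ ‖testToLp (stretchT s hs ρ)‖ = c * ‖testToLp ρ‖ ∧
      ‖rieszOp (testToLp (stretchT s hs ρ))‖ ≤ c * δ := by
  obtain ⟨φ, hφ⟩ := (denseRange_partialLaplacian (S := {0, 1}) (by simp)).exists_dist_lt
    (testToLp ρ) (half_pos hδ)
  set M := ‖testToLp (secondD 2 φ)‖ with hM
  have hM0 : 0 ≤ M := norm_nonneg _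
  obtain ⟨s, hs0, hs1⟩ : ∃ s : ℝ, 0 < s ∧ s ^ 2 * (2 * M) ≤ δ / 2 := by
    have ht : Tendsto (fun s : ℝ => s ^ 2 * (2 * M)) (𝓝[>] 0) (𝓝 (0 ^ 2 * (2 * M))) :=
      tendsto_nhdsWithin_of_tendsto_nhds (Continuous.tendsto (by fun_prop) 0)
    have h2 := ht.eventually_le_const (u := δ / 2) (by simpa using hδ)
    obtain ⟨s, h3, h4⟩ := (h2.and self_mem_nhdsWithin).exists
    exact ⟨s, h4, h3⟩
  obtain ⟨c, hc, hcn⟩ := norm_stretchT s hs0.ne'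
  refine ⟨s, hs0.ne', c, hc, hcn ρ, ?_⟩
  set D := stretchT s hs0.ne' with hD
  set G : TestSpace := ∑ i ∈ {0, 1}, secondD i φ with hG
  have e1 : testToLp (D G) = partialLaplacian {0, 1} (D φ) := by
    rw [partialLaplacian_eq, hG, map_sum]
    congr 1
    refine Finset.sum_congr rfl fun i hi => ?_
    have : stretchFactor s i = 1 := by
      simp only [Finset.mem_insert, Finset.mem_singleton] at hi
      rcases hi with rfl | rfl <;> simp [stretchFactor]
    rw [hD, secondD_stretchT, this]; simp
  have e2 : testToLp (secondD 2 (D φ)) = s ^ 2 • testToLp (D (secondD 2 φ)) := by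
    rw [hD, secondD_stretchT, map_smul]; simp [stretchFactor]
  -- Writing R for `rieszOp`: R(∂₁² + ∂₂²)Dφ = RΔDφ - R∂₃²Dφ and RΔ = ∂₃²; both remaining terms
  -- carry the factor s².
  have e3 : rieszOp (testToLp (D G)) = testToLp (secondD 2 (D φ))
      - rieszOp (testToLp (secondD 2 (D φ))) := by
    have h1 := rieszOp_laplacian (D φ)
    rw [partialLaplacian_univ, map_add] at h1
    rw [e1]; exact eq_sub_of_add_eq h1
  have n2 : ‖testToLp (secondD 2 (D φ))‖ = s ^ 2 * (c * M) := by
    rw [e2, norm_smul, hcn, Real.norm_of_nonneg (sq_nonneg s)]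
  have n1 : ‖rieszOp (testToLp (D G))‖ ≤ c * (δ / 2) := by
    rw [e3]
    refine (norm_sub_le _ _).trans ((add_le_add le_rfl (norm_rieszOp_le _)).trans ?_)
    rw [n2]
    nlinarith
  have n3 : ‖rieszOp (testToLp (D (ρ - G)))‖ ≤ c * (δ / 2) := by
    refine (norm_rieszOp_le _).trans ?_
    rw [hcn]
    refine mul_le_mul_of_nonneg_left ?_ hc.le
    rw [partialLaplacian_eq, dist_eq_norm, ← map_sub] at hφ
    exact hφ.le
  have e4 : rieszOp (testToLp (D ρ)) = rieszOp (testToLp (D (ρ - G))) + rieszOp (testToLp (D G)) := by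
    rw [← map_add, ← map_add, ← map_add, sub_add_cancel]
  rw [e4]
  exact (norm_add_le _ _).trans (by linarith)

/-- For large s the profile is flat. With ρ close to ∂₃²φ, the identity (1 - R)∂₃² = R(∂₁² + ∂₂²) on
stretched functions, R being ∂₃²Δ⁻¹, gains a factor s⁻² because only the left side is multiplied by
s². -/
theorem exists_stretch_pancake (ρ : TestSpace) {δ : ℝ} (hδ : 0 < δ) :
    ∃ s : ℝ, ∃ hs : s ≠ 0, ∃ c : ℝ, 0 < c ∧ ‖testToLp (stretchT s hs ρ)‖ = c * ‖testToLp ρ‖ ∧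
      ‖testToLp (stretchT s hs ρ) - rieszOp (testToLp (stretchT s hs ρ))‖ ≤ c * δ := by
  -- A quarter of δ, because the error is later estimated through 1 - `rieszOp` with the crude bound
  -- 2.
  obtain ⟨φ, hφ⟩ := (denseRange_partialLaplacian (S := {2}) (by simp)).exists_dist_lt
    (testToLp ρ) (by positivity : 0 < δ / 4)
  set M := ‖partialLaplacian {0, 1} φ‖ with hM
  have hM0 : 0 ≤ M := norm_nonneg _
  obtain ⟨s, hs0, hs1⟩ : ∃ s : ℝ, 0 < s ∧ M ≤ s ^ 2 * (δ / 2) := by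
    have ht : Tendsto (fun s : ℝ => s ^ 2 * (δ / 2)) atTop atTop :=
      (tendsto_pow_atTop (α := ℝ) two_ne_zero).atTop_mul_const (by positivity)
    obtain ⟨s, h3, h4⟩ := ((ht.eventually_ge_atTop M).and (eventually_gt_atTop 0)).exists
    exact ⟨s, h4, h3⟩
  obtain ⟨c, hc, hcn⟩ := norm_stretchT s hs0.ne'
  refine ⟨s, hs0.ne', c, hc, hcn ρ, ?_⟩
  set D := stretchT s hs0.ne' with hD
  set G : TestSpace := secondD 2 φ with hG
  have e1 : partialLaplacian {0, 1} (D φ) = testToLp (D (∑ i ∈ {0, 1}, secondD i φ)) := by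
    rw [partialLaplacian_eq, map_sum D]
    refine congrArg testToLp (Finset.sum_congr rfl fun i hi => ?_)
    have : stretchFactor s i = 1 := by
      simp only [Finset.mem_insert, Finset.mem_singleton] at hi
      rcases hi with rfl | rfl <;> simp [stretchFactor]
    rw [hD, secondD_stretchT, this]; simp
  have e2 : testToLp (secondD 2 (D φ)) = s ^ 2 • testToLp (D G) := by
    rw [hD, secondD_stretchT, map_smul]; simp [stretchFactor, hG]
  have e3 : testToLp (secondD 2 (D φ)) - rieszOp (testToLp (secondD 2 (D φ)))
      = rieszOp (partialLaplacian {0, 1} (D φ)) := by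
    have h1 := rieszOp_laplacian (D φ)
    rw [partialLaplacian_univ, map_add] at h1
    exact sub_eq_of_eq_add h1.symm
  have n1 : ‖testToLp (D G) - rieszOp (testToLp (D G))‖ ≤ c * (δ / 2) := by
    have h1 : ‖s ^ 2 • (testToLp (D G) - rieszOp (testToLp (D G)))‖ ≤ c * M := by
      rw [smul_sub, ← map_smul rieszOp, ← e2, e3]
      refine (norm_rieszOp_le _).trans ?_
      rw [e1, hcn, ← partialLaplacian_eq]
    rw [norm_smul, Real.norm_of_nonneg (sq_nonneg s)] at h1
    have h2 : c * M ≤ s ^ 2 * (c * (δ / 2)) := by nlinarith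
    exact le_of_mul_le_mul_left (h1.trans h2) (by positivity)
  have n3 : ‖testToLp (D (ρ - G))‖ ≤ c * (δ / 4) := by
    rw [hcn]
    refine mul_le_mul_of_nonneg_left ?_ hc.le
    rw [partialLaplacian_two, dist_eq_norm, ← map_sub] at hφ
    exact hφ.le
  have n4 : ‖testToLp (D (ρ - G)) - rieszOp (testToLp (D (ρ - G)))‖ ≤ c * (δ / 2) := by
    refine (norm_sub_le _ _).trans ((add_le_add le_rfl (norm_rieszOp_le _)).trans ?_)
    linarith
  have e4 : testToLp (D ρ) = testToLp (D (ρ - G)) + testToLp (D G) := by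
    rw [← map_add, ← map_add, sub_add_cancel]
  have e5 : testToLp (D ρ) - rieszOp (testToLp (D ρ))
      = (testToLp (D (ρ - G)) - rieszOp (testToLp (D (ρ - G))))
        + (testToLp (D G) - rieszOp (testToLp (D G))) := by
    rw [e4, map_add]; abel
  rw [e5]
  exact (norm_add_le _ _).trans (by linarith)

end Stretching

/-! ### The admissible class is nonempty -/

section Admissible

theorem IsTest.h1Data {φ : E3 → ℝ} (h : IsTest φ) :
    H1Data (fun x => (φ x : ℂ)) (fun i x => (DipolarNLS.partialD i φ x : ℂ)) := by
  refine ⟨(h.memLp 2).ofReal, fun i => ((h.partialD i).memLp 2).ofReal, fun i ψ hψ => ?_⟩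
  have h1 := integral_mul_partialD h.1 hψ i
  simp only [Complex.real_smul, ← Complex.ofReal_mul, integral_complex_ofReal]
  rw [← Complex.ofReal_neg]
  congr 1
  simpa only [mul_comm] using h1

theorem inner_potOp (l₁ l₂ : ℝ) (v : Lp ℝ 2 (volume : Measure E3)) :
    inner ℝ (potOp l₁ l₂ v) v = (-l₁ + 4 * Real.pi / 3 * l₂) * ‖v‖ ^ 2
      - 4 * Real.pi * l₂ * inner ℝ (rieszOp v) v := by
  have h : potOp l₁ l₂ v = (-l₁ + 4 * Real.pi / 3 * l₂) • v - (4 * Real.pi * l₂) • rieszOp v := by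
    rw [potOp_apply]
    have : dipoleOp v = (4 * Real.pi / 3) • ((3 : ℝ) • rieszOp v - v) := rfl
    rw [this]
    module
  rw [h, inner_sub_left, inner_smul_left, inner_smul_left, real_inner_self_eq_norm_sq]
  rfl

/-- On cigars K∗ is close to -4π/3 and on pancakes to 8π/3. The quadratic form per unit ‖ρ‖² is thus
close to -λ₁ + (4π/3)λ₂ or to -λ₁ - (8π/3)λ₂, and the sign of λ₂ decides which shape to use. -/
theorem exists_admissible {l₁ l₂ : ℝ} (hl : Unstable l₁ l₂) : (admissible l₁ l₂).Nonempty := by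
  obtain ⟨χ, hχ, h0, h1, h2, -⟩ := exists_cutoff
  -- The stretched objects are densities, so ρ is taken as a square and the function in H¹ is the
  -- stretched χ.
  have hρt : IsTest (fun x => χ x * χ x) := hχ.mul hχ.1
  set ρ : TestSpace := ⟨fun x => χ x * χ x, hρt⟩ with hρ
  have hρ0 : 0 < ‖testToLp ρ‖ := by
    rw [norm_pos_iff]
    intro hz
    have h3 := norm_testToLp_sq ρ
    rw [hz, norm_zero, zero_pow two_ne_zero] at h3
    have hc : Continuous fun x => ρ.1 x * ρ.1 x := hρt.continuous.mul hρt.continuous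
    have h4 := (hc.integral_pos_of_hasCompactSupport_nonneg_nonzero (μ := (volume : Measure E3))
      (hρt.2.mul_right) (fun x => mul_self_nonneg _) (x := 0) (by simp [hρ, h2 0]))
    rw [← h3] at h4
    exact lt_irrefl _ h4
  suffices H : ∃ s : ℝ, ∃ hs : s ≠ 0,
      0 < inner ℝ (potOp l₁ l₂ (testToLp (stretchT s hs ρ))) (testToLp (stretchT s hs ρ)) by
    obtain ⟨s, hs, hpos⟩ := H
    have ht := (isTest_stretch hχ s hs).h1Data
    refine ⟨_, ht.memH1, ?_⟩
    rw [ht.N_eq]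
    have e : ht.rho = testToLp (stretchT s hs ρ) := by
      apply Lp.ext
      filter_upwards [ht.rho_coe, testToLp_coe (stretchT s hs ρ)] with x hx1 hx2
      rw [hx1, hx2, density, Complex.norm_real, Real.norm_eq_abs, sq_abs, sq]
      rfl
    rw [e]; exact hpos
  have hpi := Real.pi_pos
  rcases le_total 0 l₂ with hl2 | hl2
  · have hd := hl.1 hl2
    set d := -l₁ + 4 * Real.pi / 3 * l₂ with hdd
    have hd0 : 0 < d := by linarith
    -- With this δ the error consumes only the fraction 4πλ₂/(4πλ₂ + 1) of the main term; the added
    -- 1 also covers λ₂ = 0.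
    obtain ⟨s, hs, c, hc, hn, hb⟩ := exists_stretch_cigar ρ
      (δ := d * ‖testToLp ρ‖ / (4 * Real.pi * l₂ + 1)) (by positivity)
    refine ⟨s, hs, ?_⟩
    rw [inner_potOp, ← hdd, hn]
    have h3 := (real_inner_le_norm (rieszOp (testToLp (stretchT s hs ρ)))
      (testToLp (stretchT s hs ρ))).trans (mul_le_mul_of_nonneg_right hb (norm_nonneg _))
    rw [hn] at h3
    set R := ‖testToLp ρ‖
    have h5 : 4 * Real.pi * l₂ * inner ℝ (rieszOp (testToLp (stretchT s hs ρ)))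
        (testToLp (stretchT s hs ρ)) ≤ 4 * Real.pi * l₂ *
          (c * (d * R / (4 * Real.pi * l₂ + 1)) * (c * R)) :=
      mul_le_mul_of_nonneg_left h3 (by positivity)
    have h6 : d * (c * R) ^ 2 - 4 * Real.pi * l₂ * (c * (d * R / (4 * Real.pi * l₂ + 1)) * (c * R))
        = d * (c * R) ^ 2 / (4 * Real.pi * l₂ + 1) := by
      field_simp; ring
    have h7 : 0 < d * (c * R) ^ 2 / (4 * Real.pi * l₂ + 1) := by positivity
    linarith
  · have hd := hl.2 hl2
    set d := -l₁ - 8 * Real.pi / 3 * l₂ with hdd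
    have hd0 : 0 < d := by linarith
    set k := -(4 * Real.pi * l₂) with hk
    have hk0 : 0 ≤ k := by
      rw [hk]; nlinarith
    obtain ⟨s, hs, c, hc, hn, hb⟩ := exists_stretch_pancake ρ
      (δ := d * ‖testToLp ρ‖ / (k + 1)) (by positivity)
    refine ⟨s, hs, ?_⟩
    rw [inner_potOp]
    set v := testToLp (stretchT s hs ρ) with hv
    have h3 := (real_inner_le_norm (v - rieszOp v) v).trans
      (mul_le_mul_of_nonneg_right hb (norm_nonneg _))
    rw [inner_sub_left, real_inner_self_eq_norm_sq, hn] at h3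
    rw [hn]
    set R := ‖testToLp ρ‖
    have h5 := mul_le_mul_of_nonneg_left h3 hk0
    have h6 : d * (c * R) ^ 2 - k * (c * (d * R / (k + 1)) * (c * R))
        = d * (c * R) ^ 2 / (k + 1) := by
      field_simp; ring
    have h7 : 0 < d * (c * R) ^ 2 / (k + 1) := by positivity
    have h8 : -l₁ + 4 * Real.pi / 3 * l₂ = d - k := by rw [hdd, hk]; ring
    have h9 : 4 * Real.pi * l₂ = -k := by rw [hk]; ring
    rw [h8, h9]
    linarith

end Admissible

/-! ### Cauchy–Schwarz and weak compactness -/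

section HilbertTools

variable {F G : Type*} [NormedAddCommGroup F] [NormedAddCommGroup G]

theorem eLpNorm_two_eq {f : E3 → F} (hf : MemLp f 2 volume) :
    eLpNorm f 2 volume = ENNReal.ofReal (√(∫ x, ‖f x‖ ^ 2)) := by
  rw [← lpNorm_pow_eq_integral hf.1 2 two_ne_zero, Real.sqrt_sq lpNorm_nonneg]
  exact (ofReal_lpNorm hf).symm

theorem integral_sq_le_of_eLpNorm_le {f : E3 → F} {g : E3 → G} (hf : MemLp f 2 volume)
    (hg : MemLp g 2 volume) (h : eLpNorm f 2 volume ≤ eLpNorm g 2 volume) :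
    ∫ x, ‖f x‖ ^ 2 ≤ ∫ x, ‖g x‖ ^ 2 := by
  rw [eLpNorm_two_eq hf, eLpNorm_two_eq hg, ENNReal.ofReal_le_ofReal_iff (Real.sqrt_nonneg _)] at h
  exact (Real.sqrt_le_sqrt_iff (integral_nonneg fun _ => by positivity)).mp h

theorem integrable_norm_mul {f : E3 → F} {g : E3 → G} (hf : MemLp f 2 volume)
    (hg : MemLp g 2 volume) : Integrable fun x => ‖f x‖ * ‖g x‖ :=
  hf.norm.integrable_mul hg.norm

/-- The Cauchy–Schwarz inequality. -/
theorem integral_norm_mul_sq_le {f : E3 → F} {g : E3 → G} (hf : MemLp f 2 volume)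
    (hg : MemLp g 2 volume) :
    (∫ x, ‖f x‖ * ‖g x‖) ^ 2 ≤ (∫ x, ‖f x‖ ^ 2) * ∫ x, ‖g x‖ ^ 2 := by
  have key : ∀ {u v : E3 → ℝ} (hu : MemLp u 2 volume) (hv : MemLp v 2 volume),
      inner ℝ (hu.toLp u) (hv.toLp v) = ∫ x, u x * v x := by
    intro u v hu hv
    rw [L2.inner_def]
    refine integral_congr_ae ?_
    filter_upwards [hu.coeFn_toLp, hv.coeFn_toLp] with x h1 h2
    rw [h1, h2]; simp [mul_comm]
  have h := real_inner_mul_inner_self_le (hf.norm.toLp _) (hg.norm.toLp _)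
  rw [key, key, key] at h
  simpa only [sq] using h

theorem integral_norm_mul_le {f : E3 → F} {g : E3 → G} (hf : MemLp f 2 volume)
    (hg : MemLp g 2 volume) :
    ∫ x, ‖f x‖ * ‖g x‖ ≤ √(∫ x, ‖f x‖ ^ 2) * √(∫ x, ‖g x‖ ^ 2) := by
  rw [← Real.sqrt_mul (integral_nonneg fun _ => by positivity)]
  exact Real.le_sqrt_of_sq_le (integral_norm_mul_sq_le hf hg)

theorem norm_toLp_sq {f : E3 → F} (hf : MemLp f 2 volume) :
    ‖hf.toLp f‖ ^ 2 = ∫ x, ‖f x‖ ^ 2 := by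
  rw [Lp.norm_toLp, toReal_eLpNorm hf.1]
  exact lpNorm_pow_eq_integral hf.1 2 two_ne_zero

/-- Bounded sequences in a separable Hilbert space have weakly convergent subsequences. -/
theorem exists_weak_subseq {H : Type*} [NormedAddCommGroup H] [InnerProductSpace ℂ H]
    [CompleteSpace H] [TopologicalSpace.SeparableSpace H] (u : ℕ → H) (M : ℝ) (hu : ∀ n, ‖u n‖ ≤ M) :
    ∃ φ : ℕ → ℕ, StrictMono φ ∧ ∃ v : H, ∀ w,
      Tendsto (fun n => inner ℂ w (u (φ n))) atTop (𝓝 (inner ℂ w v)) := by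
  have hc := WeakDual.isSeqCompact_closedBall ℂ H 0 M
  obtain ⟨a, -, φ, hφ, ha⟩ := hc (x := fun n =>
    StrongDual.toWeakDual (InnerProductSpace.toDual ℂ H (u n))) (fun n => by
      simp only [Set.mem_preimage, mem_closedBall_zero_iff]
      exact ((InnerProductSpace.toDual ℂ H).norm_map (u n)).trans_le (hu n))
  refine ⟨φ, hφ, (InnerProductSpace.toDual ℂ H).symm (WeakDual.toStrongDual a), fun w => ?_⟩
  have h1 := tendsto_iff_forall_eval_tendsto_topDualPairing.mp ha w
  have h2 := (Complex.continuous_conj.tendsto _).comp h1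
  rw [← inner_conj_symm, InnerProductSpace.toDual_symm_apply]
  refine h2.congr fun n => ?_
  rw [← inner_conj_symm w]
  rfl

end HilbertTools

/-! ### Weak convergence in H¹ -/

section WeakConvergence

/-- Weak convergence in `L²`, tested against all `L²` functions. -/
def WeakConv (F : ℕ → E3 → ℂ) (f : E3 → ℂ) : Prop :=
  ∀ w : E3 → ℂ, MemLp w 2 volume → Tendsto (fun n => ∫ x, w x * F n x) atTop (𝓝 (∫ x, w x * f x))

theorem WeakConv.comp {F : ℕ → E3 → ℂ} {f : E3 → ℂ} (h : WeakConv F f) {φ : ℕ → ℕ}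
    (hφ : StrictMono φ) : WeakConv (fun n => F (φ n)) f :=
  fun w hw => (h w hw).comp hφ.tendsto_atTop

theorem MemLp.conj {w : E3 → ℂ} {p : ℝ≥0∞} (hw : MemLp w p volume) :
    MemLp (fun x => (starRingEnd ℂ) (w x)) p volume :=
  hw.star

theorem integrable_mul_complex {f g : E3 → ℂ} (hf : MemLp f 2 volume) (hg : MemLp g 2 volume) :
    Integrable fun x => f x * g x := hf.integrable_mul hg

theorem WeakConv.sub {F : ℕ → E3 → ℂ} {f : E3 → ℂ} (h : WeakConv F f)
    (hF : ∀ n, MemLp (F n) 2 volume) (hf : MemLp f 2 volume) :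
    WeakConv (fun n x => F n x - f x) 0 := by
  intro w hw
  have h1 := (h w hw).sub_const (∫ x, w x * f x)
  simp only [sub_self] at h1
  simp only [Pi.zero_apply, mul_zero, integral_zero, mul_sub]
  refine h1.congr fun n => ?_
  rw [integral_sub (integrable_mul_complex hw (hF n)) (integrable_mul_complex hw hf)]

theorem exists_weakConv {F : ℕ → E3 → ℂ} (hF : ∀ n, MemLp (F n) 2 volume) {A : ℝ}
    (hA : ∀ n, mass (F n) ≤ A) :
    ∃ φ : ℕ → ℕ, StrictMono φ ∧ ∃ f, MemLp f 2 volume ∧ WeakConv (fun n => F (φ n)) f := by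
  have : Fact ((2 : ℝ≥0∞) ≠ ⊤) := ⟨by simp⟩
  obtain ⟨φ, hφ, v, hv⟩ := exists_weak_subseq (fun n => (hF n).toLp (F n)) (√A) fun n => by
    refine Real.le_sqrt_of_sq_le ?_
    rw [norm_toLp_sq]; exact hA n
  refine ⟨φ, hφ, v, Lp.memLp v, fun w hw => ?_⟩
  have h1 := hv ((MemLp.conj hw).toLp _)
  simp only [L2.inner_def] at h1
  have e : ∀ (u : Lp ℂ 2 (volume : Measure E3)) (u' : E3 → ℂ), u =ᵐ[volume] u' →
      ∫ x, inner ℂ ((MemLp.conj hw).toLp _ x) (u x) = ∫ x, w x * u' x := by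
    intro u u' hu
    refine integral_congr_ae ?_
    filter_upwards [(MemLp.conj hw).coeFn_toLp, hu] with x h1 h2
    rw [h1, h2, RCLike.inner_apply, starRingEnd_self_apply, mul_comm]
  rw [e v v ae_eq_rfl] at h1
  exact h1.congr fun n => e _ _ (hF _).coeFn_toLp

theorem weakPD_of_weakConv {F G : ℕ → E3 → ℂ} {f g : E3 → ℂ} {i : Fin 3}
    (h : ∀ n, WeakPD i (F n) (G n)) (hF : WeakConv F f) (hG : WeakConv G g) : WeakPD i f g := by
  intro φ hφ
  have h1 := hF (fun x => (partialD i φ x : ℂ)) ((hφ.partialD i).memLp 2).ofReal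
  have h2 := (hG (fun x => (φ x : ℂ)) (hφ.memLp 2).ofReal).neg
  simp only [Complex.real_smul]
  refine tendsto_nhds_unique h1 (h2.congr fun n => ?_)
  have := h n φ hφ
  simp only [Complex.real_smul] at this
  exact this.symm

theorem mass_le_gradSq (g : Fin 3 → E3 → ℂ) (i : Fin 3) :
    mass (g i) ≤ gradSq g :=
  Finset.single_le_sum (f := fun i => ∫ x, ‖g i x‖ ^ 2)
    (fun _ _ => integral_nonneg fun _ => by positivity) (Finset.mem_univ i)

/-- Bounded sequences in `H¹` have subsequences converging weakly in `H¹`. -/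
theorem exists_weakConv_h1 {F : ℕ → E3 → ℂ} {G : ℕ → Fin 3 → E3 → ℂ}
    (h : ∀ n, H1Data (F n) (G n)) {A : ℝ} (hm : ∀ n, mass (F n) ≤ A)
    (hg : ∀ n, gradSq (G n) ≤ A) :
    ∃ φ : ℕ → ℕ, StrictMono φ ∧ ∃ f g, H1Data f g ∧ WeakConv (fun n => F (φ n)) f ∧
      ∀ i, WeakConv (fun n => G (φ n) i) (g i) := by
  have hG : ∀ i n, mass (G n i) ≤ A := fun i n =>
    (mass_le_gradSq _ i).trans (hg n)
  obtain ⟨φ, hφ, f, hf, hF⟩ := exists_weakConv (fun n => (h n).memLp) hm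
  obtain ⟨φ0, hφ0, g0, hg0, hG0⟩ := exists_weakConv (fun n => (h (φ n)).memLp_grad 0)
    (fun n => hG 0 (φ n))
  obtain ⟨φ1, hφ1, g1, hg1, hG1⟩ := exists_weakConv (fun n => (h (φ (φ0 n))).memLp_grad 1)
    (fun n => hG 1 _)
  obtain ⟨φ2, hφ2, g2, hg2, hG2⟩ := exists_weakConv (fun n => (h (φ (φ0 (φ1 n)))).memLp_grad 2)
    (fun n => hG 2 _)
  have cF : WeakConv (fun n => F (φ (φ0 (φ1 (φ2 n))))) f := ((hF.comp hφ0).comp hφ1).comp hφ2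
  have c0 : WeakConv (fun n => G (φ (φ0 (φ1 (φ2 n)))) 0) g0 := (hG0.comp hφ1).comp hφ2
  have c1 : WeakConv (fun n => G (φ (φ0 (φ1 (φ2 n)))) 1) g1 := hG1.comp hφ2
  refine ⟨fun n => φ (φ0 (φ1 (φ2 n))), hφ.comp (hφ0.comp (hφ1.comp hφ2)), f, ![g0, g1, g2], ?_, cF, ?_⟩
  · refine ⟨hf, fun i => ?_, fun i => ?_⟩
    · fin_cases i
      exacts [hg0, hg1, hg2]
    · fin_cases i
      exacts [weakPD_of_weakConv (fun n => (h _).weak 0) cF c0,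
        weakPD_of_weakConv (fun n => (h _).weak 1) cF c1,
        weakPD_of_weakConv (fun n => (h _).weak 2) cF hG2]
  · intro i
    fin_cases i
    exacts [c0, c1, hG2]

end WeakConvergence

/-! ### Local compactness and dense weights -/

section LocalConvergence

theorem norm_sum_smul_sq_le (y : E3) (z : Fin 3 → ℂ) :
    ‖∑ i, y i • z i‖ ^ 2 ≤ ‖y‖ ^ 2 * ∑ i, ‖z i‖ ^ 2 := by
  have h1 : ‖∑ i, y i • z i‖ ≤ ∑ i, |y i| * ‖z i‖ :=
    (norm_sum_le _ _).trans_eq (Finset.sum_congr rfl fun i _ => by rw [norm_smul, Real.norm_eq_abs])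
  refine (pow_le_pow_left₀ (norm_nonneg _) h1 2).trans ?_
  refine (Finset.sum_mul_sq_le_sq_mul_sq _ _ _).trans_eq ?_
  rw [EuclideanSpace.norm_sq_eq]
  simp

theorem H1Data.integral_translation_le {f : E3 → ℂ} {g : Fin 3 → E3 → ℂ} (h : H1Data f g)
    (y : E3) : ∫ x, ‖f (x + y) - f x‖ ^ 2 ≤ ‖y‖ ^ 2 * gradSq g := by
  have hG : MemLp (fun x => ∑ i, y i • g i x) 2 volume :=
    memLp_finsetSum _ fun i _ => (h.memLp_grad i).const_smul (y i)
  have hT : MemLp (fun x => f (x + y)) 2 volume :=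
    h.memLp.comp_measurePreserving (measurePreserving_add_right volume y)
  refine (integral_sq_le_of_eLpNorm_le (hT.sub h.memLp) hG
    (eLpNorm_translation_le h.memLp h.memLp_grad h.weak y)).trans ?_
  have hi : ∀ i, Integrable fun x => ‖g i x‖ ^ 2 := fun i =>
    MemLp.integrable_pow (n := 2) two_ne_zero (h.memLp_grad i)
  rw [gradSq, ← integral_finsetSum _ fun i _ => hi i, ← integral_const_mul]
  exact integral_mono (MemLp.integrable_pow (n := 2) two_ne_zero hG)
    ((integrable_finsetSum _ fun i _ => hi i).const_mul _) fun x => norm_sum_smul_sq_le y _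

theorem H1Data.integral_avg_sub_le {f : E3 → ℂ} {g : Fin 3 → E3 → ℂ} (h : H1Data f g) {δ : ℝ}
    {η : E3 → ℝ} (hη : IsKernel δ η) :
    ∫ x, ‖avg η f x - f x‖ ^ 2 ≤ δ ^ 2 * gradSq g := by
  have hnn : 0 ≤ δ ^ 2 * gradSq g := mul_nonneg (sq_nonneg _) (gradSq_nonneg g)
  have h1 := hη.eLpNorm_avg_sub_le h.memLp (ENNReal.ofNNReal (Real.toNNReal (√(δ ^ 2 * gradSq g))))
    fun y hy => by
      have hT : MemLp (fun x => f (x - y)) 2 volume :=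
        h.memLp.comp_measurePreserving (measurePreserving_sub_right volume y)
      have h2 := h.integral_translation_le (-y)
      simp only [← sub_eq_add_neg, norm_neg] at h2
      rw [eLpNorm_two_eq (f := fun x => f (x - y) - f x) (hT.sub h.memLp)]
      refine ENNReal.ofReal_le_ofReal (Real.sqrt_le_sqrt (h2.trans ?_))
      exact mul_le_mul_of_nonneg_right (pow_le_pow_left₀ (norm_nonneg _) hy 2) (gradSq_nonneg g)
  rw [eLpNorm_two_eq (f := fun x => avg η f x - f x) ((hη.memLp_avg h.memLp).sub h.memLp)] at h1
  have h2 := (ENNReal.ofReal_le_ofReal_iff (Real.sqrt_nonneg _)).mp h1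
  exact (Real.sqrt_le_sqrt_iff hnn).mp h2

theorem norm_avg_sq_le {η : E3 → ℝ} (hη : MemLp η 2 volume) {f : E3 → ℂ} (hf : MemLp f 2 volume)
    (x : E3) : ‖avg η f x‖ ^ 2 ≤ (∫ y, ‖η y‖ ^ 2) * mass f := by
  have h1 := integral_norm_mul_sq_le (memLp_comp_sub_left hη x) hf
  have e : ∫ z, ‖η (x - z)‖ ^ 2 = ∫ y, ‖η y‖ ^ 2 :=
    integral_sub_left_eq_self (fun y => ‖η y‖ ^ 2) volume x
  rw [e] at h1
  refine (pow_le_pow_left₀ (norm_nonneg _) (norm_integral_le_integral_norm _) 2).trans ?_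
  simp only [norm_smul]
  exact h1

theorem WeakConv.tendsto_avg {F : ℕ → E3 → ℂ} {f : E3 → ℂ} (h : WeakConv F f) {η : E3 → ℝ}
    (hη : MemLp η 2 volume) (x : E3) :
    Tendsto (fun n => avg η (F n) x) atTop (𝓝 (avg η f x)) := by
  have := h (fun z => (η (x - z) : ℂ)) (memLp_comp_sub_left hη x).ofReal
  simpa only [avg, Complex.real_smul] using this

theorem integrable_mul_sq {w : E3 → ℝ} (hw : AEStronglyMeasurable w volume) {C : ℝ}
    (hC : ∀ x, |w x| ≤ C) {f : E3 → ℂ} (hf : MemLp f 2 volume) :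
    Integrable fun x => w x * ‖f x‖ ^ 2 :=
  (MemLp.integrable_pow (n := 2) two_ne_zero hf).bdd_mul hw (ae_of_all _ hC)

/-- Weak convergence to zero in `H¹` implies strong convergence in `L²` on bounded sets. -/
theorem tendsto_local {F : ℕ → E3 → ℂ} {G : ℕ → Fin 3 → E3 → ℂ} (h : ∀ n, H1Data (F n) (G n))
    {A : ℝ} (hm : ∀ n, mass (F n) ≤ A) (hg : ∀ n, gradSq (G n) ≤ A) (h0 : WeakConv F 0)
    {w : E3 → ℝ} (hw : Integrable w) {C : ℝ} (hC : ∀ x, |w x| ≤ C) :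
    Tendsto (fun n => ∫ x, w x * ‖F n x‖ ^ 2) atTop (𝓝 0) := by
  have hC0 : 0 ≤ C := (abs_nonneg _).trans (hC 0)
  have hA : 0 ≤ A := (mass_nonneg _).trans (hm 0)
  have step : ∀ δ > 0, ∀ᶠ n in atTop, |∫ x, w x * ‖F n x‖ ^ 2| ≤ δ + 2 * C * (δ ^ 2 * A) := by
    intro δ hδ
    obtain ⟨η, -, hη⟩ := exists_test_kernel hδ
    -- At fixed δ the mollified functions tend to 0 pointwise, by weak convergence, and are
    -- uniformly bounded. The remainder is at most δ times the gradient norm, uniformly in n.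
    have hlim : Tendsto (fun n => ∫ x, |w x| * ‖avg η (F n) x‖ ^ 2) atTop (𝓝 (∫ _ : E3, (0 : ℝ))) := by
      refine tendsto_integral_of_dominated_convergence
        (fun x => |w x| * ((∫ y, ‖η y‖ ^ 2) * A)) (fun n => ?_) (hw.abs.mul_const _) (fun n => ?_) ?_
      · exact hw.abs.1.mul ((hη.memLp_avg (h n).memLp).1.norm.pow 2)
      · refine ae_of_all _ fun x => ?_
        rw [Real.norm_of_nonneg (by positivity)]
        refine mul_le_mul_of_nonneg_left ((norm_avg_sq_le hη.memLp_two (h n).memLp x).trans ?_)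
          (abs_nonneg _)
        exact mul_le_mul_of_nonneg_left (hm n) (integral_nonneg fun _ => by positivity)
      · refine ae_of_all _ fun x => ?_
        have h1 := h0.tendsto_avg hη.memLp_two x
        have e : avg η (0 : E3 → ℂ) x = 0 := by simp [avg]
        rw [e] at h1
        have h2 := (h1.norm.pow 2).const_mul |w x|
        simpa using h2
    rw [integral_zero] at hlim
    filter_upwards [hlim.eventually_le_const (u := δ / 2) (by positivity)] with n hn
    have hav := hη.memLp_avg (h n).memLp
    have i1 := integrable_mul_sq hw.abs.1 (fun x => by rw [abs_abs]; exact hC x) hav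
    have i2 := MemLp.integrable_pow (n := 2) two_ne_zero (hav.sub (h n).memLp)
    have i3 := integrable_mul_sq hw.abs.1 (fun x => by rw [abs_abs]; exact hC x) (h n).memLp
    calc |∫ x, w x * ‖F n x‖ ^ 2| ≤ ∫ x, |w x| * ‖F n x‖ ^ 2 := by
          refine (abs_integral_le_integral_abs).trans_eq ?_
          simp only [abs_mul, abs_pow, abs_norm]
      _ ≤ ∫ x, (2 * (|w x| * ‖avg η (F n) x‖ ^ 2) + 2 * C * ‖avg η (F n) x - F n x‖ ^ 2) := by
          refine integral_mono i3 ((i1.const_mul 2).add (i2.const_mul _)) fun x => ?_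
          have t : ‖F n x‖ ≤ ‖avg η (F n) x‖ + ‖avg η (F n) x - F n x‖ := by
            rw [norm_sub_rev]; exact norm_le_norm_add_norm_sub' _ _
          have t2 : ‖F n x‖ ^ 2 ≤ 2 * ‖avg η (F n) x‖ ^ 2 + 2 * ‖avg η (F n) x - F n x‖ ^ 2 :=
            (pow_le_pow_left₀ (norm_nonneg _) t 2).trans (by
              nlinarith [sq_nonneg (‖avg η (F n) x‖ - ‖avg η (F n) x - F n x‖)])
          have t3 := mul_le_mul_of_nonneg_left t2 (abs_nonneg (w x))
          have t4 := mul_le_mul_of_nonneg_right (hC x) (sq_nonneg ‖avg η (F n) x - F n x‖)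
          change |w x| * ‖F n x‖ ^ 2 ≤ _
          linarith
      _ = 2 * (∫ x, |w x| * ‖avg η (F n) x‖ ^ 2) + 2 * C * ∫ x, ‖avg η (F n) x - F n x‖ ^ 2 := by
          rw [← integral_const_mul, ← integral_const_mul]
          exact integral_add (i1.const_mul 2) (i2.const_mul _)
      _ ≤ δ + 2 * C * (δ ^ 2 * A) := by
          have h1 := ((h n).integral_avg_sub_le hη).trans
            (mul_le_mul_of_nonneg_left (hg n) (sq_nonneg δ))
          have h2 := mul_le_mul_of_nonneg_left h1 (by positivity : 0 ≤ 2 * C)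
          linarith
  rw [Metric.tendsto_atTop']
  intro ε hε
  have ht : Tendsto (fun δ : ℝ => δ + 2 * C * (δ ^ 2 * A)) (𝓝[>] 0) (𝓝 (0 + 2 * C * (0 ^ 2 * A))) :=
    tendsto_nhdsWithin_of_tendsto_nhds (Continuous.tendsto (by fun_prop) 0)
  obtain ⟨δ, h1, h2⟩ := ((ht.eventually_lt_const (u := ε) (by simpa using hε)).and
    self_mem_nhdsWithin).exists
  obtain ⟨n0, hn0⟩ := eventually_atTop.mp (step δ h2)
  refine ⟨n0, fun n hn => ?_⟩
  rw [dist_zero_right, Real.norm_eq_abs]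
  exact (hn0 n hn.le).trans_lt h1

/-- An `L²`-bounded sequence that tends to zero weakly against bounded integrable weights does so
against all `L²` weights. -/
theorem tendsto_of_dense {u : ℕ → E3 → ℝ} (hu : ∀ n, MemLp (u n) 2 volume) {A : ℝ}
    (hA : ∀ n, ∫ x, ‖u n x‖ ^ 2 ≤ A)
    (h : ∀ w : E3 → ℝ, Continuous w → HasCompactSupport w →
      Tendsto (fun n => ∫ x, w x * u n x) atTop (𝓝 0))
    {w : E3 → ℝ} (hw : MemLp w 2 volume) :
    Tendsto (fun n => ∫ x, w x * u n x) atTop (𝓝 0) := by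
  have hA0 : 0 ≤ A := (integral_nonneg fun _ => by positivity).trans (hA 0)
  rw [Metric.tendsto_atTop']
  intro ε hε
  set r := ε / (2 * (√A + 1)) with hr
  have hr0 : 0 < r := by positivity
  obtain ⟨v, hv1, hv2, hv3, hv4⟩ := hw.exists_hasCompactSupport_eLpNorm_sub_le (by simp)
    (ε := ENNReal.ofReal r) (by simpa using hr0)
  obtain ⟨n0, hn0⟩ := (Metric.tendsto_atTop'.mp (h v hv3 hv1)) (ε / 2) (half_pos hε)
  refine ⟨n0, fun n hn => ?_⟩
  have h1 := hn0 n hn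
  rw [dist_zero_right] at h1 ⊢
  have hd : MemLp (w - v) 2 volume := hw.sub hv4
  have e : ∫ x, w x * u n x = (∫ x, (w - v) x * u n x) + ∫ x, v x * u n x := by
    have i1 : Integrable fun x => (w - v) x * u n x := hd.integrable_mul (hu n)
    have i2 : Integrable fun x => v x * u n x := hv4.integrable_mul (hu n)
    rw [← integral_add i1 i2]
    refine integral_congr_ae (ae_of_all _ fun x => ?_)
    simp only [Pi.sub_apply]; ring
  have h2 : ‖∫ x, (w - v) x * u n x‖ ≤ r * √A := by
    refine (norm_integral_le_integral_norm _).trans ?_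
    simp only [norm_mul]
    refine (integral_norm_mul_le hd (hu n)).trans ?_
    rw [eLpNorm_two_eq hd, ENNReal.ofReal_le_ofReal_iff hr0.le] at hv2
    exact mul_le_mul hv2 (Real.sqrt_le_sqrt (hA n)) (Real.sqrt_nonneg _) hr0.le
  have h3 : r * √A < ε / 2 := by
    rw [hr, div_mul_eq_mul_div, div_lt_div_iff₀ (by positivity) two_pos]
    nlinarith
  rw [e]
  exact (norm_add_le _ _).trans_lt (by linarith)

end LocalConvergence

/-! ### Algebra in H¹ and interpolation -/

section H1Algebra

variable {f f' : E3 → ℂ} {g g' : Fin 3 → E3 → ℂ}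

theorem H1Data.add (h : H1Data f g) (h' : H1Data f' g') :
    H1Data (fun x => f x + f' x) (fun i x => g i x + g' i x) :=
  ⟨h.memLp.add h'.memLp, fun i => (h.memLp_grad i).add (h'.memLp_grad i), fun i =>
    (h.weak i).add h.memLp (h.memLp_grad i) h'.memLp (h'.memLp_grad i) (h'.weak i)⟩

theorem H1Data.const_smul (c : ℂ) (h : H1Data f g) :
    H1Data (fun x => c • f x) (fun i x => c • g i x) :=
  ⟨h.memLp.const_smul c, fun i => (h.memLp_grad i).const_smul c, fun i => (h.weak i).const_smul c⟩

theorem H1Data.sub (h : H1Data f g) (h' : H1Data f' g') :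
    H1Data (fun x => f x - f' x) (fun i x => g i x - g' i x) := by
  simpa only [neg_smul, one_smul, ← sub_eq_add_neg] using h.add (h'.const_smul (-1))

theorem H1Data.memLp_cube (h : H1Data f g) : MemLp (fun x => ‖f x‖ ^ 3) 2 volume := by
  refine memLp_of_integrable_pow (n := 2) two_ne_zero (h.memLp.1.norm.pow 3) ?_
  refine h.integrable_sixth.congr (ae_of_all _ fun x => ?_)
  simp only [norm_pow, norm_norm]
  ring

theorem integral_cube_sq (f : E3 → ℂ) : ∫ x, ‖‖f x‖ ^ 3‖ ^ 2 = sixth f := by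
  refine integral_congr_ae (ae_of_all _ fun x => ?_)
  simp only [norm_pow, norm_norm]
  ring

theorem integral_density_sq (f : E3 → ℂ) : ∫ x, ‖density f x‖ ^ 2 = ∫ x, ‖f x‖ ^ 4 := by
  refine integral_congr_ae (ae_of_all _ fun x => ?_)
  simp only [density, norm_pow, norm_norm]
  ring

theorem H1Data.integral_fourth_le (h : H1Data f g) :
    ∫ x, ‖f x‖ ^ 4 ≤ √(mass f) * √(sixth f) := by
  have h1 := integral_norm_mul_le h.memLp h.memLp_cube
  rw [integral_cube_sq] at h1
  refine (integral_congr_ae (ae_of_all _ fun x => ?_)).trans_le h1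
  simp only [norm_pow, norm_norm]
  ring

theorem exists_sobolev : ∃ S : ℝ, 0 < S ∧ ∀ (f : E3 → ℂ) (g : Fin 3 → E3 → ℂ), H1Data f g →
    sixth f ≤ S * gradSq g ^ 3 := by
  obtain ⟨C, hC⟩ := exists_sobolev_const
  refine ⟨(3 * C + 1) ^ 6, by positivity, fun f g h => ?_⟩
  have h1 := hC f g h.memLp h.memLp_grad h.weak
  have h2 : ∀ i, eLpNorm (g i) 2 volume ≤ ENNReal.ofReal √(gradSq g) := fun i => by
    rw [eLpNorm_two_eq (h.memLp_grad i)]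
    exact ENNReal.ofReal_le_ofReal (Real.sqrt_le_sqrt (mass_le_gradSq g i))
  have h3 : eLpNorm f 6 volume ≤ ENNReal.ofReal ((3 * C + 1) * √(gradSq g)) := by
    refine h1.trans ((mul_le_mul_right (Finset.sum_le_sum fun i _ => h2 i) _).trans ?_)
    rw [Finset.sum_const, Finset.card_univ, Fintype.card_fin, ← ENNReal.ofReal_nsmul,
      ← ENNReal.ofReal_coe_nnreal, ← ENNReal.ofReal_mul (by positivity)]
    refine ENNReal.ofReal_le_ofReal ?_
    have := Real.sqrt_nonneg (gradSq g)
    rw [nsmul_eq_mul]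
    push_cast
    linarith
  have h4 : normL 6 f ≤ (3 * C + 1) * √(gradSq g) := by
    rw [normL, ← toReal_eLpNorm h.memLp.1]
    exact ENNReal.toReal_le_of_le_ofReal (by positivity) h3
  rw [← MemLp.normL_six_pow h.memLp]
  refine (pow_le_pow_left₀ lpNorm_nonneg h4 6).trans_eq ?_
  have e := Real.sq_sqrt (gradSq_nonneg g)
  calc ((3 * C + 1) * √(gradSq g)) ^ 6 = (3 * C + 1) ^ 6 * (√(gradSq g) ^ 2) ^ 3 := by ring
    _ = _ := by rw [e]

end H1Algebra

/-! ### Nonvanishing of local averages -/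

section Nonvanishing

theorem integral_pow_three_le {f : E3 → ℂ} {g : Fin 3 → E3 → ℂ} (h : H1Data f g) :
    (Integrable fun x => ‖f x‖ ^ 3) ∧ ∫ x, ‖f x‖ ^ 3 ≤ mass f + sixth f := by
  have hp : ∀ x, ‖f x‖ ^ 3 ≤ ‖f x‖ ^ 2 + ‖f x‖ ^ 6 := fun x => by
    nlinarith [norm_nonneg (f x), sq_nonneg (‖f x‖ ^ 3 - 1), sq_nonneg (‖f x‖),
      mul_nonneg (sq_nonneg (‖f x‖)) (sq_nonneg (‖f x‖ - 1)), sq_nonneg (‖f x‖ ^ 2 * (‖f x‖ - 1)),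
      sq_nonneg (‖f x‖ * (‖f x‖ ^ 2 - 1))]
  have hi : Integrable fun x => ‖f x‖ ^ 2 + ‖f x‖ ^ 6 := h.integrable_sq.add h.integrable_sixth
  have h3 : Integrable fun x => ‖f x‖ ^ 3 := by
    refine hi.mono' (h.memLp.1.norm.pow 3) (ae_of_all _ fun x => ?_)
    rw [Real.norm_of_nonneg (by positivity)]
    exact hp x
  refine ⟨h3, (integral_mono h3 hi hp).trans_eq ?_⟩
  exact integral_add h.integrable_sq h.integrable_sixth

/-- `H¹`-bounded functions that do not vanish in `L⁴` have a local average that is not small. -/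
theorem exists_avg_lower_bound {A c : ℝ} (hA : 0 ≤ A) (hc : 0 < c) :
    ∃ η : E3 → ℝ, MemLp η 2 volume ∧ ∃ c' > 0, ∀ (f : E3 → ℂ) (g : Fin 3 → E3 → ℂ), H1Data f g →
      mass f ≤ A → gradSq g ≤ A → sixth f ≤ A → c ≤ ∫ x, ‖f x‖ ^ 4 → ∃ x, c' ≤ ‖avg η f x‖ := by
  -- If every average were below d = c/(4(A+1)), then ∫|f|⁴ ≤ ∫|f|³|η∗f - f| + d∫|f|³. The first
  -- term is at most δA < c/2, by Cauchy–Schwarz and the gradient bound, and the second is at most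
  -- 2dA ≤ c/2.
  have hδ : 0 < c / (2 * (A + 1)) := by positivity
  obtain ⟨η, -, hη⟩ := exists_test_kernel hδ
  refine ⟨η, hη.memLp_two, c / (4 * (A + 1)), by positivity, fun f g h hm hg h6 h4 => ?_⟩
  by_contra! hcon
  set d := c / (4 * (A + 1)) with hd
  have hsub := (hη.memLp_avg h.memLp).sub h.memLp
  have i1 := integrable_norm_mul h.memLp_cube hsub
  obtain ⟨i2, h3⟩ := integral_pow_three_le h
  have h5 : ∫ x, ‖f x‖ ^ 4 ≤ (∫ x, ‖‖f x‖ ^ 3‖ * ‖(avg η f - f) x‖) + d * ∫ x, ‖f x‖ ^ 3 := by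
    rw [← integral_const_mul, ← integral_add i1 (i2.const_mul d)]
    refine integral_mono h.integrable_fourth (i1.add (i2.const_mul d)) fun x => ?_
    have t : ‖f x‖ ≤ d + ‖avg η f x - f x‖ := by
      rw [norm_sub_rev]
      exact (norm_le_norm_add_norm_sub' _ _).trans (add_le_add (hcon x).le le_rfl)
    have t2 := mul_le_mul_of_nonneg_left t (pow_nonneg (norm_nonneg (f x)) 3)
    simp only [Pi.sub_apply, norm_pow, norm_norm]
    linarith
  have h7 := integral_norm_mul_le h.memLp_cube hsub
  rw [integral_cube_sq] at h7
  have h8 : ∫ x, ‖(avg η f - f) x‖ ^ 2 ≤ (c / (2 * (A + 1))) ^ 2 * A :=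
    (h.integral_avg_sub_le hη).trans (mul_le_mul_of_nonneg_left hg (sq_nonneg _))
  have h9 : √(sixth f) * √(∫ x, ‖(avg η f - f) x‖ ^ 2) ≤ c / (2 * (A + 1)) * A := by
    rw [← Real.sqrt_mul (sixth_nonneg f)]
    refine Real.sqrt_le_iff.mpr ⟨by positivity, ?_⟩
    refine (mul_le_mul h6 h8 (integral_nonneg fun _ => by positivity) hA).trans_eq ?_
    ring
  have e1 : c / (2 * (A + 1)) * A < c / 2 := by
    rw [div_mul_eq_mul_div, div_lt_div_iff₀ (by positivity) two_pos]; nlinarith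
  have e2 : d * ∫ x, ‖f x‖ ^ 3 ≤ c / 2 := by
    have : d * ∫ x, ‖f x‖ ^ 3 ≤ d * (2 * A) :=
      mul_le_mul_of_nonneg_left (by linarith) (by positivity)
    refine this.trans ?_
    rw [hd, div_mul_eq_mul_div, div_le_div_iff₀ (by positivity) two_pos]; nlinarith
  linarith

end Nonvanishing

/-! ### Splitting of the functionals along weak limits -/

section Splitting

/-- The difference ‖u‖² - ‖u - f‖² = 2 Re⟨f, u⟩ - ‖f‖² is affine in u over the reals, so it passes
to weak limits. -/
theorem WeakConv.tendsto_mass_sub {F : ℕ → E3 → ℂ} {f : E3 → ℂ} (h : WeakConv F f)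
    (hF : ∀ n, MemLp (F n) 2 volume) (hf : MemLp f 2 volume) :
    Tendsto (fun n => mass (F n) - mass (fun x => F n x - f x)) atTop (𝓝 (mass f)) := by
  have hre : ∀ {u : E3 → ℂ}, MemLp u 2 volume → ∫ x, ((starRingEnd ℂ) (f x) * u x).re
      = (∫ x, (starRingEnd ℂ) (f x) * u x).re := fun hu =>
    integral_re (integrable_mul_complex (MemLp.conj hf) hu)
  have key : ∀ {u : E3 → ℂ}, MemLp u 2 volume → mass u - mass (fun x => u x - f x)
      = 2 * (∫ x, (starRingEnd ℂ) (f x) * u x).re - mass f := by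
    intro u hu
    have i1 := MemLp.integrable_pow (n := 2) two_ne_zero hu
    have i2 : Integrable fun x => ‖u x - f x‖ ^ 2 :=
      MemLp.integrable_pow (n := 2) two_ne_zero (hu.sub hf)
    have i3 := MemLp.integrable_pow (n := 2) two_ne_zero hf
    have i4 : Integrable fun x => ((starRingEnd ℂ) (f x) * u x).re :=
      (integrable_mul_complex (MemLp.conj hf) hu).re
    rw [← hre hu, mass, mass, mass, ← integral_sub i1 i2, ← integral_const_mul,
      ← integral_sub (i4.const_mul 2) i3]
    refine integral_congr_ae (ae_of_all _ fun x => ?_)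
    simp only [← Complex.normSq_eq_norm_sq, Complex.normSq_apply, Complex.mul_re, Complex.conj_re,
      Complex.conj_im, Complex.sub_re, Complex.sub_im]
    ring
  have h1 := (((Complex.continuous_re.tendsto _).comp (h _ (MemLp.conj hf))).const_mul 2).sub_const
    (mass f)
  have e := key hf
  have z : mass (fun x => f x - f x) = 0 := by simp [mass]
  rw [z, sub_zero] at e
  rw [← e] at h1
  exact h1.congr fun n => (key (hF n)).symm

theorem tendsto_gradSq_sub {G : ℕ → Fin 3 → E3 → ℂ} {g : Fin 3 → E3 → ℂ}
    (h : ∀ i, WeakConv (fun n => G n i) (g i)) (hG : ∀ n i, MemLp (G n i) 2 volume)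
    (hg : ∀ i, MemLp (g i) 2 volume) :
    Tendsto (fun n => gradSq (G n) - gradSq (fun i x => G n i x - g i x)) atTop
      (𝓝 (gradSq g)) := by
  have := tendsto_finsetSum Finset.univ fun i _ =>
    (h i).tendsto_mass_sub (fun n => hG n i) (hg i)
  simp only [Finset.sum_sub_distrib] at this
  exact this

variable {F : ℕ → E3 → ℂ} {G : ℕ → Fin 3 → E3 → ℂ} {A : ℝ}

/-- Densities are bounded in L² by L²–L⁶ interpolation, so compactly supported continuous weights
suffice; for these the claim is local compactness. -/
theorem tendsto_weight_sq (h : ∀ n, H1Data (F n) (G n)) (hm : ∀ n, mass (F n) ≤ A)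
    (hg : ∀ n, gradSq (G n) ≤ A) (h6 : ∀ n, sixth (F n) ≤ A) (h0 : WeakConv F 0) {w : E3 → ℝ}
    (hw : MemLp w 2 volume) : Tendsto (fun n => ∫ x, w x * density (F n) x) atTop (𝓝 0) := by
  refine tendsto_of_dense (A := √A * √A) (fun n => (h n).memLp_density) (fun n => ?_)
    (fun v hv hvc => ?_) hw
  · rw [integral_density_sq]
    exact (h n).integral_fourth_le.trans (mul_le_mul (Real.sqrt_le_sqrt (hm n))
      (Real.sqrt_le_sqrt (h6 n)) (Real.sqrt_nonneg _) (Real.sqrt_nonneg _))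
  · obtain ⟨C, hC⟩ := hvc.exists_bound_of_continuous hv
    exact tendsto_local h hm hg h0 (hv.integrable_of_hasCompactSupport hvc) hC

/-- As for the densities, but the local step factors v|F|³ as (v|F|)·|F|² in Cauchy–Schwarz. The
intended weight is the cube of the weak limit. -/
theorem tendsto_weight_cube (h : ∀ n, H1Data (F n) (G n)) (hm : ∀ n, mass (F n) ≤ A)
    (hg : ∀ n, gradSq (G n) ≤ A) (h6 : ∀ n, sixth (F n) ≤ A) (h0 : WeakConv F 0) {w : E3 → ℝ}
    (hw : MemLp w 2 volume) : Tendsto (fun n => ∫ x, w x * ‖F n x‖ ^ 3) atTop (𝓝 0) := by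
  refine tendsto_of_dense (A := A) (fun n => (h n).memLp_cube) (fun n => ?_) (fun v hv hvc => ?_) hw
  · rw [integral_cube_sq]; exact h6 n
  · obtain ⟨C, hC⟩ := hvc.exists_bound_of_continuous hv
    have hv2c : HasCompactSupport fun x => v x * v x := hvc.mul_right
    have h1 := tendsto_local h hm hg h0 (w := fun x => v x * v x) (C := C * C)
      ((hv.mul hv).integrable_of_hasCompactSupport hv2c) (fun x => by
        rw [abs_mul]; exact mul_le_mul (hC x) (hC x) (abs_nonneg _) ((abs_nonneg _).trans (hC x)))
    have h2 := (Real.continuous_sqrt.tendsto _).comp h1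
    have h3 := h2.mul_const (√(√A * √A))
    rw [Real.sqrt_zero, zero_mul] at h3
    refine squeeze_zero_norm (fun n => ?_) h3
    have hvF : MemLp (fun x => v x • F n x) 2 volume := by
      refine (h n).memLp.of_le_mul (c := C) (hv.aestronglyMeasurable.smul (h n).memLp.1)
        (ae_of_all _ fun x => ?_)
      rw [norm_smul]
      exact mul_le_mul_of_nonneg_right (hC x) (norm_nonneg _)
    have e1 : ∫ x, ‖v x • F n x‖ ^ 2 = ∫ x, v x * v x * ‖F n x‖ ^ 2 := by
      refine integral_congr_ae (ae_of_all _ fun x => ?_)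
      simp only [norm_smul, mul_pow, Real.norm_eq_abs, sq_abs, ← sq]
    calc ‖∫ x, v x * ‖F n x‖ ^ 3‖ ≤ ∫ x, ‖v x • F n x‖ * ‖density (F n) x‖ := by
          refine (norm_integral_le_integral_norm _).trans_eq
            (integral_congr_ae (ae_of_all _ fun x => ?_))
          simp only [density, norm_smul, norm_mul, norm_pow, norm_norm]
          ring
      _ ≤ √(∫ x, ‖v x • F n x‖ ^ 2) * √(∫ x, ‖density (F n) x‖ ^ 2) :=
          integral_norm_mul_le hvF (h n).memLp_density
      _ ≤ _ := by
          rw [e1, integral_density_sq]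
          refine mul_le_mul_of_nonneg_left (Real.sqrt_le_sqrt ?_) (Real.sqrt_nonneg _)
          exact (h n).integral_fourth_le.trans (mul_le_mul (Real.sqrt_le_sqrt (hm n))
            (Real.sqrt_le_sqrt (h6 n)) (Real.sqrt_nonneg _) (Real.sqrt_nonneg _))

/-- A one-sided, quantitative substitute for the Brezis–Lieb lemma. The cross term is arranged as a
product of cubes so that `tendsto_weight_cube` eliminates it. -/
theorem norm_add_pow_six_ge (a b : ℂ) {ε : ℝ} (hε : 0 < ε) :
    (1 - 12 * ε) * (‖a‖ ^ 6 + ‖b‖ ^ 6) - 24 / ε ^ 2 * (‖a‖ ^ 3 * ‖b‖ ^ 3) ≤ ‖b + a‖ ^ 6 := by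
  set p := ‖a‖ with hp
  set q := ‖b‖ with hq
  have hp0 : 0 ≤ p := norm_nonneg _
  have hq0 : 0 ≤ q := norm_nonneg _
  have h1 : (q - p) ^ 2 ≤ ‖b + a‖ ^ 2 := by
    rw [sq_le_sq, abs_of_nonneg (norm_nonneg (b + a))]
    have := abs_norm_sub_norm_le b (-a)
    rwa [norm_neg, sub_neg_eq_add] at this
  have h2 : ((q - p) ^ 2) ^ 3 ≤ ‖b + a‖ ^ 6 := by
    calc ((q - p) ^ 2) ^ 3 ≤ (‖b + a‖ ^ 2) ^ 3 := pow_le_pow_left₀ (sq_nonneg _) h1 3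
      _ = _ := by ring
  refine le_trans ?_ h2
  set B := p ^ 2 + q ^ 2 with hB
  set r := 2 * (p * q) with hr
  have hB0 : 0 ≤ B := by positivity
  have hr0 : 0 ≤ r := by positivity
  have hrB : r ≤ B := by nlinarith [sq_nonneg (p - q)]
  have e : (q - p) ^ 2 = B - r := by rw [hB, hr]; ring
  rw [e]
  have t1 : B ^ 3 - 3 * (B ^ 2 * r) ≤ (B - r) ^ 3 := by nlinarith [sq_nonneg r, mul_nonneg (sq_nonneg r) (by linarith : 0 ≤ 3 * B - r)]
  -- Young's inequality by cases on r ≤ εB. With B³ ≤ 4(p⁶ + q⁶) and r³ = 8p³q³ it produces the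
  -- constants 12 = 3·4 and 24 = 3·8.
  have t2 : B ^ 2 * r ≤ ε * B ^ 3 + r ^ 3 / ε ^ 2 := by
    rcases le_total r (ε * B) with h | h
    · have : B ^ 2 * r ≤ B ^ 2 * (ε * B) := mul_le_mul_of_nonneg_left h (sq_nonneg _)
      have : 0 ≤ r ^ 3 / ε ^ 2 := by positivity
      nlinarith
    · have h3 : B ^ 2 * r ≤ r ^ 3 / ε ^ 2 := by
        rw [le_div_iff₀ (by positivity)]
        have := pow_le_pow_left₀ (by positivity) h 2
        nlinarith [mul_le_mul_of_nonneg_right this hr0]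
      have : 0 ≤ ε * B ^ 3 := by positivity
      linarith
  have t3 : p ^ 6 + q ^ 6 ≤ B ^ 3 := by
    have : B ^ 3 = p ^ 6 + q ^ 6 + 3 * (p ^ 2 * q ^ 2) * B := by rw [hB]; ring
    have h0 : 0 ≤ 3 * (p ^ 2 * q ^ 2) * B := by positivity
    linarith
  have t4 : B ^ 3 ≤ 4 * (p ^ 6 + q ^ 6) := by
    have : 4 * (p ^ 6 + q ^ 6) - B ^ 3 = 3 * B * (p ^ 2 - q ^ 2) ^ 2 := by rw [hB]; ring
    have h0 : 0 ≤ 3 * B * (p ^ 2 - q ^ 2) ^ 2 := by positivity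
    linarith
  have e3 : 24 / ε ^ 2 * (p ^ 3 * q ^ 3) = 3 * (r ^ 3 / ε ^ 2) := by rw [hr]; ring
  rw [e3]
  have t5 := mul_le_mul_of_nonneg_left t4 hε.le
  linarith

theorem sixth_add_ge {f h : E3 → ℂ} {g k : Fin 3 → E3 → ℂ} (hf : H1Data f g) (hh : H1Data h k)
    {ε : ℝ} (hε : 0 < ε) : (1 - 12 * ε) * (sixth f + sixth h)
      - 24 / ε ^ 2 * ∫ x, ‖f x‖ ^ 3 * ‖h x‖ ^ 3 ≤ sixth (fun x => h x + f x) := by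
  have i1 := (hf.integrable_sixth.add hh.integrable_sixth).const_mul (1 - 12 * ε)
  have i2 : Integrable fun x => ‖f x‖ ^ 3 * ‖h x‖ ^ 3 :=
    hf.memLp_cube.integrable_mul hh.memLp_cube
  have i2' := i2.const_mul (24 / ε ^ 2)
  have e : (1 - 12 * ε) * (sixth f + sixth h) - 24 / ε ^ 2 * ∫ x, ‖f x‖ ^ 3 * ‖h x‖ ^ 3
      = ∫ x, ((1 - 12 * ε) * (‖f x‖ ^ 6 + ‖h x‖ ^ 6) - 24 / ε ^ 2 * (‖f x‖ ^ 3 * ‖h x‖ ^ 3)) := by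
    rw [sixth, sixth, ← integral_add hf.integrable_sixth hh.integrable_sixth, ← integral_const_mul,
      ← integral_const_mul]
    exact (integral_sub i1 i2').symm
  rw [e]
  exact integral_mono (i1.sub i2') (hh.add hf).integrable_sixth fun x =>
    norm_add_pow_six_ge _ _ hε

/-- Pointwise, |h + f|² differs from |f|² + |h|² by at most 2|f||h|. The bound tends to 0 when `h`
runs through remainders that converge weakly to 0. -/
theorem norm_rho_sub_sq_le {f h : E3 → ℂ} {g k : Fin 3 → E3 → ℂ} (hf : H1Data f g)
    (hh : H1Data h k) : ‖(hh.add hf).rho - (hf.rho + hh.rho)‖ ^ 2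
      ≤ 4 * ∫ x, density f x * density h x := by
  have i2 : Integrable fun x => density f x * density h x :=
    hf.memLp_density.integrable_mul hh.memLp_density
  set v := (hh.add hf).rho - (hf.rho + hh.rho) with hv
  have e : ‖v‖ ^ 2 = ∫ x, ‖v x‖ ^ 2 := by
    rw [← norm_toLp_sq (Lp.memLp v), Lp.toLp_coeFn]
  rw [e, ← integral_const_mul]
  refine integral_mono_ae (MemLp.integrable_pow (n := 2) two_ne_zero (Lp.memLp v))
    (i2.const_mul 4) ?_
  filter_upwards [Lp.coeFn_sub (hh.add hf).rho (hf.rho + hh.rho), Lp.coeFn_add hf.rho hh.rho,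
    hf.rho_coe, hh.rho_coe, (hh.add hf).rho_coe] with x h1 h2 h3 h4 h5
  rw [h1, Pi.sub_apply, h2, Pi.add_apply, h3, h4, h5, Real.norm_eq_abs, sq_abs]
  simp only [density]
  have t1 := norm_add_le (h x) (f x)
  have t2 := abs_norm_sub_norm_le (h x) (-f x)
  rw [norm_neg, sub_neg_eq_add] at t2
  set p := ‖f x‖
  set q := ‖h x‖
  have hp : 0 ≤ p := norm_nonneg _
  have hq : 0 ≤ q := norm_nonneg _
  have s0 := norm_nonneg (h x + f x)
  have u1 : ‖h x + f x‖ ^ 2 ≤ (q + p) ^ 2 := pow_le_pow_left₀ s0 t1 2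
  have u2 : (q - p) ^ 2 ≤ ‖h x + f x‖ ^ 2 := by
    rw [sq_le_sq, abs_of_nonneg s0]; exact t2
  have u3 : |‖h x + f x‖ ^ 2 - (p ^ 2 + q ^ 2)| ≤ 2 * (p * q) := by
    rw [abs_le]; constructor <;> nlinarith
  have u4 := pow_le_pow_left₀ (abs_nonneg _) u3 2
  rw [sq_abs] at u4
  refine u4.trans_eq ?_
  ring

/-- With τ = ρ + σ + r, symmetry reduces the cross terms to 2⟨Vρ, σ⟩, which vanishes in the limit by
hypothesis, and to terms containing r, which tends to 0 in norm. The nonlocality of V causes no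
loss. -/
theorem tendsto_quadratic_sub {H : Type*} [NormedAddCommGroup H] [InnerProductSpace ℝ H]
    (V : H →L[ℝ] H) (hV : ∀ u v, inner ℝ (V u) v = inner ℝ u (V v)) (ρ : H) {σ τ : ℕ → H} {B : ℝ}
    (hσ : ∀ n, ‖σ n‖ ≤ B) (hw : Tendsto (fun n => inner ℝ (V ρ) (σ n)) atTop (𝓝 0))
    (hr : Tendsto (fun n => ‖τ n - (ρ + σ n)‖) atTop (𝓝 0)) :
    Tendsto (fun n => inner ℝ (V (τ n)) (τ n) - inner ℝ (V (σ n)) (σ n)) atTop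
      (𝓝 (inner ℝ (V ρ) ρ)) := by
  set r := fun n => τ n - (ρ + σ n) with hrd
  have hV1 : Tendsto (fun n => ‖V (r n)‖) atTop (𝓝 0) := by
    have h1 := hr.const_mul ‖V‖
    rw [mul_zero] at h1
    exact squeeze_zero (fun _ => norm_nonneg _) (fun n => V.le_opNorm _) h1
  have hb : ∀ {v : ℕ → H} {C : ℝ}, (∀ n, ‖v n‖ ≤ C) →
      Tendsto (fun n => inner ℝ (V (r n)) (v n)) atTop (𝓝 0) := by
    intro v C hv
    have h1 := hV1.mul_const C
    rw [zero_mul] at h1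
    refine squeeze_zero_norm (fun n => ?_) h1
    exact (norm_inner_le_norm _ _).trans (mul_le_mul_of_nonneg_left (hv n) (norm_nonneg _))
  have t1 := hb (v := fun _ => ρ) (C := ‖ρ‖) (fun _ => le_rfl)
  have t2 := hb (v := σ) hσ
  have t3 : Tendsto (fun n => inner ℝ (V (r n)) (r n)) atTop (𝓝 0) := by
    have h1 := hV1.mul hr
    rw [zero_mul] at h1
    exact squeeze_zero_norm (fun n => norm_inner_le_norm _ _) h1
  have hlim := (((hw.const_mul 2).add (t1.const_mul 2)).add ((t2.const_mul 2).add t3)).const_add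
    (inner ℝ (V ρ) ρ)
  simp only [mul_zero, add_zero] at hlim
  refine hlim.congr fun n => ?_
  have e : τ n = ρ + σ n + r n := (add_sub_cancel _ _).symm
  have s1 : inner ℝ (V (σ n)) ρ = inner ℝ (V ρ) (σ n) := by rw [hV, real_inner_comm]
  have s2 : inner ℝ (V ρ) (r n) = inner ℝ (V (r n)) ρ := by rw [hV, real_inner_comm]
  have s3 : inner ℝ (V (σ n)) (r n) = inner ℝ (V (r n)) (σ n) := by rw [hV, real_inner_comm]
  rw [e]
  simp only [map_add, inner_add_left, inner_add_right, s1, s2, s3]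
  ring

theorem tendsto_N_sub (h : ∀ n, H1Data (F n) (G n)) (hm : ∀ n, mass (F n) ≤ A)
    (hg : ∀ n, gradSq (G n) ≤ A) (h6 : ∀ n, sixth (F n) ≤ A) (h0 : WeakConv F 0)
    {f : E3 → ℂ} {g : Fin 3 → E3 → ℂ} (hf : H1Data f g) (l₁ l₂ : ℝ) :
    Tendsto (fun n => N l₁ l₂ (fun x => F n x + f x) - N l₁ l₂ (F n)) atTop (𝓝 (N l₁ l₂ f)) := by
  have hA : 0 ≤ A := (mass_nonneg _).trans (hm 0)
  rw [hf.N_eq]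
  refine (tendsto_quadratic_sub (potOp l₁ l₂) (potOp_symm l₁ l₂) hf.rho (σ := fun n => (h n).rho)
    (τ := fun n => ((h n).add hf).rho) (B := √A) (fun n => ?_) ?_ ?_).congr fun n => ?_
  · rw [← sq_le_sq₀ (norm_nonneg _) (Real.sqrt_nonneg _), (h n).norm_rho_sq]
    refine (h n).integral_fourth_le.trans ((mul_le_mul (Real.sqrt_le_sqrt (hm n))
      (Real.sqrt_le_sqrt (h6 n)) (Real.sqrt_nonneg _) (Real.sqrt_nonneg _)).trans_eq ?_)
    rw [Real.mul_self_sqrt hA, Real.sq_sqrt hA]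
  · refine (tendsto_weight_sq h hm hg h6 h0 (Lp.memLp (potOp l₁ l₂ hf.rho))).congr fun n => ?_
    rw [L2.inner_def]
    refine integral_congr_ae ?_
    filter_upwards [(h n).rho_coe] with x hx
    rw [hx]; simp [mul_comm]
  · have h1 := (tendsto_weight_sq h hm hg h6 h0 hf.memLp_density).const_mul 4
    rw [mul_zero] at h1
    have h2 := squeeze_zero (fun n => sq_nonneg ‖((h n).add hf).rho - (hf.rho + (h n).rho)‖)
      (fun n => norm_rho_sub_sq_le hf (h n)) h1
    have h3 := (Real.continuous_sqrt.tendsto _).comp h2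
    rw [Real.sqrt_zero] at h3
    exact h3.congr fun n => Real.sqrt_sq (norm_nonneg _)
  · rw [((h n).add hf).N_eq, (h n).N_eq]

end Splitting

/-! ### Homogeneity and superadditivity of the product -/

section GNFunction

variable {α : ℝ}

theorem gnFun_nonneg {a b c : ℝ} (ha : 0 ≤ a) (hb : 0 ≤ b) (hc : 0 ≤ c) : 0 ≤ gnFun α a b c := by
  unfold gnFun; positivity

theorem gnFun_pos {a b c : ℝ} (ha : 0 < a) (hb : 0 < b) (hc : 0 < c) : 0 < gnFun α a b c := by
  unfold gnFun; positivity

theorem gnFun_one_one (c : ℝ) : gnFun α 1 1 c = c ^ (α / (2 * (1 + α))) := by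
  simp [gnFun]

theorem continuous_gnFun (hα : 0 < α) : Continuous fun p : ℝ × ℝ × ℝ => gnFun α p.1 p.2.1 p.2.2 := by
  unfold gnFun
  refine ((continuous_fst.rpow_const fun _ => Or.inr (by positivity)).mul
    ((continuous_fst.comp continuous_snd).rpow_const fun _ => Or.inr (by positivity))).mul
    ((continuous_snd.comp continuous_snd).rpow_const fun _ => Or.inr (by positivity))

/-- The exponents add up to μ⁴ and κ⁻³, the factors by which N scales, so the Weinstein quotient is
invariant under the whole two-parameter scaling. -/
theorem gnFun_affine (hα : 0 < α) {a b c μ κ : ℝ} (ha : 0 ≤ a) (hb : 0 ≤ b) (hc : 0 ≤ c)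
    (hμ : 0 < μ) (hκ : 0 < κ) :
    gnFun α (μ ^ 2 * (κ ^ 3)⁻¹ * a) (μ ^ 2 * κ⁻¹ * b) (μ ^ 6 * (κ ^ 3)⁻¹ * c)
      = μ ^ 4 * (κ ^ 3)⁻¹ * gnFun α a b c := by
  have hα' : 1 + α ≠ 0 := by positivity
  have e : ∀ (n k : ℕ) (p : ℝ), (μ ^ n * (κ ^ k)⁻¹) ^ p = μ ^ (n * p) * κ ^ (-(k * p)) := by
    intro n k p
    rw [Real.mul_rpow (by positivity) (by positivity), ← Real.rpow_natCast_mul hμ.le,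
      Real.inv_rpow (by positivity), ← Real.rpow_natCast_mul hκ.le, Real.rpow_neg hκ.le]
  have e1 := e 2 3 (1 / 2)
  have e2 := e 2 1 (3 / (2 * (1 + α)))
  have e3 := e 6 3 (α / (2 * (1 + α)))
  rw [pow_one] at e2
  rw [gnFun, gnFun, Real.mul_rpow (by positivity) ha, Real.mul_rpow (by positivity) hb,
    Real.mul_rpow (by positivity) hc, e1, e2, e3]
  have m1 : μ ^ (((2 : ℕ) : ℝ) * (1 / 2)) * μ ^ (((2 : ℕ) : ℝ) * (3 / (2 * (1 + α))))
      * μ ^ (((6 : ℕ) : ℝ) * (α / (2 * (1 + α)))) = μ ^ 4 := by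
    rw [← Real.rpow_add hμ, ← Real.rpow_add hμ, ← Real.rpow_natCast]
    congr 1; push_cast; field_simp; ring
  have m2 : κ ^ (-(((3 : ℕ) : ℝ) * (1 / 2))) * κ ^ (-(((1 : ℕ) : ℝ) * (3 / (2 * (1 + α)))))
      * κ ^ (-(((3 : ℕ) : ℝ) * (α / (2 * (1 + α))))) = (κ ^ 3)⁻¹ := by
    rw [← Real.rpow_add hκ, ← Real.rpow_add hκ, ← Real.rpow_natCast, ← Real.rpow_neg hκ.le]
    congr 1; push_cast; field_simp; ring
  rw [← m1, ← m2]
  ring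

/-- The exponents sum to (2+α)/(1+α) ≥ 1. Dividing by this sum only increases powers of numbers in
[0, 1] and makes the exponents weights, so weighted AM–GM applies. -/
theorem gn_weight_le (hα : 0 < α) {u v w : ℝ} (hu : u ∈ Set.Icc (0 : ℝ) 1)
    (hv : v ∈ Set.Icc (0 : ℝ) 1) (hw : w ∈ Set.Icc (0 : ℝ) 1) :
    gnFun α u v w ≤ ((1 + α) * u + 3 * v + α * w) / (2 * (2 + α)) := by
  have hs : 1 ≤ (2 + α) / (1 + α) := by rw [le_div_iff₀ (by positivity)]; linarith
  have key : ∀ {x p : ℝ}, x ∈ Set.Icc (0 : ℝ) 1 → 0 ≤ p →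
      x ^ p ≤ x ^ (p / ((2 + α) / (1 + α))) := fun hx hp =>
    Real.rpow_le_rpow_of_exponent_ge' hx.1 hx.2 (by positivity) (div_le_self hp hs)
  have h := Real.geom_mean_le_arith_mean3_weighted (w₁ := 1 / 2 / ((2 + α) / (1 + α)))
    (w₂ := 3 / (2 * (1 + α)) / ((2 + α) / (1 + α)))
    (w₃ := α / (2 * (1 + α)) / ((2 + α) / (1 + α))) (by positivity) (by positivity) (by positivity)
    hu.1 hv.1 hw.1 (by field_simp; ring)
  have h1 : gnFun α u v w ≤ u ^ (1 / 2 / ((2 + α) / (1 + α)))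
      * v ^ (3 / (2 * (1 + α)) / ((2 + α) / (1 + α))) * w ^ (α / (2 * (1 + α)) / ((2 + α) / (1 + α))) := by
    have hu0 := hu.1
    have hv0 := hv.1
    have hw0 := hw.1
    unfold gnFun
    refine mul_le_mul (mul_le_mul (key hu (by positivity)) (key hv (by positivity)) (by positivity)
      (by positivity)) (key hw (by positivity)) (by positivity) (by positivity)
  refine (h1.trans h).trans_eq ?_
  field_simp

/-- After division by c + c', both terms are bounded by the same affine expression in the fractions;
complementary fractions make the two bounds add up to exactly 1. -/
theorem gnFun_superadditive (hα : 0 < α) {a a' b b' c c' : ℝ} (ha : 0 ≤ a) (ha' : 0 ≤ a')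
    (hb : 0 ≤ b) (hb' : 0 ≤ b') (hc : 0 ≤ c) (hc' : 0 ≤ c') (haa : a + a' = 1) (hbb : b + b' = 1) :
    gnFun α a b c + gnFun α a' b' c' ≤ gnFun α 1 1 (c + c') := by
  rw [gnFun_one_one]
  have hθ : α / (2 * (1 + α)) ≠ 0 := by positivity
  rcases (add_nonneg hc hc').eq_or_lt with h0 | h0
  · have h1 : c = 0 := by linarith
    have h2 : c' = 0 := by linarith
    simp [gnFun, h1, h2, Real.zero_rpow hθ]
  · have e : ∀ {x y z : ℝ}, 0 ≤ z → gnFun α x y z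
        = (c + c') ^ (α / (2 * (1 + α))) * gnFun α x y (z / (c + c')) := by
      intro x y z hz
      unfold gnFun
      rw [Real.div_rpow hz h0.le]
      have : (c + c') ^ (α / (2 * (1 + α))) ≠ 0 := by positivity
      field_simp
    rw [e hc, e hc', ← mul_add]
    refine mul_le_of_le_one_right (by positivity) ?_
    have m1 : c / (c + c') ∈ Set.Icc (0 : ℝ) 1 :=
      ⟨by positivity, div_le_one_of_le₀ (by linarith) h0.le⟩
    have m2 : c' / (c + c') ∈ Set.Icc (0 : ℝ) 1 :=
      ⟨by positivity, div_le_one_of_le₀ (by linarith) h0.le⟩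
    refine (add_le_add (gn_weight_le hα ⟨ha, by linarith⟩ ⟨hb, by linarith⟩ m1)
      (gn_weight_le hα ⟨ha', by linarith⟩ ⟨hb', by linarith⟩ m2)).trans_eq ?_
    have e1 : c' / (c + c') = 1 - c / (c + c') := by field_simp; ring
    have e2 : a' = 1 - a := by linarith
    have e3 : b' = 1 - b := by linarith
    rw [e1, e2, e3]
    field_simp
    ring

end GNFunction

/-! ### The Gagliardo–Nirenberg–Hölder inequality -/

section Inequality

variable {l₁ l₂ α : ℝ}

theorem H1Data.N_le {f : E3 → ℂ} {g : Fin 3 → E3 → ℂ} (h : H1Data f g) (l₁ l₂ : ℝ) :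
    N l₁ l₂ f ≤ ‖potOp l₁ l₂‖ * ∫ x, ‖f x‖ ^ 4 := by
  rw [h.N_eq, ← h.norm_rho_sq]
  refine (real_inner_le_norm _ _).trans ?_
  refine (mul_le_mul_of_nonneg_right ((potOp l₁ l₂).le_opNorm _) (norm_nonneg _)).trans_eq ?_
  ring

theorem H1Data.N_le_sqrt {f : E3 → ℂ} {g : Fin 3 → E3 → ℂ} (h : H1Data f g) (l₁ l₂ : ℝ) :
    N l₁ l₂ f ≤ ‖potOp l₁ l₂‖ * (√(mass f) * √(sixth f)) :=
  (h.N_le l₁ l₂).trans (mul_le_mul_of_nonneg_left h.integral_fourth_le (norm_nonneg _))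

/-- In N ≤ ‖V‖ (∫|f|²)^{1/2} (∫|f|⁶)^{1/2} the last exponent is split as 1/2 = α/(2(1+α)) +
1/(2(1+α)), and Sobolev turns the second power into one of the gradient energy. -/
theorem exists_gn_const (l₁ l₂ : ℝ) (hα : 0 < α) : ∃ C : ℝ, 0 < C ∧
    ∀ (f : E3 → ℂ) (g : Fin 3 → E3 → ℂ), H1Data f g →
      N l₁ l₂ f ≤ C * gnFun α (mass f) (gradSq g) (sixth f) := by
  obtain ⟨S, hS, hSob⟩ := exists_sobolev
  refine ⟨(‖potOp l₁ l₂‖ + 1) * S ^ (1 / (2 * (1 + α))), by positivity, fun f g h => ?_⟩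
  refine (h.N_le_sqrt l₁ l₂).trans ?_
  have ha := mass_nonneg f
  have hb := gradSq_nonneg g
  have hc := sixth_nonneg f
  have h1 : √(sixth f) ≤ sixth f ^ (α / (2 * (1 + α))) *
      (S ^ (1 / (2 * (1 + α))) * gradSq g ^ (3 / (2 * (1 + α)))) := by
    rcases hc.eq_or_lt with h0 | h0
    · rw [← h0, Real.sqrt_zero]; positivity
    · rw [Real.sqrt_eq_rpow]
      have e : (1 / 2 : ℝ) = α / (2 * (1 + α)) + 1 / (2 * (1 + α)) := by field_simp; ring
      rw [e, Real.rpow_add h0]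
      refine mul_le_mul_of_nonneg_left ?_ (by positivity)
      refine (Real.rpow_le_rpow hc (hSob f g h) (by positivity)).trans_eq ?_
      rw [Real.mul_rpow hS.le (by positivity), ← Real.rpow_natCast_mul hb]
      congr 2
      push_cast; field_simp
  have h2 : √(mass f) = mass f ^ (1 / 2 : ℝ) := Real.sqrt_eq_rpow _
  calc ‖potOp l₁ l₂‖ * (√(mass f) * √(sixth f))
      ≤ (‖potOp l₁ l₂‖ + 1) * (mass f ^ (1 / 2 : ℝ) * (sixth f ^ (α / (2 * (1 + α))) *
      (S ^ (1 / (2 * (1 + α))) * gradSq g ^ (3 / (2 * (1 + α)))))) := by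
        rw [h2]
        refine mul_le_mul (by linarith) (mul_le_mul_of_nonneg_left h1 (by positivity))
          (by positivity) (by positivity)
    _ = _ := by rw [gnFun]; ring

/-- The infimum of the Weinstein functional. -/
def weinsteinInf (l₁ l₂ α : ℝ) : ℝ := sInf (weinstein l₁ l₂ α '' admissible l₁ l₂)

theorem H1Data.weinstein_eq {f : E3 → ℂ} {g : Fin 3 → E3 → ℂ} (h : H1Data f g) (hα : 0 < α) :
    weinstein l₁ l₂ α f = gnFun α (mass f) (gradSq g) (sixth f) / N l₁ l₂ f := by
  rw [weinstein, h.gnProduct_eq hα]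

theorem H1Data.gnFun_nonneg {f : E3 → ℂ} {g : Fin 3 → E3 → ℂ} (_ : H1Data f g) :
    0 ≤ gnFun α (mass f) (gradSq g) (sixth f) :=
  DipolarNLS.gnFun_nonneg (mass_nonneg f) (gradSq_nonneg g) (sixth_nonneg f)

theorem exists_weinstein_lower_bound (l₁ l₂ : ℝ) (hα : 0 < α) :
    ∃ d : ℝ, 0 < d ∧ ∀ f ∈ admissible l₁ l₂, d ≤ weinstein l₁ l₂ α f := by
  obtain ⟨C, hC, h⟩ := exists_gn_const l₁ l₂ hα
  refine ⟨C⁻¹, inv_pos.mpr hC, fun f hf => ?_⟩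
  have h1 := h f _ hf.1.h1Data
  rw [hf.1.h1Data.weinstein_eq hα, le_div_iff₀ hf.2, inv_mul_le_iff₀ hC]
  exact h1

theorem weinsteinInf_pos (hl : Unstable l₁ l₂) (hα : 0 < α) : 0 < weinsteinInf l₁ l₂ α := by
  obtain ⟨d, hd, h⟩ := exists_weinstein_lower_bound l₁ l₂ hα
  refine hd.trans_le (le_csInf ((exists_admissible hl).image _) ?_)
  rintro _ ⟨f, hf, rfl⟩
  exact h f hf

theorem weinsteinInf_le (hα : 0 < α) {f : E3 → ℂ} (hf : f ∈ admissible l₁ l₂) :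
    weinsteinInf l₁ l₂ α ≤ weinstein l₁ l₂ α f := by
  obtain ⟨d, -, h⟩ := exists_weinstein_lower_bound l₁ l₂ hα
  refine csInf_le ⟨d, ?_⟩ ⟨f, hf, rfl⟩
  rintro _ ⟨f, hf, rfl⟩
  exact h f hf

/-- For N ≤ 0 the bound holds by signs. Having it on all of H¹ matters because the remainders of a
minimizing sequence and the perturbations of an optimizer need not be admissible. -/
theorem H1Data.weinsteinInf_mul_N_le {f : E3 → ℂ} {g : Fin 3 → E3 → ℂ} (h : H1Data f g)
    (hl : Unstable l₁ l₂) (hα : 0 < α) :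
    weinsteinInf l₁ l₂ α * N l₁ l₂ f ≤ gnFun α (mass f) (gradSq g) (sixth f) := by
  rcases lt_or_ge 0 (N l₁ l₂ f) with hN | hN
  · have := weinsteinInf_le hα (f := f) (l₁ := l₁) (l₂ := l₂) ⟨h.memH1, hN⟩
    rwa [h.weinstein_eq hα, le_div_iff₀ hN] at this
  · exact (mul_nonpos_of_nonneg_of_nonpos (weinsteinInf_pos hl hα).le hN).trans h.gnFun_nonneg

theorem H1Data.weinstein_affine {f : E3 → ℂ} {g : Fin 3 → E3 → ℂ} (h : H1Data f g) (hα : 0 < α)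
    {μ κ : ℝ} (hμ : 0 < μ) (hκ : 0 < κ) (v : E3) :
    weinstein l₁ l₂ α (affineTrans μ κ v f) = weinstein l₁ l₂ α f := by
  rw [(h.affine μ hκ v).weinstein_eq hα, h.weinstein_eq hα, mass_affine f μ hκ, sixth_affine f μ hκ,
    gradSq_affine g μ hκ, gnFun_affine hα (mass_nonneg f) (gradSq_nonneg g) (sixth_nonneg f) hμ hκ,
    N_affine h l₁ l₂ μ hκ v, mul_div_mul_left _ _ (by positivity)]

theorem H1Data.N_affine_pos {f : E3 → ℂ} {g : Fin 3 → E3 → ℂ} (h : H1Data f g) (hN : 0 < N l₁ l₂ f)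
    {μ κ : ℝ} (hμ : 0 < μ) (hκ : 0 < κ) (v : E3) : 0 < N l₁ l₂ (affineTrans μ κ v f) := by
  rw [N_affine h l₁ l₂ μ hκ v]; positivity

theorem H1Data.mass_pos {f : E3 → ℂ} {g : Fin 3 → E3 → ℂ} (h : H1Data f g) (hN : 0 < N l₁ l₂ f) :
    0 < mass f := by
  refine (mass_nonneg f).lt_of_ne fun h0 => ?_
  have := h.N_le_sqrt l₁ l₂
  rw [← h0, Real.sqrt_zero, zero_mul, mul_zero] at this
  linarith

theorem H1Data.sixth_pos {f : E3 → ℂ} {g : Fin 3 → E3 → ℂ} (h : H1Data f g) (hN : 0 < N l₁ l₂ f) :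
    0 < sixth f := by
  refine (sixth_nonneg f).lt_of_ne fun h0 => ?_
  have := h.N_le_sqrt l₁ l₂
  rw [← h0, Real.sqrt_zero, mul_zero, mul_zero] at this
  linarith

theorem H1Data.gradSq_pos_of_sixth {f : E3 → ℂ} {g : Fin 3 → E3 → ℂ} (h : H1Data f g)
    (h6 : 0 < sixth f) : 0 < gradSq g := by
  obtain ⟨S, hS, hSob⟩ := exists_sobolev
  refine (gradSq_nonneg g).lt_of_ne fun h0 => ?_
  have := hSob f g h
  rw [← h0] at this
  norm_num at this
  linarith

theorem H1Data.exists_normalized {f : E3 → ℂ} {g : Fin 3 → E3 → ℂ} (h : H1Data f g) (hα : 0 < α)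
    (hN : 0 < N l₁ l₂ f) : ∃ F G, H1Data F G ∧ mass F = 1 ∧ gradSq G = 1 ∧ 0 < N l₁ l₂ F ∧
      weinstein l₁ l₂ α F = weinstein l₁ l₂ α f := by
  have ha := h.mass_pos hN
  have hb := h.gradSq_pos_of_sixth (h.sixth_pos hN)
  -- The parameters solve μ²κ⁻³ mass = 1 and μ²κ⁻¹ gradSq = 1.
  set κ := √(mass f / gradSq g) with hκd
  have hκ : 0 < κ := Real.sqrt_pos.mpr (by positivity)
  have hκ2 : κ ^ 2 = mass f / gradSq g := Real.sq_sqrt (by positivity)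
  set μ := √(κ / gradSq g) with hμd
  have hμ : 0 < μ := Real.sqrt_pos.mpr (by positivity)
  have hμ2 : μ ^ 2 = κ / gradSq g := Real.sq_sqrt (by positivity)
  refine ⟨_, _, h.affine μ hκ 0, ?_, ?_, h.N_affine_pos hN hμ hκ 0, h.weinstein_affine hα hμ hκ 0⟩
  · rw [mass_affine f μ hκ, hμ2, show κ ^ 3 = κ ^ 2 * κ by ring, hκ2]; field_simp
  · rw [gradSq_affine g μ hκ, hμ2]; field_simp

end Inequality

/-! ### Existence of an optimizer -/

section Existence

variable {l₁ l₂ α : ℝ}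

theorem mass_sub_le {u v : E3 → ℂ} (hu : MemLp u 2 volume) (hv : MemLp v 2 volume) :
    mass (fun x => u x - v x) ≤ 2 * mass u + 2 * mass v := by
  have i1 := MemLp.integrable_pow (n := 2) two_ne_zero hu
  have i2 := MemLp.integrable_pow (n := 2) two_ne_zero hv
  have i3 : Integrable fun x => ‖u x - v x‖ ^ 2 :=
    MemLp.integrable_pow (n := 2) two_ne_zero (hu.sub hv)
  rw [mass, mass, mass, ← integral_const_mul, ← integral_const_mul,
    ← integral_add (i1.const_mul 2) (i2.const_mul 2)]
  refine integral_mono i3 ((i1.const_mul 2).add (i2.const_mul 2)) fun x => ?_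
  have t := pow_le_pow_left₀ (norm_nonneg _) (norm_sub_le (u x) (v x)) 2
  nlinarith [sq_nonneg (‖u x‖ - ‖v x‖)]

theorem H1Data.gradSq_sub_le {u v : E3 → ℂ} {g k : Fin 3 → E3 → ℂ} (hu : H1Data u g)
    (hv : H1Data v k) : gradSq (fun i x => g i x - k i x) ≤ 2 * gradSq g + 2 * gradSq k := by
  rw [gradSq, gradSq, gradSq, Finset.mul_sum, Finset.mul_sum, ← Finset.sum_add_distrib]
  exact Finset.sum_le_sum fun i _ => mass_sub_le (hu.memLp_grad i) (hv.memLp_grad i)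

set_option maxHeartbeats 1000000 in
/-- The weak limit of a normalized minimizing sequence satisfies the reverse of the sharp
inequality. -/
theorem gnFun_le_of_weak_limit (hl : Unstable l₁ l₂) (hα : 0 < α) {F : ℕ → E3 → ℂ}
    {G : ℕ → Fin 3 → E3 → ℂ} (h : ∀ n, H1Data (F n) (G n)) (hm : ∀ n, mass (F n) = 1)
    (hg : ∀ n, gradSq (G n) = 1) (hN : ∀ n, 0 < N l₁ l₂ (F n))
    (hW : Tendsto (fun n => weinstein l₁ l₂ α (F n)) atTop (𝓝 (weinsteinInf l₁ l₂ α)))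
    {f : E3 → ℂ} {g : Fin 3 → E3 → ℂ} (hf : H1Data f g) (hF : WeakConv F f)
    (hG : ∀ i, WeakConv (fun n => G n i) (g i)) :
    gnFun α (mass f) (gradSq g) (sixth f) ≤ weinsteinInf l₁ l₂ α * N l₁ l₂ f := by
  obtain ⟨S, hS, hSob⟩ := exists_sobolev
  set m := weinsteinInf l₁ l₂ α with hmd
  have hm0 : 0 < m := weinsteinInf_pos hl hα
  set k : ℕ → E3 → ℂ := fun n x => F n x - f x with hk
  set K : ℕ → Fin 3 → E3 → ℂ := fun n i x => G n i x - g i x with hK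
  have hd : ∀ n, H1Data (k n) (K n) := fun n => (h n).sub hf
  set B := 2 + 2 * mass f + 2 * gradSq g with hB
  have hB1 : 0 ≤ B := by
    have := mass_nonneg f
    have := gradSq_nonneg g
    positivity
  have hkm : ∀ n, mass (k n) ≤ B := fun n =>
    (mass_sub_le (h n).memLp hf.memLp).trans (by rw [hm n, hB]; linarith [gradSq_nonneg g])
  have hkg : ∀ n, gradSq (K n) ≤ B := fun n =>
    ((h n).gradSq_sub_le hf).trans (by rw [hg n, hB]; linarith [mass_nonneg f])
  set A := B + S * B ^ 3 + S with hA
  have hSB : 0 ≤ S * B ^ 3 := by positivity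
  have hk6 : ∀ n, sixth (k n) ≤ A := fun n => by
    refine (hSob _ _ (hd n)).trans ?_
    have := mul_le_mul_of_nonneg_left (pow_le_pow_left₀ (gradSq_nonneg _) (hkg n) 3) hS.le
    linarith
  have hF6 : ∀ n, sixth (F n) ≤ A := fun n => by
    have := hSob _ _ (h n)
    rw [hg n] at this
    linarith
  have hkm' : ∀ n, mass (k n) ≤ A := fun n => (hkm n).trans (by linarith)
  have hkg' : ∀ n, gradSq (K n) ≤ A := fun n => (hkg n).trans (by linarith)
  have h0 : WeakConv k 0 := hF.sub (fun n => (h n).memLp) hf.memLp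
  have hFk : ∀ n, (fun x => k n x + f x) = F n := fun n => by funext x; simp [hk]
  -- limits
  have t1 : Tendsto (fun n => mass (k n)) atTop (𝓝 (1 - mass f)) := by
    refine ((hF.tendsto_mass_sub (fun n => (h n).memLp) hf.memLp).const_sub 1).congr fun n => ?_
    rw [hm n, sub_sub_cancel]
  have t2 : Tendsto (fun n => gradSq (K n)) atTop (𝓝 (1 - gradSq g)) := by
    refine ((tendsto_gradSq_sub hG (fun n => (h n).memLp_grad) hf.memLp_grad).const_sub 1).congr
      fun n => ?_
    rw [hg n, sub_sub_cancel]
  have t3 : Tendsto (fun n => N l₁ l₂ (F n) - N l₁ l₂ (k n)) atTop (𝓝 (N l₁ l₂ f)) := by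
    have := tendsto_N_sub hd hkm' hkg' hk6 h0 hf l₁ l₂
    simpa only [hFk] using this
  have t4 := tendsto_weight_cube hd hkm' hkg' hk6 h0 hf.memLp_cube
  -- subsequence along which the sixth powers converge
  obtain ⟨p, -, φ, hφ, hp⟩ := ((isCompact_Icc (a := (0 : ℝ)) (b := A)).prod
    (isCompact_Icc (a := (0 : ℝ)) (b := A))).tendsto_subseq
    (x := fun n => (sixth (F n), sixth (k n)))
    fun n => ⟨⟨sixth_nonneg _, hF6 n⟩, ⟨sixth_nonneg _, hk6 n⟩⟩
  have s1 : Tendsto (fun n => sixth (F (φ n))) atTop (𝓝 p.1) := (continuous_fst.tendsto p).comp hp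
  have s2 : Tendsto (fun n => sixth (k (φ n))) atTop (𝓝 p.2) := (continuous_snd.tendsto p).comp hp
  have hp2 : 0 ≤ p.2 := ge_of_tendsto' s2 fun n => sixth_nonneg _
  -- The cross term vanishes along the sequence at each fixed ε; ε tends to 0 only afterwards.
  have hsup : sixth f + p.2 ≤ p.1 := by
    have hε : ∀ ε : ℝ, 0 < ε → (1 - 12 * ε) * (sixth f + p.2) ≤ p.1 := by
      intro ε hε
      have u1 := ((s2.const_add (sixth f)).const_mul (1 - 12 * ε)).sub
        ((t4.comp hφ.tendsto_atTop).const_mul (24 / ε ^ 2))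
      rw [mul_zero, sub_zero] at u1
      refine le_of_tendsto_of_tendsto' u1 s1 fun n => ?_
      have := sixth_add_ge hf (hd (φ n)) hε
      rwa [hFk] at this
    have ht : Tendsto (fun ε : ℝ => (1 - 12 * ε) * (sixth f + p.2)) (𝓝[>] 0)
        (𝓝 ((1 - 12 * 0) * (sixth f + p.2))) :=
      tendsto_nhdsWithin_of_tendsto_nhds (Continuous.tendsto (by fun_prop) 0)
    have := le_of_tendsto ht (eventually_mem_nhdsWithin.mono fun ε h => hε ε h)
    linarith
  have ha1 : 0 ≤ 1 - mass f := ge_of_tendsto' t1 fun n => mass_nonneg _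
  have hb1 : 0 ≤ 1 - gradSq g := ge_of_tendsto' t2 fun n => gradSq_nonneg _
  -- the limit of `m N(F n)`
  have v1 : Tendsto (fun n => gnFun α 1 1 (sixth (F (φ n)))) atTop (𝓝 (gnFun α 1 1 p.1)) :=
    ((continuous_gnFun hα).tendsto (1, 1, p.1)).comp
      (tendsto_const_nhds.prodMk_nhds (tendsto_const_nhds.prodMk_nhds s1))
  have v2 : Tendsto (fun n => gnFun α (mass (k (φ n))) (gradSq (K (φ n))) (sixth (k (φ n)))) atTop
      (𝓝 (gnFun α (1 - mass f) (1 - gradSq g) p.2)) :=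
    ((continuous_gnFun hα).tendsto (1 - mass f, 1 - gradSq g, p.2)).comp
      ((t1.comp hφ.tendsto_atTop).prodMk_nhds ((t2.comp hφ.tendsto_atTop).prodMk_nhds s2))
  have v3 : Tendsto (fun n => m * N l₁ l₂ (F (φ n))) atTop (𝓝 (gnFun α 1 1 p.1)) := by
    have w1 := ((hW.comp hφ.tendsto_atTop).inv₀ hm0.ne').mul v1
    have w2 := w1.const_mul m
    rw [mul_inv_cancel_left₀ hm0.ne'] at w2
    refine w2.congr fun n => ?_
    have hP : 0 < gnFun α 1 1 (sixth (F (φ n))) :=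
      gnFun_pos one_pos one_pos ((h (φ n)).sixth_pos (hN _))
    simp only [Function.comp_apply]
    rw [(h (φ n)).weinstein_eq hα, hm, hg, inv_div, div_mul_cancel₀ _ hP.ne']
  have v4 : Tendsto (fun n => m * N l₁ l₂ (k (φ n))) atTop
      (𝓝 (gnFun α 1 1 p.1 - m * N l₁ l₂ f)) := by
    refine (v3.sub ((t3.comp hφ.tendsto_atTop).const_mul m)).congr fun n => ?_
    simp only [Function.comp_apply]; ring
  -- The sharp inequality for the remainders, in the limit: gnFun(1, 1, p.1) - m N(f) is at most the
  -- product of what the remainder retains. Superadditivity then leaves at most m N(f) for the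
  -- product of f.
  have v5 := le_of_tendsto_of_tendsto' v4 v2 fun n => (hd (φ n)).weinsteinInf_mul_N_le hl hα
  have v6 := gnFun_superadditive hα (mass_nonneg f) ha1 (gradSq_nonneg g) hb1 (sixth_nonneg f) hp2
    (add_sub_cancel _ _) (add_sub_cancel _ _)
  have v7 : gnFun α 1 1 (sixth f + p.2) ≤ gnFun α 1 1 p.1 := by
    rw [gnFun_one_one, gnFun_one_one]
    exact Real.rpow_le_rpow (add_nonneg (sixth_nonneg f) hp2) hsup (by positivity)
  linarith

/-- A lower bound for the `L⁴` norm along normalized functions with bounded Weinstein quotient. -/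
theorem exists_fourth_lower_bound (hα : 0 < α) {M : ℝ} (hM : 0 < M) :
    ∃ c : ℝ, 0 < c ∧ ∀ f g, H1Data f g → mass f = 1 → gradSq g = 1 → 0 < N l₁ l₂ f →
      weinstein l₁ l₂ α f ≤ M → c ≤ ∫ x, ‖f x‖ ^ 4 := by
  set k := ‖potOp l₁ l₂‖ + 1 with hk
  have hk0 : 0 < k := by positivity
  set d := ((M * k)⁻¹) ^ (2 * (1 + α)) with hd
  have hd0 : 0 < d := by positivity
  refine ⟨d ^ (α / (2 * (1 + α))) / M / k, by positivity, fun f g h hm hg hN hW => ?_⟩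
  have hc := h.sixth_pos hN
  have h1 := h.N_le_sqrt l₁ l₂
  rw [hm, Real.sqrt_one, one_mul] at h1
  have h2 : N l₁ l₂ f ≤ k * √(sixth f) :=
    h1.trans (mul_le_mul_of_nonneg_right (by rw [hk]; linarith) (Real.sqrt_nonneg _))
  rw [h.weinstein_eq hα, hm, hg, gnFun_one_one, div_le_iff₀ hN] at hW
  set θ := α / (2 * (1 + α)) with hθ
  have hθ0 : 0 < θ := by positivity
  have e : (1 / 2 : ℝ) = θ + 1 / (2 * (1 + α)) := by rw [hθ]; field_simp; ring
  -- The bounded quotient gives sixth^θ ≤ M N ≤ M k sixth^{1/2}. Since θ < 1/2, dividing by sixth^θ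
  -- bounds the sixth-power integral from below.
  have h3 : 1 ≤ M * k * sixth f ^ (1 / (2 * (1 + α))) := by
    have h4 : sixth f ^ θ ≤ M * (k * √(sixth f)) := hW.trans (mul_le_mul_of_nonneg_left h2 hM.le)
    rw [Real.sqrt_eq_rpow, e, Real.rpow_add hc] at h4
    have hp : 0 < sixth f ^ θ := by positivity
    refine le_of_mul_le_mul_left ?_ hp
    rw [mul_one]
    refine h4.trans_eq ?_
    ring
  have h5 : d ≤ sixth f := by
    have h6 : (M * k)⁻¹ ≤ sixth f ^ (1 / (2 * (1 + α))) := by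
      rw [inv_le_iff_one_le_mul₀ (by positivity), mul_comm]; exact h3
    have h7 := Real.rpow_le_rpow (by positivity) h6 (by positivity : 0 ≤ 2 * (1 + α))
    rwa [← Real.rpow_mul hc.le, one_div_mul_cancel (by positivity), Real.rpow_one] at h7
  have h8 : d ^ θ ≤ M * N l₁ l₂ f := (Real.rpow_le_rpow hd0.le h5 hθ0.le).trans hW
  have h9 : N l₁ l₂ f ≤ k * ∫ x, ‖f x‖ ^ 4 :=
    (h.N_le l₁ l₂).trans (mul_le_mul_of_nonneg_right (by rw [hk]; linarith)
      (integral_nonneg fun _ => by positivity))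
  rw [div_le_iff₀ hk0, div_le_iff₀ hM]
  calc d ^ θ ≤ M * N l₁ l₂ f := h8
    _ ≤ M * (k * ∫ x, ‖f x‖ ^ 4) := mul_le_mul_of_nonneg_left h9 hM.le
    _ = _ := by ring

theorem avg_affine_zero (η : E3 → ℝ) (f : E3 → ℂ) (v : E3) :
    avg η (affineTrans 1 1 v f) 0 = avg η f v := by
  rw [avg_eq, avg_eq]
  refine integral_congr_ae (ae_of_all _ fun y => ?_)
  simp only [affineTrans, one_smul, zero_sub]
  rw [neg_add_eq_sub]

theorem avg_congr_right {η : E3 → ℝ} {f f' : E3 → ℂ} (h : f =ᵐ[volume] f') (x : E3) :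
    avg η f x = avg η f' x := by
  refine integral_congr_ae ?_
  filter_upwards [h] with z hz
  rw [hz]

theorem mass_eq_zero_iff {f : E3 → ℂ} (hf : MemLp f 2 volume) : mass f = 0 ↔ f =ᵐ[volume] 0 := by
  rw [mass, integral_eq_zero_iff_of_nonneg (fun _ => by positivity)
    (MemLp.integrable_pow (n := 2) two_ne_zero hf)]
  constructor <;> intro h <;> filter_upwards [h] with x hx
  · simpa using hx
  · simp [hx]

theorem sixth_pos_of_mass_pos {f : E3 → ℂ} {g : Fin 3 → E3 → ℂ} (h : H1Data f g)
    (hm : 0 < mass f) : 0 < sixth f := by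
  refine (sixth_nonneg f).lt_of_ne fun h0 => hm.ne' ?_
  rw [mass_eq_zero_iff h.memLp]
  have h1 := h0.symm
  rw [sixth, integral_eq_zero_iff_of_nonneg (fun _ => by positivity) h.integrable_sixth] at h1
  filter_upwards [h1] with x hx
  simpa using hx

/-- The infimum of the Weinstein functional is attained. -/
theorem exists_optimizer (hl : Unstable l₁ l₂) (hα : 0 < α) :
    ∃ f g, H1Data f g ∧ 0 < N l₁ l₂ f ∧ weinstein l₁ l₂ α f = weinsteinInf l₁ l₂ α := by
  set m := weinsteinInf l₁ l₂ α with hmd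
  have hm0 : 0 < m := weinsteinInf_pos hl hα
  have hseq : ∀ n : ℕ, ∃ F G, H1Data F G ∧ mass F = 1 ∧ gradSq G = 1 ∧ 0 < N l₁ l₂ F ∧
      weinstein l₁ l₂ α F < m + 1 / ((n : ℝ) + 1) := by
    intro n
    have hlt : m < m + 1 / ((n : ℝ) + 1) := lt_add_of_pos_right _ (by positivity)
    obtain ⟨_, ⟨f, hf, rfl⟩, hlt'⟩ := exists_lt_of_csInf_lt ((exists_admissible hl).image _) hlt
    obtain ⟨F, G, hFG, h1, h2, h3, h4⟩ := hf.1.h1Data.exists_normalized hα hf.2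
    exact ⟨F, G, hFG, h1, h2, h3, by rw [h4]; exact hlt'⟩
  choose F0 G0 h0 hm0' hg0 hN0 hW0 using hseq
  have hWle : ∀ n, weinstein l₁ l₂ α (F0 n) ≤ m + 1 := fun n => by
    refine (hW0 n).le.trans (add_le_add le_rfl ?_)
    rw [div_le_one (by positivity)]
    linarith [(Nat.cast_nonneg n : (0 : ℝ) ≤ n)]
  obtain ⟨c, hc, hc4⟩ := exists_fourth_lower_bound (l₁ := l₁) (l₂ := l₂) hα
    (by positivity : 0 < m + 1)
  obtain ⟨S, hS, hSob⟩ := exists_sobolev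
  obtain ⟨η, hη, d, hd, hlow⟩ := exists_avg_lower_bound (A := 1 + S) (by positivity) hc
  have hex : ∀ n, ∃ x, d ≤ ‖avg η (F0 n) x‖ := fun n => by
    refine hlow (F0 n) (G0 n) (h0 n) (by rw [hm0' n]; linarith) (by rw [hg0 n]; linarith) ?_
      (hc4 _ _ (h0 n) (hm0' n) (hg0 n) (hN0 n) (hWle n))
    have := hSob _ _ (h0 n)
    rw [hg0 n] at this
    linarith
  choose v hv using hex
  -- Recentring places the non-small average at the origin, where evaluating the average is a weakly
  -- continuous functional; the weak limit is therefore nonzero.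
  set F := fun n => affineTrans 1 1 (v n) (F0 n) with hF
  set G := fun n i => affineTrans (1 * 1) 1 (v n) (G0 n i) with hG
  have hd1 : ∀ n, H1Data (F n) (G n) := fun n => (h0 n).affine 1 one_pos (v n)
  have hFm : ∀ n, mass (F n) = 1 := fun n => by
    rw [hF, mass_affine _ _ one_pos, hm0' n]; norm_num
  have hFg : ∀ n, gradSq (G n) = 1 := fun n => by
    rw [hG, gradSq_affine _ _ one_pos, hg0 n]; norm_num
  have hFN : ∀ n, 0 < N l₁ l₂ (F n) := fun n => (h0 n).N_affine_pos (hN0 n) one_pos one_pos _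
  have hFW : Tendsto (fun n => weinstein l₁ l₂ α (F n)) atTop (𝓝 m) := by
    have ht : Tendsto (fun n : ℕ => m + 1 / ((n : ℝ) + 1)) atTop (𝓝 (m + 0)) :=
      tendsto_one_div_add_atTop_nhds_zero_nat.const_add m
    rw [add_zero] at ht
    refine tendsto_of_tendsto_of_tendsto_of_le_of_le tendsto_const_nhds ht (fun n => ?_) fun n => ?_
    · exact weinsteinInf_le hα ⟨(hd1 n).memH1, hFN n⟩
    · exact ((h0 n).weinstein_affine hα one_pos one_pos (v n)).trans_le (hW0 n).le
  obtain ⟨φ, hφ, f, g, hfg, hwf, hwg⟩ := exists_weakConv_h1 hd1 (A := 1) (fun n => (hFm n).le)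
    (fun n => (hFg n).le)
  have hle := gnFun_le_of_weak_limit hl hα (fun n => hd1 (φ n)) (fun n => hFm _) (fun n => hFg _)
    (fun n => hFN _) (hFW.comp hφ.tendsto_atTop) hfg hwf hwg
  have hne : 0 < mass f := by
    refine (mass_nonneg f).lt_of_ne fun hz => ?_
    have hz' := (mass_eq_zero_iff hfg.memLp).mp hz.symm
    have h1 := (hwf.tendsto_avg hη 0).norm
    rw [avg_congr_right hz' 0] at h1
    have h2 : avg η (0 : E3 → ℂ) 0 = 0 := by simp [avg]
    rw [h2, norm_zero] at h1
    have h3 : d ≤ 0 := ge_of_tendsto' h1 fun n => by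
      rw [hF, avg_affine_zero]; exact hv _
    linarith
  have h6 := sixth_pos_of_mass_pos hfg hne
  have hP := gnFun_pos (α := α) hne (hfg.gradSq_pos_of_sixth h6) h6
  -- Admissibility of the limit comes for free: 0 < P(f) ≤ m N(f).
  have hN : 0 < N l₁ l₂ f := by
    by_contra! hcon
    have := mul_nonpos_of_nonneg_of_nonpos hm0.le hcon
    linarith
  refine ⟨f, g, hfg, hN, le_antisymm ?_ (weinsteinInf_le hα ⟨hfg.memH1, hN⟩)⟩
  rw [hfg.weinstein_eq hα, div_le_iff₀ hN]
  exact hle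

end Existence

/-! ### Differentiating integrals of even powers -/

section NormDerivative

/-- `Re (conj u · v)`. -/
def reProd (u v : E3 → ℂ) (x : E3) : ℝ := ((starRingEnd ℂ) (u x) * v x).re

theorem abs_reProd_le (u v : E3 → ℂ) (x : E3) : |reProd u v x| ≤ ‖u x‖ * ‖v x‖ := by
  refine (Complex.abs_re_le_norm _).trans_eq ?_
  rw [norm_mul, RCLike.norm_conj]

theorem norm_add_smul_sq (z w : ℂ) (t : ℝ) : ‖z + t • w‖ ^ 2
    = ‖z‖ ^ 2 + 2 * t * ((starRingEnd ℂ) z * w).re + t ^ 2 * ‖w‖ ^ 2 := by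
  simp only [← Complex.normSq_eq_norm_sq, Complex.normSq_apply, Complex.mul_re, Complex.conj_re,
      Complex.conj_im, Complex.add_re, Complex.add_im, Complex.smul_re, Complex.smul_im, smul_eq_mul]
  ring

theorem aestronglyMeasurable_reProd {u v : E3 → ℂ} (hu : AEStronglyMeasurable u volume)
    (hv : AEStronglyMeasurable v volume) : AEStronglyMeasurable (reProd u v) volume :=
  Complex.continuous_re.comp_aestronglyMeasurable
    ((Complex.continuous_conj.comp_aestronglyMeasurable hu).mul hv)

/-- Differentiation of `∫ |u + t v|^(2(j+1))` at `t = 0`. -/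
theorem hasDerivAt_integral_norm_pow (j : ℕ) {u v : E3 → ℂ}
    (hu : MemLp u ((2 * (j + 1) : ℕ) : ℝ≥0∞) volume)
    (hv : MemLp v ((2 * (j + 1) : ℕ) : ℝ≥0∞) volume) :
    HasDerivAt (fun t : ℝ => ∫ x, ‖u x + t • v x‖ ^ (2 * (j + 1)))
      (2 * (j + 1) * ∫ x, ‖u x‖ ^ (2 * j) * reProd u v x) 0 := by
  set s : E3 → ℝ := fun x => ‖u x‖ + ‖v x‖ with hs
  have hsL : MemLp s ((2 * (j + 1) : ℕ) : ℝ≥0∞) volume := hu.norm.add hv.norm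
  have hsi : Integrable fun x => ‖s x‖ ^ (2 * (j + 1)) := hsL.integrable_norm_pow (by simp)
  have hs0 : ∀ x, 0 ≤ s x := fun x => by positivity
  simp only [Real.norm_of_nonneg (hs0 _)] at hsi
  have hle : ∀ x, ∀ t ∈ Metric.ball (0 : ℝ) 1, ‖u x + t • v x‖ ≤ s x := fun x t ht => by
    rw [mem_ball_zero_iff] at ht
    refine (norm_add_le _ _).trans (add_le_add le_rfl ?_)
    rw [norm_smul]
    exact mul_le_of_le_one_left (norm_nonneg _) ht.le
  have hm : ∀ t : ℝ, AEStronglyMeasurable (fun x => u x + t • v x) volume := fun t =>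
    hu.1.add (hv.1.const_smul t)
  have key := hasDerivAt_integral_of_dominated_loc_of_deriv_le (μ := (volume : Measure E3))
    (F := fun (t : ℝ) x => ‖u x + t • v x‖ ^ (2 * (j + 1)))
    (F' := fun t x => (j + 1 : ℝ) * (‖u x + t • v x‖ ^ 2) ^ j *
      (2 * reProd (fun x => u x + t • v x) v x))
    (x₀ := (0 : ℝ)) (s := Metric.ball (0 : ℝ) 1)
    (bound := fun x => 2 * (j + 1 : ℝ) * s x ^ (2 * (j + 1))) (Metric.ball_mem_nhds _ one_pos)
    (Eventually.of_forall fun t => (hm t).norm.pow _) ?_ ?_ ?_ (hsi.const_mul _) ?_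
  · have h := key.2
    refine h.congr_deriv ?_
    rw [← integral_const_mul]
    refine integral_congr_ae (ae_of_all _ fun x => ?_)
    simp only [reProd, zero_smul, add_zero, ← pow_mul]
    ring
  · simp only [zero_smul, add_zero]
    exact hu.integrable_norm_pow (by simp)
  · exact ((((hm 0).norm.pow 2).pow j).const_mul _).mul
      ((aestronglyMeasurable_reProd (hm 0) hv.1).const_mul 2)
  · refine ae_of_all _ fun x t ht => ?_
    have h1 := hle x t ht
    have h2 : ‖v x‖ ≤ s x := le_add_of_nonneg_left (norm_nonneg _)
    have h3 := abs_reProd_le (fun x => u x + t • v x) v x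
    have h4 : |reProd (fun x => u x + t • v x) v x| ≤ s x * s x :=
      h3.trans (mul_le_mul h1 h2 (norm_nonneg _) (hs0 x))
    rw [norm_mul, norm_mul, norm_mul, Real.norm_of_nonneg (by positivity : (0 : ℝ) ≤ j + 1),
      Real.norm_of_nonneg (by positivity : (0 : ℝ) ≤ 2), norm_pow,
      Real.norm_of_nonneg (sq_nonneg _), Real.norm_eq_abs]
    calc (j + 1 : ℝ) * (‖u x + t • v x‖ ^ 2) ^ j * (2 * |reProd (fun x => u x + t • v x) v x|)
        ≤ (j + 1 : ℝ) * (s x ^ 2) ^ j * (2 * (s x * s x)) := by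
          have := pow_le_pow_left₀ (sq_nonneg _) (pow_le_pow_left₀ (norm_nonneg _) h1 2) j
          gcongr
      _ = _ := by rw [← pow_mul]; ring
  · refine ae_of_all _ fun x t _ => ?_
    -- An even power of the modulus is polynomial in t, so there is no trouble at zeros of u + tv.
    have e : (fun t : ℝ => ‖u x + t • v x‖ ^ (2 * (j + 1))) = fun t =>
        (‖u x‖ ^ 2 + 2 * t * ((starRingEnd ℂ) (u x) * v x).re + t ^ 2 * ‖v x‖ ^ 2) ^ (j + 1) := by
      funext t; rw [pow_mul, norm_add_smul_sq]
    rw [e, norm_add_smul_sq]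
    have hd : HasDerivAt (fun t : ℝ => ‖u x‖ ^ 2 + 2 * t * ((starRingEnd ℂ) (u x) * v x).re
        + t ^ 2 * ‖v x‖ ^ 2) (2 * ((starRingEnd ℂ) (u x) * v x).re + 2 * t * ‖v x‖ ^ 2) t := by
      have h1 := ((hasDerivAt_id t).const_mul 2).mul_const ((starRingEnd ℂ) (u x) * v x).re
      have h2 := ((hasDerivAt_id t).pow 2).mul_const (‖v x‖ ^ 2)
      have h3 := (h1.const_add (‖u x‖ ^ 2)).add h2
      refine h3.congr_deriv ?_
      simp
    have h4 := hd.pow (j + 1)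
    refine h4.congr_deriv ?_
    have e2 : reProd (fun x => u x + t • v x) v x
        = ((starRingEnd ℂ) (u x) * v x).re + t * ‖v x‖ ^ 2 := by
      simp only [reProd, ← Complex.normSq_eq_norm_sq, Complex.normSq_apply, Complex.mul_re,
        Complex.conj_re, Complex.conj_im, Complex.add_re, Complex.add_im, Complex.smul_re,
        Complex.smul_im, smul_eq_mul]
      ring
    rw [e2]
    push_cast
    ring

end NormDerivative

/-! ### The Euler–Lagrange equation -/

section EulerLagrange

variable {l₁ l₂ α : ℝ} {f ψ : E3 → ℂ} {g k : Fin 3 → E3 → ℂ}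

theorem H1Data.perturb (hf : H1Data f g) (hψ : H1Data ψ k) (t : ℝ) :
    H1Data (fun x => f x + t • ψ x) (fun i x => g i x + t • k i x) :=
  hf.add (hψ.const_smul (t : ℂ))

theorem hasDerivAt_mass {u v : E3 → ℂ} (hu : MemLp u 2 volume) (hv : MemLp v 2 volume) :
    HasDerivAt (fun t : ℝ => mass (fun x => u x + t • v x)) (2 * ∫ x, reProd u v x) 0 := by
  have := hasDerivAt_integral_norm_pow 0 (u := u) (v := v) (by exact_mod_cast hu)
    (by exact_mod_cast hv)
  simpa [mass] using this

theorem hasDerivAt_gradSq (hg : ∀ i, MemLp (g i) 2 volume) (hk : ∀ i, MemLp (k i) 2 volume) :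
    HasDerivAt (fun t : ℝ => gradSq (fun i x => g i x + t • k i x))
      (2 * ∑ i, ∫ x, reProd (g i) (k i) x) 0 := by
  rw [Finset.mul_sum]
  exact HasDerivAt.fun_sum fun i _ => hasDerivAt_mass (hg i) (hk i)

theorem hasDerivAt_sixth (hf : H1Data f g) (hψ : H1Data ψ k) :
    HasDerivAt (fun t : ℝ => sixth (fun x => f x + t • ψ x))
      (6 * ∫ x, ‖f x‖ ^ 4 * reProd f ψ x) 0 := by
  have := hasDerivAt_integral_norm_pow 2 (u := f) (v := ψ) (by exact_mod_cast hf.memLp_six)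
    (by exact_mod_cast hψ.memLp_six)
  norm_num at this
  exact this

theorem memLp_reProd (hf : H1Data f g) (hψ : H1Data ψ k) : MemLp (reProd f ψ) 2 volume := by
  refine (hf.memLp_density.add hψ.memLp_density).mono
    (aestronglyMeasurable_reProd hf.memLp.1 hψ.memLp.1) (ae_of_all _ fun x => ?_)
  rw [Real.norm_eq_abs, Real.norm_eq_abs, abs_of_nonneg (a := (density f + density ψ) x)
    (add_nonneg (sq_nonneg _) (sq_nonneg _))]
  refine (abs_reProd_le f ψ x).trans ?_
  simp only [Pi.add_apply, density]
  nlinarith [sq_nonneg (‖f x‖ - ‖ψ x‖), sq_nonneg (‖f x‖), sq_nonneg (‖ψ x‖)]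

theorem rho_perturb (hf : H1Data f g) (hψ : H1Data ψ k) (t : ℝ) :
    (hf.perturb hψ t).rho
      = hf.rho + (2 * t) • (memLp_reProd hf hψ).toLp _ + t ^ 2 • hψ.rho := by
  apply Lp.ext
  filter_upwards [(hf.perturb hψ t).rho_coe, hf.rho_coe, hψ.rho_coe,
    (memLp_reProd hf hψ).coeFn_toLp,
    Lp.coeFn_add (hf.rho + (2 * t) • (memLp_reProd hf hψ).toLp _) (t ^ 2 • hψ.rho),
    Lp.coeFn_add hf.rho ((2 * t) • (memLp_reProd hf hψ).toLp _),
    Lp.coeFn_smul (2 * t) ((memLp_reProd hf hψ).toLp _), Lp.coeFn_smul (t ^ 2) hψ.rho]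
    with x h1 h2 h3 h4 h5 h6 h7 h8
  rw [h1, h5, Pi.add_apply, h6, Pi.add_apply, h7, h8, Pi.smul_apply, Pi.smul_apply, h2, h3, h4,
    density, norm_add_smul_sq]
  rfl

theorem hasDerivAt_quadratic {H : Type*} [NormedAddCommGroup H] [InnerProductSpace ℝ H]
    (V : H →L[ℝ] H) (hV : ∀ u v, inner ℝ (V u) v = inner ℝ u (V v)) (ρ q r : H) :
    HasDerivAt (fun t : ℝ => inner ℝ (V (ρ + (2 * t) • q + t ^ 2 • r)) (ρ + (2 * t) • q + t ^ 2 • r))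
      (4 * inner ℝ (V ρ) q) 0 := by
  have hd : HasDerivAt (fun t : ℝ => ρ + (2 * t) • q + t ^ 2 • r) ((2 : ℝ) • q) 0 := by
    have h1 := ((hasDerivAt_id (0 : ℝ)).const_mul 2).smul_const q
    have h2 := ((hasDerivAt_id (0 : ℝ)).pow 2).smul_const r
    have h3 := (h1.const_add ρ).add h2
    refine h3.congr_deriv ?_
    simp
  have h4 := HasDerivAt.inner ℝ (V.hasFDerivAt.comp_hasDerivAt (0 : ℝ) hd) hd
  refine h4.congr_deriv ?_
  simp only [mul_zero, zero_smul, add_zero, ne_eq, OfNat.ofNat_ne_zero, not_false_eq_true, zero_pow,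
    map_smul, inner_smul_left, inner_smul_right, Function.comp_apply]
  have : inner ℝ (V q) ρ = inner ℝ (V ρ) q := by rw [hV, real_inner_comm]
  rw [this]
  simp
  ring

theorem hasDerivAt_N (hf : H1Data f g) (hψ : H1Data ψ k) (l₁ l₂ : ℝ) :
    HasDerivAt (fun t : ℝ => N l₁ l₂ (fun x => f x + t • ψ x))
      (4 * inner ℝ (potOp l₁ l₂ hf.rho) ((memLp_reProd hf hψ).toLp _)) 0 := by
  have e : (fun t : ℝ => N l₁ l₂ (fun x => f x + t • ψ x)) = fun t =>
      inner ℝ (potOp l₁ l₂ (hf.rho + (2 * t) • (memLp_reProd hf hψ).toLp _ + t ^ 2 • hψ.rho))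
        (hf.rho + (2 * t) • (memLp_reProd hf hψ).toLp _ + t ^ 2 • hψ.rho) := by
    funext t
    rw [(hf.perturb hψ t).N_eq, rho_perturb]
  rw [e]
  exact hasDerivAt_quadratic _ (potOp_symm l₁ l₂) _ _ _

theorem hasDerivAt_gnFun {a b c : ℝ → ℝ} {a' b' c' : ℝ} (ha : HasDerivAt a a' 0)
    (hb : HasDerivAt b b' 0) (hc : HasDerivAt c c' 0) (ha0 : 0 < a 0) (hb0 : 0 < b 0)
    (hc0 : 0 < c 0) : HasDerivAt (fun t => gnFun α (a t) (b t) (c t))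
      (gnFun α (a 0) (b 0) (c 0) * (1 / 2 * a' / a 0 + 3 / (2 * (1 + α)) * b' / b 0
        + α / (2 * (1 + α)) * c' / c 0)) 0 := by
  have h := ((ha.rpow_const (p := 1 / 2) (Or.inl ha0.ne')).mul
    (hb.rpow_const (p := 3 / (2 * (1 + α))) (Or.inl hb0.ne'))).mul
    (hc.rpow_const (p := α / (2 * (1 + α))) (Or.inl hc0.ne'))
  refine h.congr_deriv ?_
  rw [Real.rpow_sub_one ha0.ne', Real.rpow_sub_one hb0.ne', Real.rpow_sub_one hc0.ne', gnFun]
  simp only [Pi.mul_apply]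
  ring

/-- The Euler–Lagrange equation of the Weinstein functional, in weak form. -/
theorem euler_lagrange (hl : Unstable l₁ l₂) (hα : 0 < α) (hf : H1Data f g) (hN : 0 < N l₁ l₂ f)
    (hopt : weinstein l₁ l₂ α f = weinsteinInf l₁ l₂ α) (hψ : H1Data ψ k) :
    (∑ i, ∫ x, reProd (g i) (k i) x)
      + α * gradSq g / sixth f * (∫ x, ‖f x‖ ^ 4 * reProd f ψ x)
      + (1 + α) * gradSq g / (3 * mass f) * (∫ x, reProd f ψ x)
      = 4 * (1 + α) * gradSq g / (3 * N l₁ l₂ f)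
        * inner ℝ (potOp l₁ l₂ hf.rho) ((memLp_reProd hf hψ).toLp _) := by
  have ha := hf.mass_pos hN
  have hc := hf.sixth_pos hN
  have hb := hf.gradSq_pos_of_sixth hc
  set m := weinsteinInf l₁ l₂ α with hm
  have hm0 : 0 < m := weinsteinInf_pos hl hα
  have hP : gnFun α (mass f) (gradSq g) (sixth f) = m * N l₁ l₂ f := by
    rw [← hopt, hf.weinstein_eq hα, div_mul_cancel₀ _ hN.ne']
  have hd := (hasDerivAt_gnFun (α := α) (hasDerivAt_mass hf.memLp hψ.memLp)
    (hasDerivAt_gradSq hf.memLp_grad hψ.memLp_grad) (hasDerivAt_sixth hf hψ)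
    (by simpa using ha) (by simpa using hb) (by simpa using hc)).sub
    ((hasDerivAt_N hf hψ l₁ l₂).const_mul m)
  -- Minimizing P - mN instead of P/N avoids checking that perturbations stay admissible.
  have hmin : IsLocalMin ((fun t : ℝ => gnFun α (mass fun x => f x + t • ψ x)
      (gradSq fun i x => g i x + t • k i x) (sixth fun x => f x + t • ψ x))
      - fun t : ℝ => m * N l₁ l₂ fun x => f x + t • ψ x) 0 := by
    refine Eventually.of_forall fun t => ?_
    have h1 := (hf.perturb hψ t).weinsteinInf_mul_N_le hl hα
    simp only [Pi.sub_apply, zero_smul, add_zero]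
    rw [hP, sub_self]
    exact sub_nonneg.mpr h1
  have h0 := hmin.hasDerivAt_eq_zero hd
  simp only [zero_smul, add_zero] at h0
  rw [hP] at h0
  set A1 := ∫ x, reProd f ψ x
  set B1 := ∑ i, ∫ x, reProd (g i) (k i) x
  set C1 := ∫ x, ‖f x‖ ^ 4 * reProd f ψ x
  set I := inner ℝ (potOp l₁ l₂ hf.rho) ((memLp_reProd hf hψ).toLp _)
  set a := mass f
  set b := gradSq g
  set c := sixth f
  set n := N l₁ l₂ f
  have h1 : n * (1 / 2 * (2 * A1) / a + 3 / (2 * (1 + α)) * (2 * B1) / b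
      + α / (2 * (1 + α)) * (6 * C1) / c) - 4 * I = 0 := by
    have : m * (n * (1 / 2 * (2 * A1) / a + 3 / (2 * (1 + α)) * (2 * B1) / b
      + α / (2 * (1 + α)) * (6 * C1) / c) - 4 * I) = 0 := by rw [← h0]; ring
    exact (mul_eq_zero.mp this).resolve_left hm0.ne'
  have h2 : I = n / 4 * (1 / 2 * (2 * A1) / a + 3 / (2 * (1 + α)) * (2 * B1) / b
      + α / (2 * (1 + α)) * (6 * C1) / c) := by linarith
  rw [h2]
  field_simp
  ring

end EulerLagrange

/-! ### The modulus of an H¹ function -/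

section Modulus

theorem WeakConv.mass_le {F : ℕ → E3 → ℂ} {f : E3 → ℂ} (h : WeakConv F f)
    (hF : ∀ n, MemLp (F n) 2 volume) (hf : MemLp f 2 volume) {A : ℝ} (hA : ∀ n, mass (F n) ≤ A) :
    mass f ≤ A :=
  le_of_tendsto' (h.tendsto_mass_sub hF hf) fun n =>
    (sub_le_self _ (mass_nonneg _)).trans (hA n)

theorem IsTest.exists_zero_outside {φ : E3 → ℝ} (hφ : IsTest φ) :
    ∃ R : ℝ, ∀ x, R < ‖x‖ → φ x = 0 := by
  obtain ⟨R, hR⟩ := hφ.2.isCompact.isBounded.subset_closedBall 0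
  refine ⟨R, fun x hx => image_eq_zero_of_notMem_tsupport fun hmem => ?_⟩
  have := hR hmem
  rw [mem_closedBall_zero_iff] at this
  linarith

/-- Difference quotients of a test function converge against an `L²` function. -/
theorem tendsto_integral_diffQuot {φ : E3 → ℝ} (hφ : IsTest φ) {u : E3 → ℂ}
    (hu : MemLp u 2 volume) (i : Fin 3) :
    Tendsto (fun t : ℝ => ∫ x, (t⁻¹ * (φ (x - t • ee i) - φ x)) • u x) (𝓝[>] 0)
      (𝓝 (∫ x, (-partialD i φ x) • u x)) := by
  obtain ⟨L, hL⟩ := hφ.1.lipschitzWith_of_hasCompactSupport hφ.2 (by simp)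
  obtain ⟨R, hR⟩ := hφ.exists_zero_outside
  have he : ‖(ee i : E3)‖ = 1 := by simp [ee]
  have hint : Integrable (fun x => (L : ℝ) * (Metric.closedBall (0 : E3) (R + 1)).indicator
      (fun x => ‖u x‖) x) := by
    refine Integrable.const_mul ?_ _
    rw [integrable_indicator_iff measurableSet_closedBall]
    exact ((MemLp.locInt hu).integrableOn_isCompact (isCompact_closedBall _ _)).norm
  have hsmall : ∀ᶠ t : ℝ in 𝓝[>] 0, 0 < t ∧ t < 1 := by
    filter_upwards [Ioo_mem_nhdsGT (zero_lt_one' ℝ)] with t ht using ht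
  refine tendsto_integral_filter_of_dominated_convergence _ ?_ ?_ hint ?_
  · refine Eventually.of_forall fun t => ?_
    have : Continuous fun x : E3 => t⁻¹ * (φ (x - t • ee i) - φ x) := by
      have := hφ.continuous
      fun_prop
    exact this.aestronglyMeasurable.smul hu.1
  · filter_upwards [hsmall] with t ht
    refine ae_of_all _ fun x => ?_
    rw [norm_smul]
    by_cases hx : x ∈ Metric.closedBall (0 : E3) (R + 1)
    · rw [Set.indicator_of_mem hx]
      refine mul_le_mul_of_nonneg_right ?_ (norm_nonneg _)
      have h1 := hL.dist_le_mul (x - t • ee i) x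
      rw [dist_eq_norm, dist_eq_norm, sub_sub_cancel_left, norm_neg, norm_smul, he, mul_one,
        Real.norm_of_nonneg ht.1.le] at h1
      rw [norm_mul, norm_inv, Real.norm_of_nonneg ht.1.le, inv_mul_le_iff₀ ht.1, mul_comm]
      exact h1
    · rw [Set.indicator_of_notMem hx, mul_zero]
      rw [mem_closedBall_zero_iff, not_le] at hx
      have h1 : φ x = 0 := hR x (by linarith)
      have h2 : φ (x - t • ee i) = 0 := by
        refine hR _ ?_
        have h3 := norm_sub_norm_le x (t • ee i)
        rw [norm_smul, he, mul_one, Real.norm_of_nonneg ht.1.le] at h3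
        linarith [ht.2]
      rw [h1, h2]; simp
  · refine ae_of_all _ fun x => ?_
    have h1 : HasDerivAt (fun t : ℝ => φ (x - t • ee i)) (-partialD i φ x) 0 := by
      have h2 : HasDerivAt (fun t : ℝ => x - t • (ee i : E3)) (-(ee i)) 0 := by
        have := ((hasDerivAt_id (0 : ℝ)).smul_const (ee i : E3)).const_sub x
        simpa using this
      have h3 : HasFDerivAt φ (fderiv ℝ φ x) (x - (0 : ℝ) • (ee i : E3)) := by
        rw [zero_smul, sub_zero]; exact (hφ.differentiable x).hasFDerivAt
      have h4 := h3.comp_hasDerivAt (0 : ℝ) h2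
      rw [map_neg] at h4
      exact h4
    have h2 := h1.tendsto_slope_zero_right
    simp only [zero_add, zero_smul, sub_zero, smul_eq_mul] at h2
    exact h2.smul_const (u x)

/-- The reverse triangle inequality passes from |f| to f, and the translation estimate along one
coordinate direction does the rest. -/
theorem H1Data.mass_diffQuot_le {f : E3 → ℂ} {g : Fin 3 → E3 → ℂ} (h : H1Data f g) (i : Fin 3)
    {t : ℝ} (ht : 0 < t) :
    mass (fun x => t⁻¹ • ((‖f (x + t • ee i)‖ : ℂ) - (‖f x‖ : ℂ))) ≤ mass (g i) := by
  have hT : MemLp (fun x => f (x + t • ee i)) 2 volume :=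
    h.memLp.comp_measurePreserving (measurePreserving_add_right volume (t • ee i))
  have h1 := eLpNorm_translation_le h.memLp h.memLp_grad h.weak (t • ee i)
  have e : (fun x => ∑ j, (t • ee i : E3) j • g j x) = fun x => t • g i x := by
    funext x
    rw [Finset.sum_eq_single i]
    · simp [ee]
    · intro j _ hj; simp [ee, hj]
    · simp
  rw [e] at h1
  have h2 := integral_sq_le_of_eLpNorm_le (f := fun x => f (x + t • ee i) - f x)
    (hT.sub h.memLp) ((h.memLp_grad i).const_smul t) h1
  simp only [Pi.smul_apply, norm_smul, mul_pow, integral_const_mul, Real.norm_eq_abs, sq_abs] at h2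
  have h3 : mass (fun x => t⁻¹ • ((‖f (x + t • ee i)‖ : ℂ) - (‖f x‖ : ℂ)))
      ≤ (t ^ 2)⁻¹ * ∫ x, ‖f (x + t • ee i) - f x‖ ^ 2 := by
    rw [mass, ← integral_const_mul]
    refine integral_mono ?_ ?_ fun x => ?_
    · exact MemLp.integrable_pow (n := 2) two_ne_zero
        ((hT.norm.ofReal.sub h.memLp.norm.ofReal).const_smul (t⁻¹))
    · exact (MemLp.integrable_pow (n := 2) two_ne_zero (hT.sub h.memLp)).const_mul _
    · simp only [norm_smul, mul_pow, norm_inv, Real.norm_eq_abs, inv_pow, sq_abs]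
      refine mul_le_mul_of_nonneg_left ?_ (by positivity)
      rw [← Complex.ofReal_sub, Complex.norm_real, Real.norm_eq_abs]
      exact pow_le_pow_left₀ (abs_nonneg _) (abs_norm_sub_norm_le _ _) 2
  refine h3.trans ((mul_le_mul_of_nonneg_left h2 (by positivity)).trans_eq ?_)
  rw [← mul_assoc, inv_mul_cancel₀ (by positivity), one_mul]
  rfl

theorem integral_mul_diffQuot (φ : E3 → ℝ) (hφ : IsTest φ) {u : E3 → ℂ} (hu : MemLp u 2 volume)
    (i : Fin 3) (t : ℝ) : ∫ x, (φ x : ℂ) * (t⁻¹ • (u (x + t • ee i) - u x))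
      = ∫ x, (t⁻¹ * (φ (x - t • ee i) - φ x)) • u x := by
  have hT : MemLp (fun x => u (x + t • ee i)) 2 volume :=
    hu.comp_measurePreserving (measurePreserving_add_right volume (t • ee i))
  have hT' : IsTest fun x => φ (x - t • ee i) := by
    simpa [sub_eq_add_neg] using hφ.comp_affine one_ne_zero (-(t • ee i))
  have i1 := hφ.integrable_smul hT
  have i2 := hφ.integrable_smul hu
  have i3 := hT'.integrable_smul hu
  have e1 : ∫ x, φ x • u (x + t • ee i) = ∫ x, φ (x - t • ee i) • u x := by
    rw [← integral_add_right_eq_self (fun x => φ (x - t • ee i) • u x) (t • ee i)]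
    simp
  calc ∫ x, (φ x : ℂ) * (t⁻¹ • (u (x + t • ee i) - u x))
      = ∫ x, t⁻¹ • (φ x • u (x + t • ee i) - φ x • u x) := by
        refine integral_congr_ae (ae_of_all _ fun x => ?_)
        simp only [Complex.real_smul]; ring
    _ = t⁻¹ • ((∫ x, φ (x - t • ee i) • u x) - ∫ x, φ x • u x) := by
        rw [integral_smul, integral_sub i1 i2, e1]
    _ = ∫ x, (t⁻¹ * (φ (x - t • ee i) - φ x)) • u x := by
        rw [← integral_sub i3 i2, ← integral_smul]
        refine integral_congr_ae (ae_of_all _ fun x => ?_)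
        simp only [Complex.real_smul]; push_cast; ring

/-- The modulus of an `H¹` function is in `H¹`, and its gradient is not larger. -/
theorem H1Data.exists_modulus {f : E3 → ℂ} {g : Fin 3 → E3 → ℂ} (h : H1Data f g) :
    ∃ k, H1Data (fun x => (‖f x‖ : ℂ)) k ∧ gradSq k ≤ gradSq g := by
  have hu : MemLp (fun x => (‖f x‖ : ℂ)) 2 volume := h.memLp.norm.ofReal
  have key : ∀ i, ∃ k, MemLp k 2 volume ∧ WeakPD i (fun x => (‖f x‖ : ℂ)) k ∧ mass k ≤ mass (g i) := by
    intro i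
    set t : ℕ → ℝ := fun n => 1 / ((n : ℝ) + 1) with ht
    have ht0 : ∀ n, 0 < t n := fun n => by positivity
    have htl : Tendsto t atTop (𝓝[>] 0) := by
      rw [tendsto_nhdsWithin_iff]
      exact ⟨tendsto_one_div_add_atTop_nhds_zero_nat, Eventually.of_forall ht0⟩
    have hT : ∀ n, MemLp (fun x => (‖f (x + t n • ee i)‖ : ℂ)) 2 volume := fun n =>
      hu.comp_measurePreserving (measurePreserving_add_right volume (t n • ee i))
    have hD : ∀ n, MemLp (fun x => (t n)⁻¹ • ((‖f (x + t n • ee i)‖ : ℂ) - (‖f x‖ : ℂ))) 2 volume :=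
      fun n => ((hT n).sub hu).const_smul (t n)⁻¹
    -- A weak limit of difference quotients of |f| is a weak derivative, and lower semicontinuity
    -- keeps the bound with constant 1.
    obtain ⟨s, hs, k, hk, hw⟩ := exists_weakConv hD fun n => h.mass_diffQuot_le i (ht0 n)
    refine ⟨k, hk, fun φ hφ => ?_, hw.mass_le (fun n => hD _) hk
      fun n => h.mass_diffQuot_le i (ht0 _)⟩
    have h1 := hw (fun x => (φ x : ℂ)) (hφ.memLp 2).ofReal
    have h2 := (tendsto_integral_diffQuot hφ hu i).comp (htl.comp hs.tendsto_atTop)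
    have h3 := tendsto_nhds_unique h1 (h2.congr fun n =>
      (integral_mul_diffQuot φ hφ hu i (t (s n))).symm)
    simp only [neg_smul, integral_neg] at h3
    simp only [Complex.real_smul] at h3 ⊢
    rw [h3, neg_neg]
  choose k hk1 hk2 hk3 using key
  exact ⟨k, ⟨hu, hk1, hk2⟩, Finset.sum_le_sum fun i _ => hk3 i⟩

end Modulus

/-! ### Nonexistence for the equation without potential -/

section Nonexistence

/-- The Laplacian of the n-th cutoff is O(n⁻²) on a ball of volume O(n³). Its L² norm squared is
O(1/n), and Cauchy–Schwarz applies. -/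
theorem tendsto_integral_mul_laplacian_cutoff {χ : ℕ → E3 → ℝ} {M : ℝ}
    (hχ : ∀ n, IsTest (χ n))
    (h2 : ∀ (n : ℕ) i j x, |partialD i (partialD j (χ n)) x| ≤ M / ((n : ℝ) + 1) ^ 2)
    (hz : ∀ (n : ℕ) x, 2 * ((n : ℝ) + 1) < ‖x‖ → χ n x = 0) {u : E3 → ℝ}
    (hu : MemLp u 2 volume) :
    Tendsto (fun n => ∫ x, u x * ∑ i, partialD i (partialD i (χ n)) x) atTop (𝓝 0) := by
  set v := (volume : Measure E3).real (Metric.ball 0 1) with hv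
  set a := ∫ x, ‖u x‖ ^ 2 with ha
  have ha0 : 0 ≤ a := integral_nonneg fun _ => by positivity
  have hL : ∀ n, IsTest fun x => ∑ i, partialD i (partialD i (χ n)) x := fun n =>
    IsTest.sum _ fun i _ => ((hχ n).partialD i).partialD i
  have hbd : ∀ n : ℕ, ∫ x, ‖∑ i, partialD i (partialD i (χ n)) x‖ ^ 2
      ≤ 72 * M ^ 2 * v * (1 / ((n : ℝ) + 1)) := by
    intro n
    set r : ℝ := (n : ℝ) + 1 with hr
    have hr0 : 0 < r := by positivity
    have e1 : (volume : Measure E3).real (Metric.closedBall 0 (2 * r)) = (2 * r) ^ 3 * v := by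
      rw [Measure.real, Measure.addHaar_closedBall _ _ (by positivity), ENNReal.toReal_mul,
        ENNReal.toReal_ofReal (by positivity), finrank_euclideanSpace_fin]
      rfl
    have i1 : Integrable ((Metric.closedBall (0 : E3) (2 * r)).indicator
        fun _ => (3 * (M / r ^ 2)) ^ 2) :=
      (integrable_indicator_iff measurableSet_closedBall).mpr
        (integrableOn_const (measure_closedBall_lt_top.ne))
    calc ∫ x, ‖∑ i, partialD i (partialD i (χ n)) x‖ ^ 2
        ≤ ∫ x, (Metric.closedBall (0 : E3) (2 * r)).indicator
            (fun _ => (3 * (M / r ^ 2)) ^ 2) x := by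
          refine integral_mono (MemLp.integrable_pow (n := 2) two_ne_zero ((hL n).memLp 2)) i1
            fun x => ?_
          by_cases hx : x ∈ Metric.closedBall (0 : E3) (2 * r)
          · rw [Set.indicator_of_mem hx]
            refine pow_le_pow_left₀ (norm_nonneg _) ((norm_sum_le _ _).trans ?_) 2
            refine (Finset.sum_le_sum fun i _ => h2 n i i x).trans_eq ?_
            simp only [Finset.sum_const, Finset.card_univ, Fintype.card_fin, nsmul_eq_mul]
            norm_num [hr]
          · rw [Set.indicator_of_notMem hx]
            rw [mem_closedBall_zero_iff, not_le] at hx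
            have : ∀ i, partialD i (partialD i (χ n)) x = 0 := fun i =>
              partialD_eq_zero_of_norm_gt (r := 2 * r)
                (fun y hy => partialD_eq_zero_of_norm_gt (hz n) i hy) i hx
            simp [this]
      _ = (2 * r) ^ 3 * v * (3 * (M / r ^ 2)) ^ 2 := by
          rw [integral_indicator measurableSet_closedBall, setIntegral_const, e1, smul_eq_mul]
      _ = 72 * M ^ 2 * v * (1 / r) := by field_simp; ring
  have h0 : Tendsto (fun n : ℕ => √a * √(72 * M ^ 2 * v * (1 / ((n : ℝ) + 1)))) atTop (𝓝 0) := by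
    have h1 := (tendsto_one_div_add_atTop_nhds_zero_nat (𝕜 := ℝ)).const_mul (72 * M ^ 2 * v)
    have h3 := ((Real.continuous_sqrt.tendsto _).comp h1).const_mul (√a)
    simpa using h3
  refine squeeze_zero_norm (fun n => ?_) h0
  refine (norm_integral_le_integral_norm _).trans ?_
  simp only [norm_mul]
  exact (integral_norm_mul_le hu ((hL n).memLp 2)).trans
    (mul_le_mul_of_nonneg_left (Real.sqrt_le_sqrt (hbd n)) (Real.sqrt_nonneg _))

/-- There is no nonnegative `H¹` solution of `-Δu = K u - s u⁵` with `K ∫ u² > s ∫ u⁶`. -/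
theorem not_exists_nonneg_solution {u : E3 → ℝ} {k : Fin 3 → E3 → ℂ} (hu0 : ∀ x, 0 ≤ u x)
    (h : H1Data (fun x => (u x : ℂ)) k) {K s : ℝ} (hK : 0 < K) (hs : 0 < s)
    (hpos : s * sixth (fun x => (u x : ℂ)) < K * mass (fun x => (u x : ℂ)))
    (heq : ∀ φ, IsTest φ → ∑ i, ∫ x, (k i x).re * partialD i φ x
      = ∫ x, (K * u x - s * u x ^ 5) * φ x) : False := by
  obtain ⟨χ, M, -, hχ, hχ0, hχ1, hχe, -, hχ2, hχz⟩ := exists_cutoff_seq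
  have huL : MemLp u 2 volume := by
    simpa using h.memLp.re
  have hlap : ∀ φ, IsTest φ → ∑ i, ∫ x, (k i x).re * partialD i φ x
      = - ∫ x, u x * ∑ i, partialD i (partialD i φ) x := by
    intro φ hφ
    have h1 : ∀ i, ∫ x, (k i x).re * partialD i φ x = - ∫ x, u x * partialD i (partialD i φ) x := by
      intro i
      have h2 := congrArg Complex.re (h.weak i _ (hφ.partialD i))
      have i1 := ((hφ.partialD i).partialD i).integrable_smul h.memLp
      have i2 := (hφ.partialD i).integrable_smul (h.memLp_grad i)
      rw [Complex.neg_re] at h2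
      have r1 := integral_re (𝕜 := ℂ) i1
      have r2 := integral_re (𝕜 := ℂ) i2
      simp only [RCLike.re_eq_complex_re] at r1 r2
      rw [← r1, ← r2] at h2
      simp only [Complex.real_smul, ← Complex.ofReal_mul, Complex.ofReal_re,
        Complex.re_ofReal_mul] at h2
      simp only [mul_comm] at h2 ⊢
      rw [h2, neg_neg]
    rw [Finset.sum_congr rfl fun i _ => h1 i, Finset.sum_neg_distrib, ← integral_finsetSum]
    · simp only [Finset.mul_sum]
    · intro i _
      exact huL.integrable_mul (((hφ.partialD i).partialD i).memLp 2)
  set W : E3 → ℝ := fun x => K * u x - s * u x ^ 5 with hW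
  have hne : ∀ x, ‖((u x : ℝ) : ℂ)‖ = u x := fun x => by
    rw [Complex.norm_real, Real.norm_of_nonneg (hu0 x)]
  have j2 : Integrable fun x => u x ^ 2 := by simpa only [hne] using h.integrable_sq
  have j6 : Integrable fun x => u x ^ 6 := by simpa only [hne] using h.integrable_sixth
  have jWu : Integrable fun x => W x * u x := by
    refine ((j2.const_mul K).sub (j6.const_mul s)).congr (ae_of_all _ fun x => ?_)
    simp only [hW, Pi.sub_apply]; ring
  have eWu : ∫ x, W x * u x = K * mass (fun x => (u x : ℂ)) - s * sixth (fun x => (u x : ℂ)) := by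
    simp only [mass, sixth, hne]
    rw [← integral_const_mul, ← integral_const_mul, ← integral_sub (j2.const_mul K) (j6.const_mul s)]
    refine integral_congr_ae (ae_of_all _ fun x => ?_)
    simp only [hW]; ring
  have jW : ∀ φ, IsTest φ → Integrable fun x => W x * φ x := by
    intro φ hφ
    obtain ⟨C, hC0, hC⟩ := hφ.bounded
    have i5 : Integrable fun x => u x ^ 5 := by
      refine (h.memLp_density.integrable_mul h.memLp_cube).congr (ae_of_all _ fun x => ?_)
      simp only [Pi.mul_apply, density, hne]; ring
    have i1 : Integrable fun x => K * (u x * φ x) := (huL.integrable_mul (hφ.memLp 2)).const_mul K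
    have i2 : Integrable fun x => s * (u x ^ 5 * φ x) :=
      (i5.mul_bdd hφ.continuous.aestronglyMeasurable (ae_of_all _ hC)).const_mul s
    refine (i1.sub i2).congr (ae_of_all _ fun x => ?_)
    simp only [hW, Pi.sub_apply]; ring
  -- The value at which Ku - su⁵ changes sign, so (τ - u)W ≥ 0 pointwise. Integrated against
  -- cutoffs, τW contributes 0 in the limit by the equation, which forces ∫Wu ≤ 0 and contradicts
  -- `hpos`.
  set τ := (K / s) ^ (1 / 4 : ℝ) with hτ
  have hτ0 : 0 ≤ τ := by positivity
  have hτ4 : τ ^ 4 = K / s := by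
    rw [hτ, ← Real.rpow_mul_natCast (by positivity)]; norm_num
  have hKτ : K = s * τ ^ 4 := by rw [hτ4]; field_simp
  have hle : ∀ x, W x * u x ≤ τ * W x := by
    intro x
    have e : τ * W x - W x * u x = s * u x * ((τ - u x) ^ 2 * ((τ + u x) * (τ ^ 2 + u x ^ 2))) := by
      simp only [hW]; rw [hKτ]; ring
    have := hu0 x
    have : 0 ≤ s * u x * ((τ - u x) ^ 2 * ((τ + u x) * (τ ^ 2 + u x ^ 2))) := by positivity
    linarith
  have t1 : Tendsto (fun n => τ * ∫ x, W x * χ n x) atTop (𝓝 0) := by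
    have h1 := ((tendsto_integral_mul_laplacian_cutoff hχ hχ2 hχz huL).neg).const_mul τ
    rw [neg_zero, mul_zero] at h1
    refine h1.congr fun n => ?_
    rw [← heq _ (hχ n), hlap _ (hχ n)]
  have t2 : Tendsto (fun n => ∫ x, W x * u x * χ n x) atTop (𝓝 (∫ x, W x * u x)) := by
    refine tendsto_integral_of_dominated_convergence (fun x => ‖W x * u x‖) (fun n => ?_) jWu.norm
      (fun n => ae_of_all _ fun x => ?_) (ae_of_all _ fun x => ?_)
    · exact jWu.1.mul (hχ n).continuous.aestronglyMeasurable
    · rw [norm_mul, Real.norm_of_nonneg (hχ0 n x)]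
      exact mul_le_of_le_one_right (norm_nonneg _) (hχ1 n x)
    · refine tendsto_const_nhds.congr' ?_
      obtain ⟨m, hm⟩ := exists_nat_ge ‖x‖
      filter_upwards [eventually_ge_atTop m] with n hn
      rw [hχe n x, mul_one]
      have : (m : ℝ) ≤ n := by exact_mod_cast hn
      linarith
  have hfin := le_of_tendsto_of_tendsto' t2 t1 fun n => by
    rw [← integral_const_mul]
    refine integral_mono (jWu.mul_bdd (hχ n).continuous.aestronglyMeasurable (c := 1)
      (ae_of_all _ fun x => by rw [Real.norm_of_nonneg (hχ0 n x)]; exact hχ1 n x))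
      ((jW _ (hχ n)).const_mul τ) fun x => ?_
    have := mul_le_mul_of_nonneg_right (hle x) (hχ0 n x)
    change W x * u x * χ n x ≤ τ * (W x * χ n x)
    linarith
  rw [eWu] at hfin
  linarith

end Nonexistence

/-! ### The weak equation against test functions -/

section WeakEquation

variable {l₁ l₂ α : ℝ} {f : E3 → ℂ} {g : Fin 3 → E3 → ℂ}

theorem H1Data.dipoleConv_ae (h : H1Data f g) :
    dipoleConv (density f) =ᵐ[volume] dipoleOp h.rho := dipoleConv_ae_eq h.memLp_density

theorem H1Data.memLp_dipoleConv (h : H1Data f g) : MemLp (dipoleConv (density f)) 2 volume :=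
  (memLp_congr_ae h.dipoleConv_ae).mpr (Lp.memLp _)

theorem H1Data.potOp_ae (h : H1Data f g) (l₁ l₂ : ℝ) : potOp l₁ l₂ h.rho =ᵐ[volume]
    fun x => -(l₁ * density f x + l₂ * dipoleConv (density f) x) := by
  rw [potOp_apply]
  filter_upwards [Lp.coeFn_sub (-(l₁ • h.rho)) (l₂ • dipoleOp h.rho), Lp.coeFn_neg (l₁ • h.rho),
    Lp.coeFn_smul l₁ h.rho, Lp.coeFn_smul l₂ (dipoleOp h.rho), h.rho_coe, h.dipoleConv_ae]
    with x h1 h2 h3 h4 h5 h6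
  rw [h1, Pi.sub_apply, h2, Pi.neg_apply, h3, h4, Pi.smul_apply, Pi.smul_apply, h5, ← h6,
    smul_eq_mul, smul_eq_mul]
  ring

theorem H1Data.inner_potOp_toLp (h : H1Data f g) (l₁ l₂ : ℝ) {q : E3 → ℝ} (hq : MemLp q 2 volume) :
    inner ℝ (potOp l₁ l₂ h.rho) (hq.toLp q)
      = - ∫ x, (l₁ * density f x + l₂ * dipoleConv (density f) x) * q x := by
  rw [L2.inner_def, ← integral_neg]
  refine integral_congr_ae ?_
  filter_upwards [h.potOp_ae l₁ l₂, hq.coeFn_toLp] with x h1 h2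
  rw [h1, h2]
  simp only [RCLike.inner_apply, conj_trivial]
  ring

theorem H1Data.integrable_fifth_mul (h : H1Data f g) {φ : E3 → ℝ} (hφ : IsTest φ) :
    Integrable fun x => ‖f x‖ ^ 5 * φ x := by
  obtain ⟨C, hC0, hC⟩ := hφ.bounded
  have i5 : Integrable fun x => ‖f x‖ ^ 5 := by
    refine (h.memLp_density.integrable_mul h.memLp_cube).congr (ae_of_all _ fun x => ?_)
    simp only [Pi.mul_apply, density]; ring
  exact i5.mul_bdd hφ.continuous.aestronglyMeasurable (ae_of_all _ hC)

/-- The complex multiple `c φ` of a test function. -/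
theorem IsTest.h1Data_smul {φ : E3 → ℝ} (hφ : IsTest φ) (c : ℂ) :
    H1Data (fun x => c • (φ x : ℂ)) (fun i x => c • (DipolarNLS.partialD i φ x : ℂ)) :=
  hφ.h1Data.const_smul c

theorem reProd_smul (u : E3 → ℂ) (c : ℂ) (φ : E3 → ℝ) (x : E3) :
    reProd u (fun x => c • (φ x : ℂ)) x = ((starRingEnd ℂ) c * (u x * (φ x : ℂ))).re := by
  simp only [reProd, smul_eq_mul, Complex.mul_re, Complex.mul_im, Complex.conj_re, Complex.conj_im,
    Complex.ofReal_re, Complex.ofReal_im]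
  ring

theorem integral_re_conj_mul {F : E3 → ℂ} (hF : Integrable F) (c : ℂ) :
    ∫ x, ((starRingEnd ℂ) c * F x).re = ((starRingEnd ℂ) c * ∫ x, F x).re := by
  rw [← integral_const_mul]
  exact integral_re (hF.const_mul _)

theorem integrable_mul_test {u : E3 → ℂ} (hu : MemLp u 2 volume) {φ : E3 → ℝ} (hφ : IsTest φ) :
    Integrable fun x => u x * (φ x : ℂ) :=
  integrable_mul_complex hu (hφ.memLp 2).ofReal

theorem H1Data.integrable_potential (h : H1Data f g) (c₁ c₂ s w : ℝ) {φ : E3 → ℝ}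
    (hφ : IsTest φ) : Integrable fun x =>
      ((c₁ * density f x + c₂ * dipoleConv (density f) x + s * density f x ^ 2 + w : ℝ) : ℂ)
        * f x * (φ x : ℂ) := by
  obtain ⟨C, hC0, hC⟩ := hφ.bounded
  have hφ' : ∀ {F : E3 → ℂ}, Integrable F → Integrable fun x => F x * (φ x : ℂ) := fun hF =>
    hF.mul_bdd (Complex.continuous_ofReal.comp hφ.continuous).aestronglyMeasurable
      (c := C) (ae_of_all _ fun x => by
        simp only [Complex.norm_real]; exact hC x)
  have hdf : MemLp (fun x => (density f x : ℂ) * f x) 2 volume := by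
    refine h.memLp_cube.congr_norm (h.memLp_density.ofReal.1.mul h.memLp.1)
      (ae_of_all _ fun x => ?_)
    simp only [norm_mul, Complex.norm_real, norm_pow, norm_norm, density]
    ring
  have i1 : Integrable fun x => (density f x : ℂ) * f x :=
    integrable_mul_complex h.memLp_density.ofReal h.memLp
  have i2 : Integrable fun x => (dipoleConv (density f) x : ℂ) * f x :=
    integrable_mul_complex h.memLp_dipoleConv.ofReal h.memLp
  have i3 : Integrable fun x => (density f x : ℂ) * ((density f x : ℂ) * f x) :=
    integrable_mul_complex h.memLp_density.ofReal hdf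
  have i4 := integrable_mul_test h.memLp hφ
  refine ((((hφ' i1).const_mul (c₁ : ℂ)).add ((hφ' i2).const_mul (c₂ : ℂ))).add
    (((hφ' i3).const_mul (s : ℂ)).add (i4.const_mul (w : ℂ)))).congr (ae_of_all _ fun x => ?_)
  simp only [Pi.add_apply]
  push_cast
  ring

/-- The Euler–Lagrange equation tested against smooth functions. -/
theorem euler_lagrange_test (hl : Unstable l₁ l₂) (hα : 0 < α) (hf : H1Data f g)
    (hN : 0 < N l₁ l₂ f) (hopt : weinstein l₁ l₂ α f = weinsteinInf l₁ l₂ α) {B s w : ℝ}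
    (hB : B = 4 * (1 + α) * gradSq g / (3 * N l₁ l₂ f)) (hs : s = α * gradSq g / sixth f)
    (hw : w = (1 + α) * gradSq g / (3 * mass f)) {φ : E3 → ℝ} (hφ : IsTest φ) :
    (∫ x, ∑ i : Fin 3, g i x * (partialD i φ x : ℂ)) +
      ∫ x, ((B * l₁ * density f x + B * l₂ * dipoleConv (density f) x + s * density f x ^ 2 + w : ℝ)
        : ℂ) * f x * (φ x : ℂ) = 0 := by
  have hI := hf.integrable_potential (B * l₁) (B * l₂) s w hφ
  have hG : ∀ i, Integrable fun x => g i x * (partialD i φ x : ℂ) := fun i =>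
    integrable_mul_test (hf.memLp_grad i) (hφ.partialD i)
  set T := (∫ x, ∑ i : Fin 3, g i x * (partialD i φ x : ℂ)) +
      ∫ x, ((B * l₁ * density f x + B * l₂ * dipoleConv (density f) x + s * density f x ^ 2 + w : ℝ)
        : ℂ) * f x * (φ x : ℂ) with hT
  -- The variation in a single direction sees only a real part. Complex multiples of φ recover the
  -- whole of T, and c = T gives |T|² = 0.
  have key : ∀ c : ℂ, ((starRingEnd ℂ) c * T).re = 0 := by
    intro c
    have hψ := hφ.h1Data_smul c
    have hEL := euler_lagrange hl hα hf hN hopt hψ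
    rw [← hB, ← hs, ← hw, hf.inner_potOp_toLp] at hEL
    have hq := memLp_reProd hf hψ
    set q := reProd f fun x => c • (φ x : ℂ) with hqd
    have e1 : ∑ i, ∫ x, reProd (g i) (fun x => c • (partialD i φ x : ℂ)) x
        = ((starRingEnd ℂ) c * ∫ x, ∑ i : Fin 3, g i x * (partialD i φ x : ℂ)).re := by
      rw [integral_finsetSum _ fun i _ => hG i, Finset.mul_sum, Complex.re_sum]
      refine Finset.sum_congr rfl fun i _ => ?_
      rw [← integral_re_conj_mul (hG i)]
      simp only [reProd_smul]
    have iq : Integrable q := by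
      refine ((integrable_mul_test hf.memLp hφ).const_mul ((starRingEnd ℂ) c)).re.congr
        (ae_of_all _ fun x => ?_)
      exact (reProd_smul f c φ x).symm
    have i4 : Integrable fun x => ‖f x‖ ^ 4 * q x := by
      refine ((hf.integrable_fifth_mul hφ).norm.const_mul ‖c‖).mono'
        ((hf.memLp.1.norm.pow 4).mul hq.1) (ae_of_all _ fun x => ?_)
      have h1 := abs_reProd_le f (fun x => c • (φ x : ℂ)) x
      rw [norm_mul, norm_mul, Real.norm_of_nonneg (by positivity : 0 ≤ ‖f x‖ ^ 4),
        Real.norm_of_nonneg (by positivity : 0 ≤ ‖f x‖ ^ 5), Real.norm_eq_abs]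
      refine (mul_le_mul_of_nonneg_left h1 (by positivity)).trans_eq ?_
      rw [norm_smul, Complex.norm_real]
      ring
    have iV : Integrable fun x => (l₁ * density f x + l₂ * dipoleConv (density f) x) * q x :=
      ((hf.memLp_density.const_mul l₁).add (hf.memLp_dipoleConv.const_mul l₂)).integrable_mul hq
    have e2 : ((starRingEnd ℂ) c * ∫ x, ((B * l₁ * density f x + B * l₂ * dipoleConv (density f) x
          + s * density f x ^ 2 + w : ℝ) : ℂ) * f x * (φ x : ℂ)).re
        = B * (∫ x, (l₁ * density f x + l₂ * dipoleConv (density f) x) * q x)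
          + (s * (∫ x, ‖f x‖ ^ 4 * q x) + w * ∫ x, q x) := by
      rw [← integral_re_conj_mul hI, ← integral_const_mul, ← integral_const_mul,
        ← integral_const_mul, ← integral_add (i4.const_mul s) (iq.const_mul w)]
      have := integral_add (iV.const_mul B) ((i4.const_mul s).add (iq.const_mul w))
      refine Eq.trans ?_ this
      refine integral_congr_ae (ae_of_all _ fun x => ?_)
      simp only [Pi.add_apply]
      rw [hqd, reProd_smul, mul_assoc ((_ : ℝ) : ℂ), mul_left_comm, Complex.re_ofReal_mul, density]
      ring
    rw [hT, mul_add, Complex.add_re, ← e1, e2]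
    linarith
  have h0 := key T
  rw [mul_comm, Complex.mul_conj, Complex.ofReal_re, Complex.normSq_eq_zero] at h0
  exact h0

end WeakEquation

/-! ### Normalized optimizers and the explicit constant -/

section NormalizedOptimizer

variable {l₁ l₂ α : ℝ}

theorem isOptimizer_of_eq {f : E3 → ℂ} {g : Fin 3 → E3 → ℂ} (hα : 0 < α) (h : H1Data f g)
    (hN : 0 < N l₁ l₂ f) (hopt : weinstein l₁ l₂ α f = weinsteinInf l₁ l₂ α) :
    IsOptimizer l₁ l₂ α f := by
  refine ⟨⟨h.memH1, hN⟩, fun u hu => ?_⟩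
  rw [Set.mem_ofPred_eq, hopt]
  exact weinsteinInf_le hα hu

theorem IsOptimizer.weinstein_eq_inf {f : E3 → ℂ} (h : IsOptimizer l₁ l₂ α f) (hα : 0 < α) :
    weinstein l₁ l₂ α f = weinsteinInf l₁ l₂ α := by
  refine le_antisymm (le_csInf ⟨_, f, h.1, rfl⟩ ?_) (weinsteinInf_le hα h.1)
  rintro _ ⟨u, hu, rfl⟩
  exact h.2 hu

/-- The Euler–Lagrange equation has two coefficients to normalize, the cubic and the quintic one,
and scaling has two free parameters; the coefficient of Q is left as the frequency. -/
theorem exists_isNormalizedOptimizer (hl : Unstable l₁ l₂) (hα : 0 < α) :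
    ∃ Q, IsNormalizedOptimizer l₁ l₂ α Q := by
  obtain ⟨f, g, hf, hN, hopt⟩ := exists_optimizer hl hα
  have ha := hf.mass_pos hN
  have hc := hf.sixth_pos hN
  have hb := hf.gradSq_pos_of_sixth hc
  -- The quintic coefficient becomes 1 when κ = μ²σ; given this, the cubic one becomes 1 when μβσ =
  -- 1.
  set σ := √(sixth f / (α * gradSq g)) with hσd
  have hσ : 0 < σ := Real.sqrt_pos.mpr (by positivity)
  have hσ2 : σ ^ 2 = sixth f / (α * gradSq g) := Real.sq_sqrt (by positivity)
  set β := √(4 * (1 + α) * gradSq g / (3 * N l₁ l₂ f)) with hβd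
  have hβ : 0 < β := Real.sqrt_pos.mpr (by positivity)
  have hβ2 : β ^ 2 = 4 * (1 + α) * gradSq g / (3 * N l₁ l₂ f) := Real.sq_sqrt (by positivity)
  set μ := (β * σ)⁻¹ with hμd
  have hμ : 0 < μ := by positivity
  set κ := μ ^ 2 * σ with hκd
  have hκ : 0 < κ := by positivity
  have hQ := hf.affine μ hκ 0
  set Q := affineTrans μ κ 0 f with hQd
  have hQN : 0 < N l₁ l₂ Q := hf.N_affine_pos hN hμ hκ 0
  have hQopt : weinstein l₁ l₂ α Q = weinsteinInf l₁ l₂ α := by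
    rw [hQd, hf.weinstein_affine hα hμ hκ 0, hopt]
  have hQ1 := hQ.memH1.h1Data
  have hgr : gradSq (fun i x => weakGrad Q x i) = μ ^ 2 * κ⁻¹ * gradSq g := by
    rw [← hQ1.normGrad_sq, hQ.normGrad_sq, gradSq_affine g μ hκ]
  have hsix : sixth Q = α * gradSq fun i x => weakGrad Q x i := by
    rw [hgr, hQd, sixth_affine f μ hκ]
    have : sixth f = σ ^ 2 * (α * gradSq g) := by rw [hσ2]; field_simp
    rw [this, hκd]
    field_simp
  have hNQ : 3 * N l₁ l₂ Q = 4 * (1 + α) * gradSq fun i x => weakGrad Q x i := by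
    rw [hgr, hQd, N_affine hf l₁ l₂ μ hκ 0]
    have : 4 * (1 + α) * gradSq g = β ^ 2 * (3 * N l₁ l₂ f) := by rw [hβ2]; field_simp
    have e : 4 * (1 + α) * (μ ^ 2 * κ⁻¹ * gradSq g) = μ ^ 2 * κ⁻¹ * (β ^ 2 * (3 * N l₁ l₂ f)) := by
      rw [← this]; ring
    rw [e, hκd, hμd]
    field_simp
  have hbQ := hQ1.gradSq_pos_of_sixth (hQ1.sixth_pos hQN)
  refine ⟨Q, isOptimizer_of_eq hα hQ hQN hQopt, ⟨(1 + α) * (gradSq fun i x => weakGrad Q x i)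
    / (3 * mass Q), hQ.memH1, fun φ hφ => ?_⟩, ?_⟩
  · have h1 := euler_lagrange_test hl hα hQ1 hQN hQopt (B := 1) (s := 1)
      (by rw [hNQ, div_self (by positivity)]) (by rw [hsix, div_self (by positivity)]) rfl hφ
    simpa only [one_mul] using h1
  · rw [MemLp.normL_six_pow hQ.memLp, hQ1.normGrad_sq, hsix]

theorem H1Data.rho_modulus {f : E3 → ℂ} {g k : Fin 3 → E3 → ℂ} (h : H1Data f g)
    (hu : H1Data (fun x => (‖f x‖ : ℂ)) k) : hu.rho = h.rho := by
  apply Lp.ext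
  filter_upwards [hu.rho_coe, h.rho_coe] with x h1 h2
  rw [h1, h2]
  simp [density]

/-- The potential of an optimizer is not constant on the set where the optimizer is nonzero. -/
theorem potential_not_constant (hl : Unstable l₁ l₂) (hα : 0 < α) {f : E3 → ℂ}
    {g : Fin 3 → E3 → ℂ} (hf : H1Data f g) (hN : 0 < N l₁ l₂ f)
    (hopt : weinstein l₁ l₂ α f = weinsteinInf l₁ l₂ α) {ν : ℝ}
    (hν : ∀ᵐ x, f x ≠ 0 → l₁ * density f x + l₂ * dipoleConv (density f) x = -ν) : False := by
  obtain ⟨k, hu, hk⟩ := hf.exists_modulus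
  set u : E3 → ℝ := fun x => ‖f x‖ with hud
  replace hu : H1Data (fun x => (u x : ℂ)) k := hu
  have hue : ∀ x, ‖((u x : ℝ) : ℂ)‖ = ‖f x‖ := fun x => by simp [hud]
  have hum : mass (fun x => (u x : ℂ)) = mass f := by simp only [mass, hue]
  have hu6 : sixth (fun x => (u x : ℂ)) = sixth f := by simp only [sixth, hue]
  have hρ : hu.rho = hf.rho := hf.rho_modulus hu
  have huN : N l₁ l₂ (fun x => (u x : ℂ)) = N l₁ l₂ f := by rw [hu.N_eq, hf.N_eq, hρ]
  have huN0 : 0 < N l₁ l₂ (fun x => (u x : ℂ)) := by rw [huN]; exact hN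
  have hα1 : 0 ≤ 3 / (2 * (1 + α)) := by positivity
  -- Passing to |f| keeps the density, hence N, the mass and the sixth power, and does not increase
  -- the gradient energy.
  have huopt : weinstein l₁ l₂ α (fun x => (u x : ℂ)) = weinsteinInf l₁ l₂ α := by
    refine le_antisymm ?_ (weinsteinInf_le hα ⟨hu.memH1, huN0⟩)
    rw [← hopt, hu.weinstein_eq hα, hf.weinstein_eq hα, huN, hum, hu6]
    refine div_le_div_of_nonneg_right ?_ hN.le
    have := mass_nonneg f
    have := sixth_nonneg f
    have := Real.rpow_le_rpow (gradSq_nonneg k) hk hα1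
    unfold gnFun
    gcongr
  have ha := hf.mass_pos hN
  have hc := hf.sixth_pos hN
  have hb : 0 < gradSq k := hu.gradSq_pos_of_sixth (hu6 ▸ hc)
  have hinner : ∀ {q : E3 → ℝ} (hq : MemLp q 2 volume), (∀ x, f x = 0 → q x = 0) →
      inner ℝ (potOp l₁ l₂ hf.rho) (hq.toLp q) = ν * ∫ x, q x := by
    intro q hq hq0
    rw [hf.inner_potOp_toLp, ← integral_neg, ← integral_const_mul]
    refine integral_congr_ae ?_
    filter_upwards [hν] with x hx
    by_cases h0 : f x = 0
    · rw [hq0 x h0]; simp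
    · rw [hx h0]; ring
  have hNν : N l₁ l₂ f = ν * mass f := by
    rw [hf.N_eq]
    exact hinner hf.memLp_density fun x hx => by simp [density, hx]
  refine not_exists_nonneg_solution (u := u) (k := k) (fun x => norm_nonneg _) hu
    (K := (1 + α) * gradSq k / mass f) (s := α * gradSq k / sixth f) (by positivity) (by positivity)
    ?_ fun φ hφ => ?_
  -- With these coefficients the required strict inequality reads α‖∇u‖² < (1+α)‖∇u‖².
  · rw [hum, hu6, div_mul_cancel₀ _ hc.ne', div_mul_cancel₀ _ ha.ne']
    linarith
  · have hEL := euler_lagrange hl hα hu huN0 huopt hφ.h1Data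
    have hre : ∀ x, reProd (fun x => (u x : ℂ)) (fun x => (φ x : ℂ)) x = u x * φ x := fun x => by
      simp [reProd]
    have hre' : ∀ i x, reProd (k i) (fun x => (partialD i φ x : ℂ)) x
        = (k i x).re * partialD i φ x := fun i x => by simp [reProd]
    have h5 := hf.integrable_fifth_mul hφ
    have h1 : Integrable fun x => u x * φ x := hf.memLp.norm.integrable_mul (hφ.memLp 2)
    simp only [hρ] at hEL
    rw [hinner _ fun x hx => by rw [hre]; simp [hud, hx]] at hEL
    simp only [hre, hre', hue, hum, hu6, huN, hNν] at hEL
    have e5 : ∀ x, ‖f x‖ ^ 4 * (u x * φ x) = ‖f x‖ ^ 5 * φ x := fun x => by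
      simp only [hud]; ring
    simp only [e5] at hEL
    have hν0 : ν ≠ 0 := fun h0 => by rw [h0, zero_mul] at hNν; exact hN.ne' hNν
    have e6 : ∫ x, ((1 + α) * gradSq k / mass f * u x - α * gradSq k / sixth f * u x ^ 5) * φ x
        = (1 + α) * gradSq k / mass f * (∫ x, u x * φ x)
          - α * gradSq k / sixth f * ∫ x, ‖f x‖ ^ 5 * φ x := by
      rw [← integral_const_mul, ← integral_const_mul,
        ← integral_sub (h1.const_mul _) (h5.const_mul _)]
      refine integral_congr_ae (ae_of_all _ fun x => ?_)
      simp only [hud]; ring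
    rw [e6]
    -- Since N = ν·mass, the constant ν cancels. The potential contributes 4 times the frequency
    -- term, and moving that term across leaves the factor 3 contained in K.
    have e7 : 4 * (1 + α) * gradSq k / (3 * (ν * mass f)) * (ν * ∫ x, u x * φ x)
        = 4 * ((1 + α) * gradSq k / (3 * mass f)) * ∫ x, u x * φ x := by
      field_simp
    rw [e7] at hEL
    have e8 : (1 + α) * gradSq k / mass f = 3 * ((1 + α) * gradSq k / (3 * mass f)) := by
      field_simp
    rw [e8]
    linarith

/-- The claim says that the Euler–Lagrange coefficient B of the cubic terms is 1. Otherwise the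
difference of the two equations solved by Q has no gradient and no quintic term, and it makes the
potential constant wherever Q ≠ 0, contrary to `potential_not_constant`. -/
theorem IsNormalizedOptimizer.N_eq {Q : E3 → ℂ} (hl : Unstable l₁ l₂) (hα : 0 < α)
    (h : IsNormalizedOptimizer l₁ l₂ α Q) :
    3 * N l₁ l₂ Q = 4 * (1 + α) * gradSq fun i x => weakGrad Q x i := by
  obtain ⟨hopt, ⟨w, hH, hsw⟩, h6⟩ := h
  have hQ := hH.h1Data
  have hN := hopt.1.2
  have hinf := hopt.weinstein_eq_inf hα
  rw [MemLp.normL_six_pow hQ.memLp, hQ.normGrad_sq] at h6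
  set b := gradSq fun i x => weakGrad Q x i with hbd
  have hc := hQ.sixth_pos hN
  have hb : 0 < b := hQ.gradSq_pos_of_sixth hc
  by_contra hne
  set B := 4 * (1 + α) * b / (3 * N l₁ l₂ Q) with hB
  have hB1 : B - 1 ≠ 0 := by
    rw [sub_ne_zero, hB, Ne, div_eq_one_iff_eq (by positivity)]
    exact fun h => hne h.symm
  set w' := (1 + α) * b / (3 * mass Q) with hw'
  refine potential_not_constant hl hα hQ hN hinf (ν := (w' - w) / (B - 1)) ?_
  have hI := fun φ hφ => hQ.integrable_potential ((B - 1) * l₁) ((B - 1) * l₂) 0 (w' - w)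
    (φ := φ) hφ
  -- The quintic coefficient is 0 because ‖Q‖₆⁶ = α‖∇Q‖² makes the Euler–Lagrange one equal to 1.
  set Z : E3 → ℂ := fun x => (((B - 1) * l₁ * density Q x + (B - 1) * l₂ * dipoleConv (density Q) x
    + 0 * density Q x ^ 2 + (w' - w) : ℝ) : ℂ) * Q x with hZ
  have hZl : LocallyIntegrable Z volume := by
    have h1 : MemLp (fun x => (((B - 1) * l₁ * density Q x
        + (B - 1) * l₂ * dipoleConv (density Q) x : ℝ) : ℂ)) 2 volume :=
      ((hQ.memLp_density.const_mul _).add (hQ.memLp_dipoleConv.const_mul _)).ofReal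
    have h2 := (integrable_mul_complex h1 hQ.memLp).locallyIntegrable.add
      (MemLp.locInt (hQ.memLp.const_mul ((w' - w : ℝ) : ℂ)))
    refine h2.congr (ae_of_all _ fun x => ?_)
    simp only [hZ, Pi.add_apply]
    push_cast
    ring
  have hZ0 : ∀ᵐ x, Z x = 0 := by
    refine ae_eq_zero_of_integral_contDiff_smul_eq_zero hZl fun φ h1 h2 => ?_
    have hφ : IsTest φ := ⟨h1, h2⟩
    have h3 := euler_lagrange_test hl hα hQ hN hinf (B := B) (s := 1) (w := w') rfl
      (by rw [h6, div_self (by positivity)]) rfl hφ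
    have h4 := hsw φ hφ
    have i1 := hQ.integrable_potential (B * l₁) (B * l₂) 1 w' hφ
    have i2 := hQ.integrable_potential l₁ l₂ 1 w hφ
    simp only [one_mul] at h3 i1 i2
    have h5 := h3.trans h4.symm
    rw [add_right_inj, ← sub_eq_zero, ← integral_sub i1 i2] at h5
    rw [← h5]
    refine integral_congr_ae (ae_of_all _ fun x => ?_)
    simp only [hZ, Complex.real_smul]
    push_cast
    ring
  filter_upwards [hZ0] with x hx hQx
  simp only [hZ] at hx
  have h1 := Complex.ofReal_eq_zero.mp ((mul_eq_zero.mp hx).resolve_right hQx)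
  rw [← neg_div, eq_div_iff hB1]
  linarith

/-- The constant is N(Q)/P(Q). Both N(Q) and ‖Q‖₆ are now multiples of powers of ‖∇Q‖, and
collecting exponents leaves (α - 1)/(α + 1). -/
theorem IsNormalizedOptimizer.sharpConst_eq {Q : E3 → ℂ} (hl : Unstable l₁ l₂) (hα : 0 < α)
    (h : IsNormalizedOptimizer l₁ l₂ α Q) : sharpConst l₁ l₂ α = explicitConst α Q := by
  have hNQ := h.N_eq hl hα
  obtain ⟨hopt, ⟨w, hH, hsw⟩, h6⟩ := h
  have hQ := hH.h1Data
  have hN := hopt.1.2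
  have hinf := hopt.weinstein_eq_inf hα
  rw [MemLp.normL_six_pow hQ.memLp, hQ.normGrad_sq] at h6
  have hG : normGrad Q ^ 2 = gradSq fun i x => weakGrad Q x i := hQ.normGrad_sq
  have hM := MemLp.normL_two_sq hQ.memLp
  set b := gradSq fun i x => weakGrad Q x i with hbd
  have ha := hQ.mass_pos hN
  have hb : 0 < b := hQ.gradSq_pos_of_sixth (hQ.sixth_pos hN)
  have hG0 : 0 < normGrad Q := lt_of_le_of_ne lpNorm_nonneg fun h0 => by
    rw [← h0] at hG; norm_num at hG; linarith
  have hM0 : 0 < normL 2 Q := lt_of_le_of_ne lpNorm_nonneg fun h0 => by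
    rw [← h0] at hM; norm_num at hM; linarith
  have e1 : sharpConst l₁ l₂ α = (weinsteinInf l₁ l₂ α)⁻¹ := rfl
  rw [e1, ← hinf, hQ.weinstein_eq hα, inv_div, h6, gnFun, explicitConst, ← hM, ← hbd, ← hG]
  have e2 : N l₁ l₂ Q = 4 * (1 + α) / 3 * normGrad Q ^ 2 := by rw [hG]; linarith
  rw [e2, Real.mul_rpow hα.le (by positivity), ← Real.rpow_natCast_mul hM0.le,
    ← Real.rpow_natCast_mul hG0.le, ← Real.rpow_natCast_mul hG0.le]
  have e3 : normL 2 Q ^ (((2 : ℕ) : ℝ) * (1 / 2)) = normL 2 Q := by norm_num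
  have hα' : 1 + α ≠ 0 := by positivity
  have hα'' : α + 1 ≠ 0 := by positivity
  have e4 : normGrad Q ^ 2 = normGrad Q ^ ((α - 1) / (α + 1))
      * (normGrad Q ^ (((2 : ℕ) : ℝ) * (3 / (2 * (1 + α))))
        * normGrad Q ^ (((2 : ℕ) : ℝ) * (α / (2 * (1 + α))))) := by
    rw [← Real.rpow_add hG0, ← Real.rpow_add hG0, ← Real.rpow_natCast]
    congr 1; push_cast; field_simp; ring
  rw [e3, e4]
  have p1 : 0 < normGrad Q ^ (((2 : ℕ) : ℝ) * (3 / (2 * (1 + α)))) := by positivity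
  have p2 : 0 < normGrad Q ^ (((2 : ℕ) : ℝ) * (α / (2 * (1 + α)))) := by positivity
  have p3 : 0 < α ^ (α / (2 * (1 + α))) := by positivity
  field_simp

end NormalizedOptimizer

end DipolarNLS

end

theorem mainTheorem9 (l₁ l₂ : ℝ) (hl : DipolarNLS.Unstable l₁ l₂) (α : ℝ) (hα : 0 < α) :
    0 < DipolarNLS.sharpConst l₁ l₂ α ∧
    IsLeast {C : ℝ | ∀ f : DipolarNLS.E3 → ℂ, DipolarNLS.MemH1 f →
        DipolarNLS.N l₁ l₂ f ≤ C * DipolarNLS.gnProduct α f}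
      (DipolarNLS.sharpConst l₁ l₂ α) ∧
    (∃ Q : DipolarNLS.E3 → ℂ, DipolarNLS.IsNormalizedOptimizer l₁ l₂ α Q) ∧
    (∀ Q : DipolarNLS.E3 → ℂ, DipolarNLS.IsNormalizedOptimizer l₁ l₂ α Q →
      DipolarNLS.sharpConst l₁ l₂ α = DipolarNLS.explicitConst α Q) := by
  have hm := DipolarNLS.weinsteinInf_pos hl hα
  have hC : DipolarNLS.sharpConst l₁ l₂ α = (DipolarNLS.weinsteinInf l₁ l₂ α)⁻¹ := rfl
  refine ⟨inv_pos.mpr hm, ⟨fun f hf => ?_, fun C hCf => ?_⟩,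
    DipolarNLS.exists_isNormalizedOptimizer hl hα, fun Q hQ => hQ.sharpConst_eq hl hα⟩
  · have h := hf.h1Data.weinsteinInf_mul_N_le hl hα
    rw [← hf.h1Data.gnProduct_eq hα] at h
    rw [hC, inv_mul_eq_div, le_div_iff₀ hm, mul_comm]
    exact h
  -- Any valid constant is tested on an optimizer, where equality holds for the sharp one.
  · obtain ⟨Q, hQ, -⟩ := DipolarNLS.exists_isNormalizedOptimizer hl hα
    have hN := hQ.1.2
    have h := hCf Q hQ.1.1
    rw [hC, ← hQ.weinstein_eq_inf hα, DipolarNLS.weinstein, inv_div]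
    have hP : 0 < DipolarNLS.gnProduct α Q := by
      refine lt_of_le_of_ne ?_ fun h0 => ?_
      · rw [hQ.1.1.h1Data.gnProduct_eq hα]
        exact hQ.1.1.h1Data.gnFun_nonneg
      · rw [← h0, mul_zero] at h
        exact absurd h (not_le.mpr hN)
    rwa [div_le_iff₀ hP]
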